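/- Let $j<0$ be an integer, $p=2j+1$, and let $$F(z)=z^{p}e^{Az^{2}}\,\frac{\prod_{\nu=1}^{\omega_1}\bigl(1+\frac{z^{2}}{a_\nu}\bigr)}{\prod_{\mu=1}^{\omega_2}\bigl(1-\frac{z^{2}}{b_\mu}\bigr)},\qquad F(z)\not\equiv z^{p},$$ where $A\ge 0$, $0\le\omega_1,\omega_2\le\infty$, all $a_\nu,b_\mu>0$, $\sum_\nu 1/a_\nu<\infty$ and $\sum_\mu 1/b_\mu<\infty$. Let $\alpha\in\mathbb{C}\setminus\{0\}$. An $\alpha$-point of $F$ is a solution $z$ of $F(z)=\alpha$; its multiplicity is the order of the zero of $F-\alpha$ at $z$, and it is simple (double) if its multiplicity is $1$ (resp. $2$). Let $Q_s=\{z\neq0: 0<\operatorname{Arg}(z e^{-i\pi s/2})<\pi/2\}$, $s\in\mathbb{Z}$, be the open quadrants ($Q_{s+4}=Q_s$), where $-\pi<\operatorname{Arg}\le\pi$. The $\alpha$-points of $F$, each repeated according to its multiplicity, can be listed as $(z_n)_{n=1}^{\omega}$, $0\le\omega\le\infty$, with $|z_n|\le|z_{n+1}|$ for all $n$; and for every such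 list the following holds, each assertion being understood for those indices for which the points involved exist. (i) If $\operatorname{Im}\alpha^2\neq0$, then all $\alpha$-points are simple, $0<|z_1|<|z_2|<\cdots$, $\operatorname{Im}z_n^2\ne0$ for every $n$, and $z_n\in Q_l$ implies $z_{n+1}\in Q_{l+\operatorname{sign}(\operatorname{Im}\alpha^2)}$. Moreover, $(-1)^j\operatorname{Im}\alpha\operatorname{Im}z_1>0$ and $\operatorname{Im}\alpha^2\operatorname{Re}z_1\operatorname{Im}z_1<0$. (ii) If $\operatorname{Im}\alpha=0$, then $0<|z_1|\le|z_2|<|z_3|\le|z_4|<|z_5|\le\cdots$; there are no purely imaginary $\alpha$-points, real $\alpha$-points are simple or double, and all other $\alpha$-points are simple. Moreover, for every $n\ge1$: $|z_{2n-1}|=|z_{2n}|$ implies $z_{2n-1}=\overline{z_{2n}}$; $|z_{2n-1}|<|z_{2n}|$ implies $\operatorname{Arg}z_{2n-1}=\operatorname{Arg}z_{2n}\in\{0,\pi\}$; $\operatorname{Re}z_{2n}\operatorname{Re}z_{2n+1}<0$; also $(-1)^j\alpha\operatorname{Re}z_1<0$; and $|z_1|<|z_2|$ implies $j=-1$. (iii)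 If $\operatorname{Re}\alpha=0$, then $0<|z_1|<|z_2|\le|z_3|<|z_4|\le|z_5|<\cdots$; there are no real $\alpha$-points, purely imaginary $\alpha$-points are simple or double, and all other $\alpha$-points are simple. Moreover, for every $n\ge1$: $|z_{2n}|=|z_{2n+1}|$ implies $z_{2n}=-\overline{z_{2n+1}}$; $|z_{2n}|<|z_{2n+1}|$ implies $\operatorname{Arg}z_{2n}=\operatorname{Arg}z_{2n+1}\in\{-\frac{\pi}{2},\frac{\pi}{2}\}$; $\operatorname{Im}z_{2n-1}\operatorname{Im}z_{2n}<0$; also $(-1)^j\operatorname{Im}\alpha\operatorname{Im}z_1>0$ and $\operatorname{Re}z_1=0$. -/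

import Mathlib

/-- The unimodular numbers `e_m = exp (i m π / k)`. -/
noncomputable def unitRay (k : ℕ) (m : ℤ) : ℂ :=
  Complex.exp (((m : ℝ) * Real.pi / (k : ℝ) : ℝ) * Complex.I)

/-- The open sector `Q_s` of opening `π / k`, numbered anticlockwise with `Q_{s + 2k} = Q_s`.
For `k = 2` these are the open quadrants: `Q_0` the first one, `Q_1` the second one, etc. -/
def openSector (k : ℕ) (s : ℤ) : Set ℂ :=
  {z : ℂ | z ≠ 0 ∧ 0 < Complex.arg (z * unitRay k (-s)) ∧
    Complex.arg (z * unitRay k (-s)) < Real.pi / (k : ℝ)}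

/-- The index set `{1, …, ω}`, all positive integers if `ω = ∞`, empty if `ω = 0`. -/
abbrev IndexUpTo (ω : ℕ∞) : Type := {ν : ℕ // 1 ≤ ν ∧ (ν : ℕ∞) ≤ ω}

/-- The expression
`z ^ p * exp (A z ^ k) * ∏_{ν=1}^{ω₁} (1 + z ^ k / a_ν) / ∏_{μ=1}^{ω₂} (1 - z ^ k / b_μ)`.
At its poles (the origin for `p < 0`, and the points with `z ^ k = b_μ`) Lean's division assigns
the value `0`, so that the poles are never `α`-points for `α ≠ 0`. -/
noncomputable def kthPowerForm (k : ℕ) (p : ℤ) (A : ℝ) (ω₁ ω₂ : ℕ∞) (a b : ℕ → ℝ) (z : ℂ) : ℂ :=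
  z ^ p * Complex.exp ((A : ℂ) * z ^ k) *
    (∏' ν : IndexUpTo ω₁, (1 + z ^ k / ((a ν : ℝ) : ℂ))) /
    (∏' μ : IndexUpTo ω₂, (1 - z ^ k / ((b μ : ℝ) : ℂ)))

/-- `F` is a function, other than `z ^ p`, of the form
`z ^ p * exp (A z ^ k) * ∏ (1 + z ^ k / a_ν) / ∏ (1 - z ^ k / b_μ)` with `k ≥ 2`, `p` coprime
to `k`, `A ≥ 0`, `a_ν, b_μ > 0`, each product being empty, finite, or infinite and absolutely
convergent. -/
def HasKthPowerForm (k : ℕ) (p : ℤ) (F : ℂ → ℂ) : Prop :=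
  2 ≤ k ∧ Int.gcd p k = 1 ∧
  (∃ (A : ℝ) (ω₁ ω₂ : ℕ∞) (a b : ℕ → ℝ),
    0 ≤ A ∧ (∀ ν : IndexUpTo ω₁, 0 < a ν) ∧ (∀ μ : IndexUpTo ω₂, 0 < b μ) ∧
    Summable (fun ν : IndexUpTo ω₁ => 1 / a ν) ∧ Summable (fun μ : IndexUpTo ω₂ => 1 / b μ) ∧
    F = kthPowerForm k p A ω₁ ω₂ a b) ∧
  F ≠ fun z => z ^ p

/-- The multiplicity of a solution `w` of `F w = α`: the order of vanishing of `F - α` at `w`. -/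
noncomputable def alphaMult (F : ℂ → ℂ) (α w : ℂ) : ℕ∞ :=
  analyticOrderAt (fun v => F v - α) w

/-- `z 1, z 2, …, z ω` (an infinite sequence if `ω = ∞`) is a list of all `α`-points of `F`, each
one repeated according to its multiplicity, ordered by non-decreasing absolute value. Only the
entries `z n` with `1 ≤ n ≤ ω` matter. -/
structure IsAlphaEnumeration (F : ℂ → ℂ) (α : ℂ) (ω : ℕ∞) (z : ℕ → ℂ) : Prop where
  isAlphaPoint : ∀ n : ℕ, 1 ≤ n → (n : ℕ∞) ≤ ω → F (z n) = α
  count : ∀ w : ℂ, F w = α →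
    Set.encard {n : ℕ | 1 ≤ n ∧ (n : ℕ∞) ≤ ω ∧ z n = w} = alphaMult F α w
  norm_le : ∀ n : ℕ, 1 ≤ n → ((n + 1 : ℕ) : ℕ∞) ≤ ω → ‖z n‖ ≤ ‖z (n + 1)‖

/-- Distribution of the `α`-points when `Im α² ≠ 0`. -/
def DistributionGeneric (j : ℤ) (F : ℂ → ℂ) (α : ℂ) (ω : ℕ∞) (z : ℕ → ℂ) : Prop :=
  (∀ n : ℕ, 1 ≤ n → (n : ℕ∞) ≤ ω →
    alphaMult F α (z n) = 1 ∧ 0 < ‖z n‖ ∧ (z n ^ 2).im ≠ 0) ∧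
  (∀ n : ℕ, 1 ≤ n → ((n + 1 : ℕ) : ℕ∞) ≤ ω →
    ‖z n‖ < ‖z (n + 1)‖ ∧
    ∀ l : ℤ, z n ∈ openSector 2 l →
      z (n + 1) ∈ openSector 2 (l + (SignType.sign (α ^ 2).im : ℤ))) ∧
  (1 ≤ ω → 0 < (-1 : ℝ) ^ j * α.im * (z 1).im ∧ (α ^ 2).im * (z 1).re * (z 1).im < 0)

/-- Distribution of the `α`-points when `α` is real. -/
def DistributionReal (j : ℤ) (F : ℂ → ℂ) (α : ℂ) (ω : ℕ∞) (z : ℕ → ℂ) : Prop :=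
  (∀ n : ℕ, 1 ≤ n → (n : ℕ∞) ≤ ω →
    0 < ‖z n‖ ∧ (z n).re ≠ 0 ∧
    ((z n).im = 0 → alphaMult F α (z n) = 1 ∨ alphaMult F α (z n) = 2) ∧
    ((z n).im ≠ 0 → alphaMult F α (z n) = 1)) ∧
  (∀ n : ℕ, 1 ≤ n → ((2 * n : ℕ) : ℕ∞) ≤ ω →
    ‖z (2 * n - 1)‖ ≤ ‖z (2 * n)‖ ∧
    (‖z (2 * n - 1)‖ = ‖z (2 * n)‖ → z (2 * n - 1) = (starRingEnd ℂ) (z (2 * n))) ∧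
    (‖z (2 * n - 1)‖ < ‖z (2 * n)‖ →
      Complex.arg (z (2 * n - 1)) = Complex.arg (z (2 * n)) ∧
      (Complex.arg (z (2 * n)) = 0 ∨ Complex.arg (z (2 * n)) = Real.pi))) ∧
  (∀ n : ℕ, 1 ≤ n → ((2 * n + 1 : ℕ) : ℕ∞) ≤ ω →
    ‖z (2 * n)‖ < ‖z (2 * n + 1)‖ ∧ (z (2 * n)).re * (z (2 * n + 1)).re < 0) ∧
  (1 ≤ ω → (-1 : ℝ) ^ j * α.re * (z 1).re < 0) ∧
  (2 ≤ ω → ‖z 1‖ < ‖z 2‖ → j = -1)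

/-- Distribution of the `α`-points when `α` is purely imaginary. -/
def DistributionImaginary (j : ℤ) (F : ℂ → ℂ) (α : ℂ) (ω : ℕ∞) (z : ℕ → ℂ) : Prop :=
  (∀ n : ℕ, 1 ≤ n → (n : ℕ∞) ≤ ω →
    0 < ‖z n‖ ∧ (z n).im ≠ 0 ∧
    ((z n).re = 0 → alphaMult F α (z n) = 1 ∨ alphaMult F α (z n) = 2) ∧
    ((z n).re ≠ 0 → alphaMult F α (z n) = 1)) ∧
  (∀ n : ℕ, 1 ≤ n → ((2 * n : ℕ) : ℕ∞) ≤ ω →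
    ‖z (2 * n - 1)‖ < ‖z (2 * n)‖ ∧ (z (2 * n - 1)).im * (z (2 * n)).im < 0) ∧
  (∀ n : ℕ, 1 ≤ n → ((2 * n + 1 : ℕ) : ℕ∞) ≤ ω →
    ‖z (2 * n)‖ ≤ ‖z (2 * n + 1)‖ ∧
    (‖z (2 * n)‖ = ‖z (2 * n + 1)‖ → z (2 * n) = -(starRingEnd ℂ) (z (2 * n + 1))) ∧
    (‖z (2 * n)‖ < ‖z (2 * n + 1)‖ →
      Complex.arg (z (2 * n)) = Complex.arg (z (2 * n + 1)) ∧
      (Complex.arg (z (2 * n + 1)) = -(Real.pi / 2) ∨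
        Complex.arg (z (2 * n + 1)) = Real.pi / 2))) ∧
  (1 ≤ ω → 0 < (-1 : ℝ) ^ j * α.im * (z 1).im ∧ (z 1).re = 0)

/-! Since `F` is odd and commutes with conjugation, it suffices to study it in the closed first
quadrant, which `z = exp u` parametrizes by the strip `0 ≤ Im u ≤ π / 2`. There `F` has an explicit
logarithm `logEval`, and its derivative in `u`, which is `z F' / F`, has positive imaginary part in
the open strip: each factor `exp (A z ^ 2)`, `1 + z ^ 2 / a` and `1 / (1 - z ^ 2 / b)` contributes a
nonnegative amount, and one of them a positive one because `F` is not `z ^ p`. Integration along a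
segment gives the inequality `logEval_cross_pos`: `Im ((G v - G u) * conj (v - u)) > 0` for `G =
logEval`, unless `u` and `v` lie on the same edge of the strip.

Everything else is drawn from this inequality. On a vertical segment it says that `|F|` decreases
strictly along a quarter circle, so that `|F| = |α|` holds at most once there; `theta` is the
argument of that point, clamped to an end of `[0, π / 2]` when there is none. Between two points of
the resulting curve it says that the argument of `F`, called `phase`, is nondecreasing in `s = log
|z|`, and strictly so except along an edge (`monotone_phase`, `phase_lt`). Near the origin the phase
equals `p * π / 2`, because `p < 0` makes `|F|` large there (`phase_near_bot`). Hence the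
`α`-points, ordered by modulus, are read off from an increasing phase, and the signs of its cosine
and sine tell the quadrant (`re_mul_cos_pos`, `im_mul_sin_pos`).

If `α` is off the axes, every open quarter turn of the phase contains exactly one admissible value,
hence at most one `α`-point. If `α` is on an axis, the admissible values are `π` apart and the phase
may rest at one of them while the curve runs along an edge. There `log |F|`, as a function of `log
|z|`, is strictly convex on the real axis and strictly concave on the imaginary one, away from zeros
and poles (`logSlope_re_lt`). A level that the phase crosses therefore carries multiplicity exactly
two: a pair of mirror points off the edge, or one double point, or the two simple ends of an
interval (`EdgeFiber.hasMass_two`). For imaginary `α` the lowest admissible value is the initial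
phase; its level set is unbounded to the left and carries at most one point
(`EdgeFiber.hasMass_of_bot`).

These counts are abstracted into `ClassIndex`, from which come both the existence of a list and,
through `IsAlphaEnumeration.class_bounds`, the class of the entry with a given index. The three
distributions then follow by comparing phases of consecutive entries. -/

/-- The product `∏ (1 + w / a i)`. -/
noncomputable def rootProd {ι : Type*} (a : ι → ℝ) (w : ℂ) : ℂ := ∏' i, (1 + w / (a i : ℂ))

/-- The sum of principal logarithms `∑ log (1 + w / a i)`. -/
noncomputable def rootLog {ι : Type*} (a : ι → ℝ) (w : ℂ) : ℂ :=
  ∑' i, Complex.log (1 + w / (a i : ℂ))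

/-! ### Products with negative zeros and the sum of the principal logarithms of their factors. -/

section RootProd

open Complex Filter Topology ComplexConjugate

variable {ι : Type*} {a : ι → ℝ}

lemma summable_div_root (hs : Summable fun i => 1 / a i) (w : ℂ) :
    Summable fun i => w / (a i : ℂ) := by
  have := (Complex.hasSum_ofReal.2 hs.hasSum).summable.mul_left w
  refine this.congr fun i => ?_
  simp [div_eq_mul_inv]

lemma summable_log_root (hs : Summable fun i => 1 / a i) (w : ℂ) :
    Summable fun i => Complex.log (1 + w / (a i : ℂ)) :=
  Complex.summable_log_one_add_of_summable (summable_div_root hs w)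

lemma one_add_div_eq_zero_iff {x : ℝ} (hx : 0 < x) (w : ℂ) :
    1 + w / (x : ℂ) = 0 ↔ w = -(x : ℂ) := by
  have : (x : ℂ) ≠ 0 := by exact_mod_cast hx.ne'
  field_simp
  constructor
  · intro h; linear_combination h
  · intro h; rw [h]; ring

lemma rootProd_eq_zero_iff (ha : ∀ i, 0 < a i) (hs : Summable fun i => 1 / a i) (w : ℂ) :
    rootProd a w = 0 ↔ ∃ i, w = -(a i : ℂ) := by
  constructor
  · intro h
    by_contra! hne
    refine tprod_one_add_ne_zero_of_summable (f := fun i => w / (a i : ℂ)) (fun i h0 => ?_)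
      (summable_div_root hs w).norm h
    exact hne i ((one_add_div_eq_zero_iff (ha i) w).1 h0)
  · rintro ⟨i, hi⟩
    exact tprod_of_exists_eq_zero ⟨i, (one_add_div_eq_zero_iff (ha i) w).2 hi⟩

lemma exp_rootLog (ha : ∀ i, 0 < a i) (hs : Summable fun i => 1 / a i) {w : ℂ}
    (hw : rootProd a w ≠ 0) : Complex.exp (rootLog a w) = rootProd a w := by
  refine Complex.cexp_tsum_eq_tprod (fun i h0 => hw ?_) (summable_log_root hs w)
  exact (rootProd_eq_zero_iff ha hs w).2 ⟨i, (one_add_div_eq_zero_iff (ha i) w).1 h0⟩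

lemma rootProd_conj (hs : Summable fun i => 1 / a i) (w : ℂ) :
    rootProd a (conj w) = conj (rootProd a w) := by
  have hm : Multipliable fun i => (1 + w / (a i : ℂ)) :=
    Complex.multipliable_one_add_of_summable (summable_div_root hs w)
  have := hm.map_tprod (starRingEnd ℂ) Complex.continuous_conj
  unfold rootProd
  rw [this]
  simp

lemma rootProd_zero : rootProd a 0 = 1 := by simp [rootProd]

lemma multipliableLocallyUniformlyOn_root (ha : ∀ i, 0 < a i)
    (hs : Summable fun i => 1 / a i) (r : ℝ) :
    MultipliableLocallyUniformlyOn (fun i w => 1 + w / (a i : ℂ)) (Metric.ball (0 : ℂ) r) := by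
  refine ⟨_, Summable.hasProdLocallyUniformlyOn_one_add Metric.isOpen_ball
    (u := fun i => r * (1 / a i)) (hs.mul_left r) ?_ ?_⟩
  · refine Filter.Eventually.of_forall fun i w hw => ?_
    have hi := ha i
    rw [mem_ball_zero_iff] at hw
    rw [norm_div, Complex.norm_real, Real.norm_of_nonneg hi.le, ← div_eq_mul_one_div]
    gcongr
  · intro i; fun_prop

lemma differentiable_rootProd (ha : ∀ i, 0 < a i) (hs : Summable fun i => 1 / a i) :
    Differentiable ℂ (rootProd a) := by
  intro w
  have hw : w ∈ Metric.ball (0 : ℂ) (‖w‖ + 1) := by simp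
  have := (multipliableLocallyUniformlyOn_root ha hs (‖w‖ + 1)).hasProdLocallyUniformlyOn
  have hd := TendstoLocallyUniformlyOn.differentiableOn this (Filter.Eventually.of_forall fun s => by
    fun_prop) Metric.isOpen_ball
  exact (hd w hw).differentiableAt (Metric.isOpen_ball.mem_nhds hw)

lemma logDeriv_rootProd (ha : ∀ i, 0 < a i) (hs : Summable fun i => 1 / a i) {w : ℂ}
    (hw : rootProd a w ≠ 0) :
    HasSum (fun i => 1 / ((a i : ℂ) + w)) (logDeriv (rootProd a) w) := by
  have hne : ∀ i, 1 + w / (a i : ℂ) ≠ 0 := fun i h0 =>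
    hw ((rootProd_eq_zero_iff ha hs w).2 ⟨i, (one_add_div_eq_zero_iff (ha i) w).1 h0⟩)
  have hl : ∀ i, logDeriv (fun w : ℂ => 1 + w / (a i : ℂ)) w = 1 / ((a i : ℂ) + w) := by
    intro i
    have hi : (a i : ℂ) ≠ 0 := by exact_mod_cast (ha i).ne'
    have hd : HasDerivAt (fun w : ℂ => 1 + w / (a i : ℂ)) (1 / (a i : ℂ)) w :=
      ((hasDerivAt_id w).div_const _).const_add 1
    rw [logDeriv_apply, hd.deriv]
    field_simp
  -- For all but finitely many `i` one has `|1 + w / a i| ≥ 1 / 2`, so `2 / a i` is a majorant.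
  have hsum : Summable fun i => 1 / ((a i : ℂ) + w) := by
    have h1 : Tendsto (fun i => w / (a i : ℂ)) cofinite (𝓝 0) :=
      (summable_div_root hs w).tendsto_cofinite_zero
    have h2 : ∀ᶠ i in cofinite, ‖w / (a i : ℂ)‖ < 1 / 2 :=
      h1.norm.eventually (gt_mem_nhds (by norm_num))
    refine Summable.of_norm_bounded_eventually (hs.mul_left 2) ?_
    filter_upwards [h2] with i hi
    have hai : (a i : ℂ) ≠ 0 := by exact_mod_cast (ha i).ne'
    have h3 : (a i : ℂ) + w = a i * (1 + w / a i) := by field_simp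
    rw [h3, norm_div, norm_mul, Complex.norm_real, Real.norm_of_nonneg (ha i).le, norm_one]
    have h4 : 1 / 2 ≤ ‖1 + w / (a i : ℂ)‖ := by
      have := norm_sub_norm_le (1 : ℂ) (-(w / (a i : ℂ)))
      rw [norm_neg, norm_one, sub_neg_eq_add] at this
      linarith
    have hp := ha i
    calc 1 / (a i * ‖1 + w / (a i : ℂ)‖) ≤ 1 / (a i * (1 / 2)) := by gcongr
      _ = 2 * (1 / a i) := by field_simp
  have hx : w ∈ Metric.ball (0 : ℂ) (‖w‖ + 1) := by simp
  have key := logDeriv_tprod_eq_tsum Metric.isOpen_ball hx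
    (f := fun i w => 1 + w / (a i : ℂ)) hne (fun i => by fun_prop)
    (by simpa only [hl] using hsum) (multipliableLocallyUniformlyOn_root ha hs _) hw
  simp only [hl] at key
  change logDeriv (rootProd a) w = _ at key
  rw [key]
  exact hsum.hasSum

lemma rootLog_im (hs : Summable fun i => 1 / a i) (w : ℂ) :
    (rootLog a w).im = ∑' i, Complex.arg (1 + w / (a i : ℂ)) := by
  rw [rootLog, Complex.im_tsum (summable_log_root hs w)]
  simp [Complex.log_im]

lemma one_add_div_im (x : ℝ) (w : ℂ) : (1 + w / (x : ℂ)).im = w.im / x := by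
  simp [Complex.div_ofReal_im]

lemma rootLog_im_nonneg (ha : ∀ i, 0 < a i) (hs : Summable fun i => 1 / a i) {w : ℂ}
    (hw : 0 ≤ w.im) : 0 ≤ (rootLog a w).im := by
  rw [rootLog_im hs]
  refine tsum_nonneg fun i => Complex.arg_nonneg_iff.2 ?_
  rw [one_add_div_im]
  exact div_nonneg hw (ha i).le

lemma rootLog_im_eq_zero (hs : Summable fun i => 1 / a i) {x : ℝ}
    (hx : ∀ i, 0 ≤ 1 + x / a i) : (rootLog a x).im = 0 := by
  rw [rootLog_im hs]
  have : ∀ i, Complex.arg (1 + (x : ℂ) / (a i : ℂ)) = 0 := fun i => by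
    have := Complex.arg_ofReal_of_nonneg (hx i)
    push_cast at this
    exact this
  simp [this]

/-- Each term `1 / a i` is at most the whole sum. This leaves a neighbourhood of the origin free of
zeros, where the factors are positive at real points. -/
lemma exists_pos_le_root (ha : ∀ i, 0 < a i) (hs : Summable fun i => 1 / a i) :
    ∃ δ > 0, ∀ i, δ ≤ a i := by
  have h0 : ∀ i, 0 ≤ 1 / a i := fun i => (one_div_pos.2 (ha i)).le
  have h2 : 0 ≤ ∑' i, 1 / a i := tsum_nonneg h0
  refine ⟨1 / (1 + ∑' i, 1 / a i), by positivity, fun i => ?_⟩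
  have h1 : 1 / a i ≤ ∑' i, 1 / a i := hs.le_tsum i fun j _ => h0 j
  rw [one_div_le (by positivity) (ha i)]
  linarith

/-- The product commutes with conjugation, so it is real at real points and the sine of its argument
vanishes. -/
lemma exists_int_rootLog_im (ha : ∀ i, 0 < a i) (hs : Summable fun i => 1 / a i) {x : ℝ}
    (hx : rootProd a x ≠ 0) : ∃ k : ℤ, (rootLog a x).im = k * Real.pi := by
  have h1 := exp_rootLog ha hs hx
  have h2 : (rootProd a x).im = 0 := by
    have := rootProd_conj hs x
    rw [Complex.conj_ofReal] at this
    exact Complex.conj_eq_iff_im.1 this.symm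
  rw [← h1, Complex.exp_im] at h2
  have h3 : Real.sin (rootLog a x).im = 0 := by
    rcases mul_eq_zero.1 h2 with h | h
    · exact absurd h (Real.exp_pos _).ne'
    · exact h
  obtain ⟨k, hk⟩ := Real.sin_eq_zero_iff.1 h3
  exact ⟨k, hk.symm⟩

/-- For `|v| ≥ 1` the bound is trivial; otherwise Jordan's inequality reduces it to a bound for the
sine. It supplies the majorant for sums of arguments. -/
lemma abs_arg_one_add_le {v : ℂ} (hv : 0 ≤ v.im) : |Complex.arg (1 + v)| ≤ Real.pi * ‖v‖ := by
  have hpi := Real.pi_pos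
  rcases le_or_gt 1 ‖v‖ with h | h
  · exact (Complex.abs_arg_le_pi _).trans (by nlinarith)
  · have hre : 0 < (1 + v).re := by
      have := Complex.abs_re_le_norm v
      have := neg_abs_le v.re
      simp only [Complex.add_re, Complex.one_re]
      linarith
    have h1 : |Complex.arg (1 + v)| ≤ Real.pi / 2 := Complex.abs_arg_le_pi_div_two_iff.2 hre.le
    have h0 : 0 ≤ Complex.arg (1 + v) := Complex.arg_nonneg_iff.2 (by simpa using hv)
    have hne : 1 + v ≠ 0 := fun h => by simp [h] at hre
    rw [abs_of_nonneg h0] at h1 ⊢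
    have h2 := Real.mul_le_sin h0 h1
    rw [Complex.sin_arg] at h2
    have hre' : 0 < ‖1 + v‖ := norm_pos_iff.2 hne
    -- the distance from `1` to the ray through `1 + v` is the sine of the argument
    have h3 : (1 + v).im / ‖1 + v‖ ≤ ‖v‖ := by
      rw [div_le_iff₀ hre']
      apply le_of_sq_le_sq _ (by positivity)
      rw [mul_pow, Complex.sq_norm, Complex.sq_norm, Complex.normSq_apply, Complex.normSq_apply]
      simp only [Complex.add_im, Complex.one_im, Complex.add_re, Complex.one_re]
      -- The two sides differ by exactly this square.
      nlinarith [sq_nonneg (v.re * v.re + v.im * v.im + v.re)]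
    have h4 : 2 / Real.pi * Complex.arg (1 + v) ≤ ‖v‖ := h2.trans h3
    have h5 : Complex.arg (1 + v) ≤ Real.pi / 2 * ‖v‖ := by
      have := mul_le_mul_of_nonneg_left h4 (by positivity : 0 ≤ Real.pi / 2)
      have e : Real.pi / 2 * (2 / Real.pi * (1 + v).arg) = (1 + v).arg := by field_simp
      linarith
    nlinarith [norm_nonneg v]

/-- On the cut the principal argument is `π`, its limit from above. This one-sided continuity is
what allows zeros and poles on the edges of the strip. -/
lemma continuousOn_log_im_nonneg :
    ContinuousOn Complex.log ({z : ℂ | 0 ≤ z.im} \ {0}) := by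
  rintro z ⟨hz, hz0⟩
  by_cases h : z ∈ slitPlane
  · exact (continuousAt_clog h).continuousWithinAt
  · rw [Complex.mem_slitPlane_iff] at h
    push Not at h
    have hre : z.re < 0 := lt_of_le_of_ne h.1 fun h0 => hz0 (Complex.ext h0 h.2)
    exact (Complex.continuousWithinAt_log_of_re_neg_of_im_zero hre h.2).mono Set.sdiff_subset

/-- Along a path in the closed upper half plane avoiding the zeros of the product, the sum of the
arguments of the factors is continuous. -/
lemma continuous_rootLog_im (ha : ∀ i, 0 < a i) (hs : Summable fun i => 1 / a i) {γ : ℝ → ℂ}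
    (hγ : Continuous γ) (him : ∀ s, 0 ≤ (γ s).im) (h0 : ∀ s, rootProd a (γ s) ≠ 0) :
    Continuous fun s => (rootLog a (γ s)).im := by
  rw [continuous_iff_continuousAt]
  intro s
  -- The path is bounded on this neighbourhood, which makes the majorant of the series of arguments
  -- uniform.
  set U : Set ℝ := {t | ‖γ t‖ < ‖γ s‖ + 1}
  have hU : IsOpen U := isOpen_lt hγ.norm continuous_const
  have hsU : s ∈ U := by simp [U]
  simp only [rootLog_im hs]
  refine ContinuousOn.continuousAt (s := U) ?_ (hU.mem_nhds hsU)
  refine continuousOn_tsum (u := fun i => Real.pi * (‖γ s‖ + 1) * (1 / a i)) (fun i => ?_)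
    (hs.mul_left _) (fun i t ht => ?_)
  · have : (fun t => Complex.arg (1 + γ t / (a i : ℂ))) =
        fun t => (Complex.log (1 + γ t / (a i : ℂ))).im := by
      ext; rw [Complex.log_im]
    rw [this]
    refine (Complex.continuous_im.comp_continuousOn (continuousOn_log_im_nonneg.comp
      (f := fun t => 1 + γ t / (a i : ℂ)) (by fun_prop) fun t _ => ⟨?_, fun h => h0 t ?_⟩))
    · change 0 ≤ (1 + γ t / (a i : ℂ)).im
      rw [one_add_div_im]
      exact div_nonneg (him t) (ha i).le
    · exact (rootProd_eq_zero_iff ha hs _).2 ⟨i, (one_add_div_eq_zero_iff (ha i) _).1 h⟩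
  · have hp := ha i
    have h1 : 0 ≤ (γ t / (a i : ℂ)).im := by
      rw [Complex.div_ofReal_im]; exact div_nonneg (him t) hp.le
    refine (abs_arg_one_add_le h1).trans ?_
    rw [norm_div, Complex.norm_real, Real.norm_of_nonneg hp.le, mul_assoc]
    have : ‖γ t‖ ≤ ‖γ s‖ + 1 := le_of_lt ht
    have e : (‖γ s‖ + 1) * (1 / a i) = (‖γ s‖ + 1) / a i := by ring
    rw [e]
    have := Real.pi_pos
    gcongr

end RootProd

/-! ### The basic inequality on the strip, factor by factor. -/

/-- The closed strip `0 ≤ Im u ≤ π / 2`, on which `u ↦ exp u` parametrizes the closed first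
quadrant without the origin. -/
def halfStrip : Set ℂ := {u | 0 ≤ u.im ∧ u.im ≤ Real.pi / 2}

/-- Both points lie on the same boundary line of the strip `0 ≤ Im u ≤ π / 2`. -/
def SameEdge (u v : ℂ) : Prop := u.im = v.im ∧ (u.im = 0 ∨ u.im = Real.pi / 2)

section Strip

open Complex Filter Topology ComplexConjugate

/-- Along the segment, `Im (φ * conj (v - u))` has derivative `Im φ' * |v - u| ^ 2`. Only continuity
is asked at the ends, since these may lie on the cut of a logarithm. -/
lemma im_mul_conj_pos_of_deriv {φ φ' : ℂ → ℂ} {u v : ℂ} (huv : u ≠ v)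
    (hc : ∀ t ∈ Set.Icc (0 : ℝ) 1, ContinuousWithinAt (fun t : ℝ => φ (u + t * (v - u)))
      (Set.Icc 0 1) t)
    (hd : ∀ t ∈ Set.Ioo (0 : ℝ) 1, HasDerivAt φ (φ' (u + t * (v - u))) (u + t * (v - u)) ∧
      0 < (φ' (u + t * (v - u))).im) :
    0 < ((φ v - φ u) * conj (v - u)).im := by
  set f : ℝ → ℝ := fun t => (φ (u + t * (v - u)) * conj (v - u)).im
  have hf : StrictMonoOn f (Set.Icc 0 1) := by
    refine strictMonoOn_of_deriv_pos (convex_Icc 0 1) ?_ ?_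
    · exact Complex.continuous_im.comp_continuousOn
        (ContinuousOn.mul (fun t ht => hc t ht) continuousOn_const)
    · intro t ht
      rw [interior_Icc] at ht
      obtain ⟨h1, h2⟩ := hd t ht
      have h3 : HasDerivAt (fun t : ℝ => u + (t : ℂ) * (v - u)) (v - u) t := by
        have := ((hasDerivAt_id (t : ℂ)).mul_const (v - u)).const_add u
        simpa using this.comp_ofReal
      have h4 := (h1.comp t h3).mul_const (conj (v - u))
      have h5 : HasDerivAt f ((φ' (u + t * (v - u)) * (v - u) * conj (v - u)).im) t := by
        have := (Complex.imCLM.hasFDerivAt.comp_hasDerivAt t h4)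
        exact this
      rw [h5.deriv, mul_assoc, Complex.mul_conj, Complex.im_mul_ofReal]
      exact mul_pos h2 (Complex.normSq_pos.2 (sub_ne_zero.2 huv.symm))
  have := hf (Set.left_mem_Icc.2 zero_le_one) (Set.right_mem_Icc.2 zero_le_one) zero_lt_one
  simp only [f, ofReal_zero, zero_mul, add_zero, ofReal_one, one_mul, add_sub_cancel] at this
  rw [sub_mul, Complex.sub_im]
  linarith

lemma exp_two_mul_im (u : ℂ) : (Complex.exp (2 * u)).im =
    Real.exp (2 * u.re) * Real.sin (2 * u.im) := by
  simp [Complex.exp_im]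

lemma exp_two_mul_re (u : ℂ) : (Complex.exp (2 * u)).re =
    Real.exp (2 * u.re) * Real.cos (2 * u.im) := by
  simp [Complex.exp_re]

lemma exp_two_mul_im_nonneg {u : ℂ} (hu : u ∈ halfStrip) : 0 ≤ (Complex.exp (2 * u)).im := by
  rw [exp_two_mul_im]
  exact mul_nonneg (Real.exp_pos _).le
    (Real.sin_nonneg_of_nonneg_of_le_pi (by linarith [hu.1]) (by linarith [hu.2]))

lemma exp_two_mul_im_pos {u : ℂ} (h0 : 0 < u.im) (h1 : u.im < Real.pi / 2) :
    0 < (Complex.exp (2 * u)).im := by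
  rw [exp_two_mul_im]
  exact mul_pos (Real.exp_pos _) (Real.sin_pos_of_pos_of_lt_pi (by linarith) (by linarith))

lemma exp_two_mul_of_im_eq_zero {u : ℂ} (h : u.im = 0) :
    Complex.exp (2 * u) = (Real.exp (2 * u.re) : ℝ) := by
  apply Complex.ext
  · rw [exp_two_mul_re, h, Complex.ofReal_re]; simp
  · rw [exp_two_mul_im, h, Complex.ofReal_im]; simp

lemma exp_two_mul_of_im_eq_pi_div_two {u : ℂ} (h : u.im = Real.pi / 2) :
    Complex.exp (2 * u) = (-Real.exp (2 * u.re) : ℝ) := by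
  have e : 2 * (Real.pi / 2) = Real.pi := by ring
  apply Complex.ext
  · rw [exp_two_mul_re, h, e, Complex.ofReal_re]; simp
  · rw [exp_two_mul_im, h, e, Complex.ofReal_im]; simp

lemma segment_im {u v : ℂ} (t : ℝ) : (u + t * (v - u)).im = (1 - t) * u.im + t * v.im := by
  simp; ring

lemma segment_mem_halfStrip {u v : ℂ} (hu : u ∈ halfStrip) (hv : v ∈ halfStrip) {t : ℝ}
    (ht : t ∈ Set.Icc (0 : ℝ) 1) : u + t * (v - u) ∈ halfStrip := by
  obtain ⟨h0, h1⟩ := ht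
  obtain ⟨hu0, hu1⟩ := hu
  obtain ⟨hv0, hv1⟩ := hv
  constructor
  · rw [segment_im]; nlinarith
  · rw [segment_im]; nlinarith

/-- A convex combination reaches an extreme height only if both ends do. So the exception `SameEdge`
is exactly what keeps open segments inside the open strip. -/
lemma segment_im_pos_lt {u v : ℂ} (hu : u ∈ halfStrip) (hv : v ∈ halfStrip)
    (he : ¬ SameEdge u v) {t : ℝ} (ht : t ∈ Set.Ioo (0 : ℝ) 1) :
    0 < (u + t * (v - u)).im ∧ (u + t * (v - u)).im < Real.pi / 2 := by
  obtain ⟨h0, h1⟩ := ht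
  obtain ⟨hu0, hu1⟩ := hu
  obtain ⟨hv0, hv1⟩ := hv
  rw [segment_im]
  constructor
  · have : 0 < u.im ∨ 0 < v.im := by
      by_contra! h
      exact he ⟨by linarith, Or.inl (by linarith)⟩
    rcases this with h | h
    · have := mul_pos (sub_pos.2 h1) h; nlinarith
    · have := mul_pos h0 h; nlinarith
  · have : u.im < Real.pi / 2 ∨ v.im < Real.pi / 2 := by
      by_contra! h
      exact he ⟨by linarith, Or.inr (by linarith)⟩
    rcases this with h | h
    · have := mul_pos (sub_pos.2 h1) (sub_pos.2 h); nlinarith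
    · have := mul_pos h0 (sub_pos.2 h); nlinarith

lemma exp_cross_pos {u v : ℂ} (hu : u ∈ halfStrip) (hv : v ∈ halfStrip) (huv : u ≠ v)
    (he : ¬ SameEdge u v) :
    0 < ((Complex.exp (2 * v) - Complex.exp (2 * u)) * conj (v - u)).im := by
  refine im_mul_conj_pos_of_deriv (φ := fun x => Complex.exp (2 * x))
    (φ' := fun x => Complex.exp (2 * x) * 2) huv
    (fun t _ => Continuous.continuousWithinAt (by fun_prop)) fun t ht => ⟨?_, ?_⟩
  · simpa using ((hasDerivAt_id (u + t * (v - u))).const_mul 2).cexp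
  · have := segment_im_pos_lt hu hv he ht
    have := exp_two_mul_im_pos this.1 this.2
    simp only [Complex.mul_im, Complex.im_ofNat, Complex.re_ofNat, mul_zero, zero_add]
    linarith

/-- The derivative of `log (1 + exp (2 y) / x)` is `2 - 2 x / (x + exp (2 y))`, whose imaginary part
has the sign of `Im (exp (2 y))`, positive in the open strip. -/
lemma log_root_cross_pos {u v : ℂ} (hu : u ∈ halfStrip) (hv : v ∈ halfStrip) (huv : u ≠ v)
    (he : ¬ SameEdge u v) {x : ℝ} (hx : 0 < x) (hu0 : 1 + Complex.exp (2 * u) / x ≠ 0)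
    (hv0 : 1 + Complex.exp (2 * v) / x ≠ 0) :
    0 < ((Complex.log (1 + Complex.exp (2 * v) / x) - Complex.log (1 + Complex.exp (2 * u) / x)) *
      conj (v - u)).im := by
  have hx' : (x : ℂ) ≠ 0 := by exact_mod_cast hx.ne'
  have hpos : ∀ t ∈ Set.Ioo (0 : ℝ) 1, 0 < (1 + Complex.exp (2 * (u + t * (v - u))) / x).im := by
    intro t ht
    have := segment_im_pos_lt hu hv he ht
    rw [one_add_div_im]
    exact div_pos (exp_two_mul_im_pos this.1 this.2) hx
  refine im_mul_conj_pos_of_deriv (φ := fun y => Complex.log (1 + Complex.exp (2 * y) / x))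
    (φ' := fun y => (Complex.exp (2 * y) * 2 / x) / (1 + Complex.exp (2 * y) / x)) huv ?_ ?_
  · refine ContinuousOn.comp (t := {z : ℂ | 0 ≤ z.im} \ {0}) continuousOn_log_im_nonneg
      (Continuous.continuousOn (by fun_prop)) fun t ht => ⟨?_, ?_⟩
    · change 0 ≤ (1 + Complex.exp (2 * (u + t * (v - u))) / x).im
      rw [one_add_div_im]
      exact div_nonneg (exp_two_mul_im_nonneg (segment_mem_halfStrip hu hv ht)) hx.le
    · intro h
      rw [Set.mem_singleton_iff] at h
      rcases eq_or_lt_of_le ht.1 with h0 | h0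
      · apply hu0; simpa [← h0] using h
      rcases eq_or_lt_of_le ht.2 with h1 | h1
      · apply hv0; simpa [h1] using h
      have := hpos t ⟨h0, h1⟩
      rw [h] at this
      simp at this
  · intro t ht
    have hp := hpos t ht
    have hw : 0 < (Complex.exp (2 * (u + t * (v - u)))).im := by
      have := segment_im_pos_lt hu hv he ht
      exact exp_two_mul_im_pos this.1 this.2
    set y := u + t * (v - u)
    constructor
    · have h1 : HasDerivAt (fun y : ℂ => Complex.exp (2 * y)) (Complex.exp (2 * y) * 2) y := by
        simpa using ((hasDerivAt_id y).const_mul 2).cexp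
      exact ((h1.div_const (x : ℂ)).const_add 1).clog
        (Complex.mem_slitPlane_iff.2 (Or.inr hp.ne'))
    · have hne : (x : ℂ) + Complex.exp (2 * y) ≠ 0 := by
        intro h
        have := congrArg Complex.im h
        simp only [Complex.add_im, Complex.ofReal_im, zero_add, Complex.zero_im] at this
        exact hw.ne' this
      have e : Complex.exp (2 * y) * 2 / x / (1 + Complex.exp (2 * y) / x) =
          2 - ((2 * x : ℝ) : ℂ) / (x + Complex.exp (2 * y)) := by
        push_cast
        have : 1 + Complex.exp (2 * y) / x ≠ 0 := by
          intro h; rw [h] at hp; simp at hp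
        field_simp
        ring
      rw [e, Complex.sub_im, Complex.im_ofNat, Complex.div_im, Complex.ofReal_im]
      simp only [Complex.add_im, Complex.ofReal_im, Complex.ofReal_re]
      have := Complex.normSq_pos.2 hne
      have : 0 < 2 * x * (0 + (Complex.exp (2 * y)).im) / Complex.normSq (x + Complex.exp (2 * y)) := by
        rw [zero_add]; positivity
      simp only [zero_mul, zero_div, zero_sub]
      linarith

lemma arg_ofReal_antitone {x y : ℝ} (h : x ≤ y) : Complex.arg y ≤ Complex.arg x := by
  rcases le_or_gt 0 y with hy | hy
  · rw [Complex.arg_ofReal_of_nonneg hy]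
    exact Complex.arg_nonneg_iff.2 (by simp)
  · rw [Complex.arg_ofReal_of_neg hy, Complex.arg_ofReal_of_neg (h.trans_lt hy)]

/-- Here `v - u` is real, so only the argument of the factor matters. It is `0` on the lower edge;
on the upper edge it jumps once, from `0` up to `π`, as the real part grows. -/
lemma log_root_cross_nonneg_of_sameEdge {u v : ℂ} (he : SameEdge u v) {x : ℝ} (hx : 0 < x) :
    0 ≤ ((Complex.log (1 + Complex.exp (2 * v) / x) - Complex.log (1 + Complex.exp (2 * u) / x)) *
      conj (v - u)).im := by
  obtain ⟨h1, h2⟩ := he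
  have hr : conj (v - u) = ((v.re - u.re : ℝ) : ℂ) := by
    apply Complex.ext <;> simp [h1]
  rw [hr, Complex.im_mul_ofReal, Complex.sub_im, Complex.log_im, Complex.log_im]
  rcases h2 with h | h
  · rw [exp_two_mul_of_im_eq_zero h, exp_two_mul_of_im_eq_zero (h1 ▸ h)]
    have : ∀ s : ℝ, Complex.arg (1 + (Real.exp s : ℝ) / (x : ℂ)) = 0 := fun s => by
      have := Complex.arg_ofReal_of_nonneg (x := 1 + Real.exp s / x) (by positivity)
      simpa using this
    rw [this, this]; simp
  · rw [exp_two_mul_of_im_eq_pi_div_two h, exp_two_mul_of_im_eq_pi_div_two (h1 ▸ h)]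
    have e : ∀ s : ℝ, 1 + ((-Real.exp s : ℝ) : ℂ) / (x : ℂ) = ((1 - Real.exp s / x : ℝ) : ℂ) :=
      fun s => by push_cast; ring
    rw [e, e]
    have key : ∀ s t : ℝ, s ≤ t → Complex.arg ((1 - Real.exp (2 * s) / x : ℝ) : ℂ) ≤
        Complex.arg ((1 - Real.exp (2 * t) / x : ℝ) : ℂ) := fun s t hst => by
      apply arg_ofReal_antitone
      gcongr
    rcases le_total u.re v.re with h3 | h3
    · exact mul_nonneg (sub_nonneg.2 (key _ _ h3)) (sub_nonneg.2 h3)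
    · exact mul_nonneg_of_nonpos_of_nonpos (sub_nonpos.2 (key _ _ h3)) (sub_nonpos.2 h3)

variable {ι : Type*} {a : ι → ℝ}

lemma hasSum_rootLog_cross (hs : Summable fun i => 1 / a i) (u v : ℂ) :
    HasSum (fun i => ((Complex.log (1 + Complex.exp (2 * v) / (a i : ℂ)) -
      Complex.log (1 + Complex.exp (2 * u) / (a i : ℂ))) * conj (v - u)).im)
      ((rootLog a (Complex.exp (2 * v)) - rootLog a (Complex.exp (2 * u))) * conj (v - u)).im := by
  have h1 := (summable_log_root hs (Complex.exp (2 * v))).hasSum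
  have h2 := (summable_log_root hs (Complex.exp (2 * u))).hasSum
  exact Complex.hasSum_im ((h1.sub h2).mul_right _)

lemma one_add_exp_div_ne_zero (ha : ∀ i, 0 < a i) (hs : Summable fun i => 1 / a i) {w : ℂ}
    (hw : rootProd a w ≠ 0) (i : ι) : 1 + w / (a i : ℂ) ≠ 0 := fun h =>
  hw ((rootProd_eq_zero_iff ha hs w).2 ⟨i, (one_add_div_eq_zero_iff (ha i) w).1 h⟩)

lemma rootLog_cross_nonneg (ha : ∀ i, 0 < a i) (hs : Summable fun i => 1 / a i) {u v : ℂ}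
    (hu : u ∈ halfStrip) (hv : v ∈ halfStrip) (hu0 : rootProd a (Complex.exp (2 * u)) ≠ 0)
    (hv0 : rootProd a (Complex.exp (2 * v)) ≠ 0) :
    0 ≤ ((rootLog a (Complex.exp (2 * v)) - rootLog a (Complex.exp (2 * u))) *
      conj (v - u)).im := by
  refine (hasSum_rootLog_cross hs u v).nonneg fun i => ?_
  by_cases he : SameEdge u v
  · exact log_root_cross_nonneg_of_sameEdge he (ha i)
  · rcases eq_or_ne u v with rfl | huv
    · simp
    · exact (log_root_cross_pos hu hv huv he (ha i) (one_add_exp_div_ne_zero ha hs hu0 i)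
        (one_add_exp_div_ne_zero ha hs hv0 i)).le

/-- The index `i` only witnesses that the product is not empty: one positive term among nonnegative
ones suffices. -/
lemma rootLog_cross_pos (ha : ∀ i, 0 < a i) (hs : Summable fun i => 1 / a i) {u v : ℂ}
    (hu : u ∈ halfStrip) (hv : v ∈ halfStrip) (hu0 : rootProd a (Complex.exp (2 * u)) ≠ 0)
    (hv0 : rootProd a (Complex.exp (2 * v)) ≠ 0) (huv : u ≠ v) (he : ¬ SameEdge u v) (i : ι) :
    0 < ((rootLog a (Complex.exp (2 * v)) - rootLog a (Complex.exp (2 * u))) *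
      conj (v - u)).im := by
  have hp : ∀ i, 0 < ((Complex.log (1 + Complex.exp (2 * v) / (a i : ℂ)) -
      Complex.log (1 + Complex.exp (2 * u) / (a i : ℂ))) * conj (v - u)).im := fun i =>
    log_root_cross_pos hu hv huv he (ha i) (one_add_exp_div_ne_zero ha hs hu0 i)
        (one_add_exp_div_ne_zero ha hs hv0 i)
  exact (hp i).trans_le (le_hasSum (hasSum_rootLog_cross hs u v) i fun j _ => (hp j).le)

/-- The reflection of the strip `0 ≤ Im u ≤ π / 2` in its middle line. -/
noncomputable def stripReflect (u : ℂ) : ℂ := conj u + (Real.pi / 2 : ℝ) * I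

lemma stripReflect_im (u : ℂ) : (stripReflect u).im = Real.pi / 2 - u.im := by
  simp [stripReflect]; ring

lemma stripReflect_mem {u : ℂ} (hu : u ∈ halfStrip) : stripReflect u ∈ halfStrip := by
  obtain ⟨h0, h1⟩ := hu
  constructor
  · rw [stripReflect_im]; linarith
  · rw [stripReflect_im]; linarith

/-- The reflection turns the factor `1 - w / b` into the conjugate of `1 + w' / b` with `w'` again
in the upper half plane. The denominator is thereby handled by the lemmas for the numerator. -/
lemma exp_two_mul_stripReflect (u : ℂ) :
    Complex.exp (2 * stripReflect u) = -conj (Complex.exp (2 * u)) := by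
  have : 2 * stripReflect u = conj (2 * u) + Real.pi * I := by
    have h2 : conj (2 : ℂ) = 2 := map_ofNat _ 2
    rw [map_mul, h2, stripReflect]
    push_cast
    ring
  rw [this, Complex.exp_add, Complex.exp_pi_mul_I, ← Complex.exp_conj]
  ring

lemma stripReflect_sub (u v : ℂ) : stripReflect v - stripReflect u = conj (v - u) := by
  simp [stripReflect]

lemma sameEdge_stripReflect_iff (u v : ℂ) :
    SameEdge (stripReflect u) (stripReflect v) ↔ SameEdge u v := by
  unfold SameEdge
  rw [stripReflect_im, stripReflect_im]
  constructor
  · rintro ⟨h1, h2⟩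
    exact ⟨by linarith, h2.elim (fun h => Or.inr (by linarith)) fun h => Or.inl (by linarith)⟩
  · rintro ⟨h1, h2⟩
    exact ⟨by linarith, h2.elim (fun h => Or.inr (by linarith)) fun h => Or.inl (by linarith)⟩

end Strip

/-! ### Continuous dependence of a sign change on a parameter. -/

section Crossing

open Filter Topology

/-- A continuous family of functions on `[0, L]`, each of which can change sign only once and only
from positive to negative, has a continuous choice of sign-change points. -/
lemma exists_continuous_crossing {D : ℝ → ℝ → ℝ} (hD : Continuous fun x : ℝ × ℝ => D x.1 x.2)
    {L : ℝ} (hL : 0 ≤ L)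
    (h : ∀ s, ∀ t ∈ Set.Icc 0 L, ∀ t' ∈ Set.Icc 0 L, t < t' → D s t ≤ 0 → D s t' < 0) :
    ∃ θ : ℝ → ℝ, Continuous θ ∧ ∀ s, θ s ∈ Set.Icc 0 L ∧ (0 < θ s → 0 ≤ D s (θ s)) ∧
      (θ s < L → D s (θ s) ≤ 0) := by
  have ex : ∀ s, ∃ t, t ∈ Set.Icc 0 L ∧ (0 < t → 0 ≤ D s t) ∧ (t < L → D s t ≤ 0) := by
    intro s
    rcases le_or_gt (D s 0) 0 with h0 | h0
    · exact ⟨0, ⟨le_rfl, hL⟩, fun h => absurd h (lt_irrefl _), fun _ => h0⟩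
    rcases le_or_gt 0 (D s L) with h1 | h1
    · exact ⟨L, ⟨hL, le_rfl⟩, fun _ => h1, fun h => absurd h (lt_irrefl _)⟩
    have hc : ContinuousOn (D s) (Set.Icc 0 L) :=
      (hD.comp (Continuous.prodMk_right s)).continuousOn
    obtain ⟨t, ht, h2⟩ := intermediate_value_Icc' hL hc ⟨h1.le, h0.le⟩
    exact ⟨t, ht, fun _ => h2.ge, fun _ => h2.le⟩
  choose θ hθ using ex
  refine ⟨θ, ?_, hθ⟩
  have hcs : ∀ t, Continuous fun s => D s t := fun t => hD.comp (Continuous.prodMk_left t)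
  rw [continuous_iff_continuousAt]
  intro s
  obtain ⟨hm, hp, hn⟩ := hθ s
  -- For fixed `t` below (above) `θ s` the value `D s t` is strictly positive (negative). This
  -- persists for nearby `s'` and keeps `θ s'` on the same side of `t`.
  refine tendsto_order.2 ⟨fun t ht => ?_, fun t ht => ?_⟩
  · rcases lt_or_ge t 0 with h0 | h0
    · exact Eventually.of_forall fun s' => h0.trans_le (hθ s').1.1
    have htm : t ∈ Set.Icc 0 L := ⟨h0, ht.le.trans hm.2⟩
    have hpos : 0 < D s t := by
      by_contra! hc
      exact absurd (h s t htm _ hm ht hc) (not_lt.2 (hp (h0.trans_lt ht)))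
    filter_upwards [(hcs t).continuousAt.eventually (lt_mem_nhds hpos)] with s' hs'
    by_contra! hc
    obtain ⟨hm', -, hn'⟩ := hθ s'
    have h1 := hn' (hc.trans_lt (ht.trans_le hm.2))
    rcases eq_or_lt_of_le hc with h2 | h2
    · rw [h2] at h1; linarith
    · linarith [h s' _ hm' t htm h2 h1]
  · rcases lt_or_ge L t with h0 | h0
    · exact Eventually.of_forall fun s' => (hθ s').1.2.trans_lt h0
    have htm : t ∈ Set.Icc 0 L := ⟨hm.1.trans ht.le, h0⟩
    have hneg : D s t < 0 := h s _ hm t htm ht (hn (ht.trans_le h0))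
    filter_upwards [(hcs t).continuousAt.eventually (gt_mem_nhds hneg)] with s' hs'
    by_contra! hc
    obtain ⟨hm', hp', -⟩ := hθ s'
    have h1 := hp' ((hm.1.trans_lt ht).trans_le hc)
    rcases eq_or_lt_of_le hc with h2 | h2
    · rw [← h2] at h1; linarith
    · linarith [h s' t htm _ hm' h2 hs'.le]

end Crossing

/-! ### The logarithm of the function on the strip and its basic inequality. -/

/-- The parameters of a function
`z ^ p * exp (A z ^ 2) * ∏ (1 + z ^ 2 / a i) / ∏ (1 - z ^ 2 / b i)` other than `z ^ p`. -/
structure PowerForm (ι κ : Type*) where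
  p : ℤ
  A : ℝ
  a : ι → ℝ
  b : κ → ℝ
  A_nonneg : 0 ≤ A
  a_pos : ∀ i, 0 < a i
  b_pos : ∀ i, 0 < b i
  summable_a : Summable fun i => 1 / a i
  summable_b : Summable fun i => 1 / b i
  nontrivial : 0 < A ∨ Nonempty ι ∨ Nonempty κ

namespace PowerForm

open Complex Filter Topology ComplexConjugate

variable {ι κ : Type*} (d : PowerForm ι κ)

/-- The function with the given parameters. -/
noncomputable def eval (z : ℂ) : ℂ :=
  z ^ d.p * Complex.exp (d.A * z ^ 2) * rootProd d.a (z ^ 2) / rootProd d.b (-z ^ 2)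

/-- The numerator in the coordinate `u = log z`. -/
noncomputable def num (u : ℂ) : ℂ :=
  Complex.exp (d.p * u + d.A * Complex.exp (2 * u)) * rootProd d.a (Complex.exp (2 * u))

/-- The denominator in the coordinate `u = log z`. -/
noncomputable def den (u : ℂ) : ℂ := rootProd d.b (-Complex.exp (2 * u))

/-- A logarithm of the function in the coordinate `u = log z`. -/
noncomputable def logEval (u : ℂ) : ℂ :=
  d.p * u + d.A * Complex.exp (2 * u) + rootLog d.a (Complex.exp (2 * u)) -
    conj (rootLog d.b (Complex.exp (2 * stripReflect u)))

/-- Neither a zero nor a pole. -/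
def Regular (u : ℂ) : Prop :=
  rootProd d.a (Complex.exp (2 * u)) ≠ 0 ∧ rootProd d.b (-Complex.exp (2 * u)) ≠ 0

variable {d}

lemma eval_exp (u : ℂ) : d.eval (Complex.exp u) = d.num u / d.den u := by
  have h1 : Complex.exp u ^ 2 = Complex.exp (2 * u) := by
    rw [← Complex.exp_nat_mul]; norm_num
  have h2 : Complex.exp u ^ d.p = Complex.exp (d.p * u) := (Complex.exp_int_mul u d.p).symm
  rw [eval, num, den, h1, h2, Complex.exp_add]

lemma rootProd_reflect (u : ℂ) :
    rootProd d.b (Complex.exp (2 * stripReflect u)) =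
      conj (rootProd d.b (-Complex.exp (2 * u))) := by
  rw [exp_two_mul_stripReflect, ← rootProd_conj d.summable_b, map_neg]

lemma Regular.reflect_ne_zero {u : ℂ} (h : d.Regular u) :
    rootProd d.b (Complex.exp (2 * stripReflect u)) ≠ 0 := by
  rw [rootProd_reflect]
  exact (map_ne_zero _).2 h.2

lemma Regular.exp_logEval {u : ℂ} (h : d.Regular u) :
    Complex.exp (d.logEval u) = d.eval (Complex.exp u) := by
  rw [eval_exp, logEval, num, den, Complex.exp_sub, Complex.exp_add _ (rootLog _ _),
    exp_rootLog d.a_pos d.summable_a h.1, Complex.exp_conj,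
    exp_rootLog d.b_pos d.summable_b h.reflect_ne_zero, rootProd_reflect, Complex.conj_conj]

lemma Regular.norm_eval {u : ℂ} (h : d.Regular u) :
    ‖d.eval (Complex.exp u)‖ = Real.exp (d.logEval u).re := by
  rw [← h.exp_logEval, Complex.norm_exp]

/-- The power `z ^ p` drops out because `p * (v - u) * conj (v - u)` is real. The minus sign of the
denominator cancels against the conjugation in `logEval`. -/
lemma logEval_cross (u v : ℂ) : ((d.logEval v - d.logEval u) * conj (v - u)).im =
    d.A * ((Complex.exp (2 * v) - Complex.exp (2 * u)) * conj (v - u)).im +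
    ((rootLog d.a (Complex.exp (2 * v)) - rootLog d.a (Complex.exp (2 * u))) * conj (v - u)).im +
    ((rootLog d.b (Complex.exp (2 * stripReflect v)) -
      rootLog d.b (Complex.exp (2 * stripReflect u))) *
        conj (stripReflect v - stripReflect u)).im := by
  have e1 : (d.logEval v - d.logEval u) * conj (v - u) =
      ((d.p : ℝ) : ℂ) * ((v - u) * conj (v - u)) +
      (d.A : ℂ) * ((Complex.exp (2 * v) - Complex.exp (2 * u)) * conj (v - u)) +
      (rootLog d.a (Complex.exp (2 * v)) - rootLog d.a (Complex.exp (2 * u))) * conj (v - u) -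
      conj ((rootLog d.b (Complex.exp (2 * stripReflect v)) -
        rootLog d.b (Complex.exp (2 * stripReflect u))) *
        conj (stripReflect v - stripReflect u)) := by
    rw [stripReflect_sub, logEval, logEval, map_mul, Complex.conj_conj,
      map_sub _ (rootLog d.b _)]
    push_cast
    ring
  rw [e1, Complex.mul_conj, Complex.sub_im, Complex.conj_im, Complex.add_im, Complex.add_im,
    ← Complex.ofReal_mul, Complex.ofReal_im, Complex.im_ofReal_mul]
  ring

lemma sameEdge_exp_cross {u v : ℂ} (he : SameEdge u v) :
    ((Complex.exp (2 * v) - Complex.exp (2 * u)) * conj (v - u)).im = 0 := by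
  obtain ⟨h1, h2⟩ := he
  have hr : conj (v - u) = ((v.re - u.re : ℝ) : ℂ) := by
    apply Complex.ext <;> simp [h1]
  rw [hr, Complex.im_mul_ofReal, Complex.sub_im]
  rcases h2 with h | h
  · rw [exp_two_mul_of_im_eq_zero h, exp_two_mul_of_im_eq_zero (h1 ▸ h)]
    simp only [Complex.ofReal_im, sub_self, zero_mul]
  · rw [exp_two_mul_of_im_eq_pi_div_two h, exp_two_mul_of_im_eq_pi_div_two (h1 ▸ h)]
    simp only [Complex.ofReal_im, sub_self, zero_mul]

lemma exp_cross_nonneg {u v : ℂ} (hu : u ∈ halfStrip) (hv : v ∈ halfStrip) :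
    0 ≤ ((Complex.exp (2 * v) - Complex.exp (2 * u)) * conj (v - u)).im := by
  rcases eq_or_ne u v with rfl | huv
  · simp
  by_cases he : SameEdge u v
  · exact (sameEdge_exp_cross he).ge
  · exact (exp_cross_pos hu hv huv he).le

lemma logEval_cross_nonneg {u v : ℂ} (hu : u ∈ halfStrip) (hv : v ∈ halfStrip)
    (hu0 : d.Regular u) (hv0 : d.Regular v) :
    0 ≤ ((d.logEval v - d.logEval u) * conj (v - u)).im := by
  rw [logEval_cross]
  exact add_nonneg (add_nonneg (mul_nonneg d.A_nonneg (exp_cross_nonneg hu hv))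
    (rootLog_cross_nonneg d.a_pos d.summable_a hu hv hu0.1 hv0.1))
    (rootLog_cross_nonneg d.b_pos d.summable_b (stripReflect_mem hu) (stripReflect_mem hv)
      hu0.reflect_ne_zero hv0.reflect_ne_zero)

/-- All three contributions are nonnegative, and nontriviality makes one of them strict. -/
lemma logEval_cross_pos {u v : ℂ} (hu : u ∈ halfStrip) (hv : v ∈ halfStrip)
    (hu0 : d.Regular u) (hv0 : d.Regular v) (huv : u ≠ v) (he : ¬ SameEdge u v) :
    0 < ((d.logEval v - d.logEval u) * conj (v - u)).im := by
  rw [logEval_cross]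
  have h1 := mul_nonneg d.A_nonneg (exp_cross_nonneg hu hv)
  have h2 := rootLog_cross_nonneg d.a_pos d.summable_a hu hv hu0.1 hv0.1
  have h3 := rootLog_cross_nonneg d.b_pos d.summable_b (stripReflect_mem hu) (stripReflect_mem hv)
      hu0.reflect_ne_zero hv0.reflect_ne_zero
  rcases d.nontrivial with h | ⟨⟨i⟩⟩ | ⟨⟨i⟩⟩
  · have := mul_pos h (exp_cross_pos hu hv huv he)
    linarith
  · have := rootLog_cross_pos d.a_pos d.summable_a hu hv hu0.1 hv0.1 huv he i
    linarith
  · have hne : stripReflect u ≠ stripReflect v := by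
      intro h
      have := stripReflect_sub u v
      rw [h, sub_self, eq_comm, map_eq_zero, sub_eq_zero] at this
      exact huv this.symm
    have := rootLog_cross_pos d.b_pos d.summable_b (stripReflect_mem hu) (stripReflect_mem hv)
      hu0.reflect_ne_zero hv0.reflect_ne_zero hne (by rwa [sameEdge_stripReflect_iff]) i
    linarith

lemma sin_two_mul_eq_zero {t : ℝ} (h0 : 0 ≤ t) (h1 : t ≤ Real.pi / 2)
    (h : Real.sin (2 * t) = 0) : t = 0 ∨ t = Real.pi / 2 := by
  by_contra! hc
  have h2 : 0 < t := lt_of_le_of_ne h0 hc.1.symm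
  have h3 : t < Real.pi / 2 := lt_of_le_of_ne h1 hc.2
  exact (Real.sin_pos_of_pos_of_lt_pi (by linarith) (by linarith) : 0 < Real.sin (2 * t)).ne' h

/-- A zero needs `exp (2 u)` real and negative, which in the strip happens only on the upper edge.
The poles sit likewise on the lower edge only. -/
lemma rootProd_a_ne_zero {u : ℂ} (hu : u ∈ halfStrip) (h : u.im < Real.pi / 2) :
    rootProd d.a (Complex.exp (2 * u)) ≠ 0 := by
  rw [Ne, rootProd_eq_zero_iff d.a_pos d.summable_a]
  rintro ⟨i, hi⟩
  have him : (Complex.exp (2 * u)).im = 0 := by rw [hi]; simp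
  rw [exp_two_mul_im] at him
  have hs := (mul_eq_zero.1 him).resolve_left (Real.exp_pos _).ne'
  rcases sin_two_mul_eq_zero hu.1 hu.2 hs with h0 | h0
  · rw [exp_two_mul_of_im_eq_zero h0] at hi
    have := congrArg Complex.re hi
    rw [Complex.neg_re, Complex.ofReal_re, Complex.ofReal_re] at this
    linarith [Real.exp_pos (2 * u.re), d.a_pos i]
  · exact h.ne h0

lemma rootProd_b_ne_zero {u : ℂ} (hu : u ∈ halfStrip) (h : 0 < u.im) :
    rootProd d.b (-Complex.exp (2 * u)) ≠ 0 := by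
  rw [Ne, rootProd_eq_zero_iff d.b_pos d.summable_b]
  rintro ⟨i, hi⟩
  rw [neg_inj] at hi
  have him : (Complex.exp (2 * u)).im = 0 := by rw [hi]; simp
  rw [exp_two_mul_im] at him
  have hs := (mul_eq_zero.1 him).resolve_left (Real.exp_pos _).ne'
  rcases sin_two_mul_eq_zero hu.1 hu.2 hs with h0 | h0
  · exact h.ne' h0
  · rw [exp_two_mul_of_im_eq_pi_div_two h0] at hi
    have := congrArg Complex.re hi
    rw [Complex.ofReal_re, Complex.ofReal_re] at this
    linarith [Real.exp_pos (2 * u.re), d.b_pos i]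

lemma num_eq_zero_iff (u : ℂ) : d.num u = 0 ↔ rootProd d.a (Complex.exp (2 * u)) = 0 := by
  simp [num, Complex.exp_ne_zero]

/-! ### The level curve `|F| = exp c` and the phase along it. -/

/-- The point `s + i t`. -/
noncomputable def pt (s t : ℝ) : ℂ := ⟨s, t⟩

@[simp] lemma pt_re (s t : ℝ) : (pt s t).re = s := rfl
@[simp] lemma pt_im (s t : ℝ) : (pt s t).im = t := rfl

lemma pt_eq (s t : ℝ) : pt s t = s + t * I := by
  apply Complex.ext <;> simp

variable (d) in
/-- This is positive, zero or negative according as the function is larger than, equal to or smaller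
than `exp c` in absolute value at `exp (s + i t)`. -/
noncomputable def gap (c s t : ℝ) : ℝ := ‖d.num (pt s t)‖ - Real.exp c * ‖d.den (pt s t)‖

/-- Comparing numerator and denominator by subtraction avoids the quotient, so nothing breaks at
zeros and poles on the edges. -/
lemma continuous_gap (c : ℝ) : Continuous fun x : ℝ × ℝ => d.gap c x.1 x.2 := by
  have ha := (differentiable_rootProd d.a_pos d.summable_a).continuous
  have hb := (differentiable_rootProd d.b_pos d.summable_b).continuous
  simp only [gap, num, den, pt_eq]
  fun_prop

lemma Regular.den_ne_zero {u : ℂ} (h : d.Regular u) : d.den u ≠ 0 := h.2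

lemma Regular.gap_eq {c s t : ℝ} (h : d.Regular (pt s t)) :
    d.gap c s t = ‖d.den (pt s t)‖ * (Real.exp (d.logEval (pt s t)).re - Real.exp c) := by
  rw [← h.norm_eval, eval_exp, norm_div, gap]
  have : ‖d.den (pt s t)‖ ≠ 0 := norm_ne_zero_iff.2 h.2
  field_simp

lemma Regular.gap_nonneg_iff {c s t : ℝ} (h : d.Regular (pt s t)) :
    0 ≤ d.gap c s t ↔ c ≤ (d.logEval (pt s t)).re := by
  rw [h.gap_eq, mul_nonneg_iff_of_pos_left (norm_pos_iff.2 h.den_ne_zero), sub_nonneg, Real.exp_le_exp]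

lemma Regular.gap_pos_iff {c s t : ℝ} (h : d.Regular (pt s t)) :
    0 < d.gap c s t ↔ c < (d.logEval (pt s t)).re := by
  rw [h.gap_eq, mul_pos_iff_of_pos_left (norm_pos_iff.2 h.den_ne_zero), sub_pos, Real.exp_lt_exp]

lemma Regular.gap_nonpos_iff {c s t : ℝ} (h : d.Regular (pt s t)) :
    d.gap c s t ≤ 0 ↔ (d.logEval (pt s t)).re ≤ c := by
  rw [← not_lt, h.gap_pos_iff, not_lt]

lemma Regular.gap_neg_iff {c s t : ℝ} (h : d.Regular (pt s t)) :
    d.gap c s t < 0 ↔ (d.logEval (pt s t)).re < c := by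
  rw [← not_le, h.gap_nonneg_iff, not_le]

lemma Regular.gap_eq_zero_iff {c s t : ℝ} (h : d.Regular (pt s t)) :
    d.gap c s t = 0 ↔ (d.logEval (pt s t)).re = c := by
  rw [le_antisymm_iff, h.gap_nonneg_iff, h.gap_nonpos_iff, ← le_antisymm_iff]

/-- Off the upper edge there are no zeros, and at a pole the gap would be positive. -/
lemma regular_of_gap_nonpos {c s t : ℝ} (hu : pt s t ∈ halfStrip) (ht : t < Real.pi / 2)
    (h : d.gap c s t ≤ 0) : d.Regular (pt s t) := by
  refine ⟨rootProd_a_ne_zero hu ht, fun h0 => ?_⟩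
  have h1 : 0 < ‖d.num (pt s t)‖ := norm_pos_iff.2
    (mt (num_eq_zero_iff _).1 (rootProd_a_ne_zero hu ht))
  rw [gap, den, h0] at h
  simp only [norm_zero, mul_zero, sub_zero] at h
  linarith

lemma regular_of_gap_nonneg {c s t : ℝ} (hu : pt s t ∈ halfStrip) (ht : 0 < t)
    (h : 0 ≤ d.gap c s t) : d.Regular (pt s t) := by
  refine ⟨fun h0 => ?_, rootProd_b_ne_zero hu ht⟩
  have h1 : 0 < ‖d.den (pt s t)‖ := norm_pos_iff.2 (rootProd_b_ne_zero hu ht)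
  rw [gap, (num_eq_zero_iff _).2 h0] at h
  have := mul_pos (Real.exp_pos c) h1
  simp only [norm_zero] at h
  linarith

lemma pt_sub (s t s' t' : ℝ) : pt s' t' - pt s t = pt (s' - s) (t' - t) := by
  apply Complex.ext <;> simp

lemma cross_pt (x : ℂ) (s t : ℝ) : (x * conj (pt s t)).im = x.im * s - x.re * t := by
  simp only [Complex.mul_im, Complex.conj_re, Complex.conj_im, pt_re, pt_im]
  ring

/-- On a vertical segment the basic inequality says that `Re logEval` strictly decreases upwards.
The assumed signs of the gap already guarantee regularity at both ends. -/
lemma gap_sign_change (c s : ℝ) {t t' : ℝ} (ht : t ∈ Set.Icc 0 (Real.pi / 2))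
    (ht' : t' ∈ Set.Icc 0 (Real.pi / 2)) (hlt : t < t') (h : d.gap c s t ≤ 0) :
    d.gap c s t' < 0 := by
  by_contra! hc
  have hr := regular_of_gap_nonpos (d := d) (c := c) (s := s) ht (hlt.trans_le ht'.2) h
  have hr' := regular_of_gap_nonneg (d := d) (c := c) (s := s) ht' (ht.1.trans_lt hlt) hc
  have h1 := hr.gap_nonpos_iff.1 h
  have h2 := hr'.gap_nonneg_iff.1 hc
  have key := logEval_cross_pos (d := d) (u := pt s t) (v := pt s t') ht ht' hr hr'
    (fun h => hlt.ne (congrArg Complex.im h)) (fun h => hlt.ne h.1)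
  rw [pt_sub, cross_pt, sub_self, mul_zero, zero_sub, Complex.sub_re] at key
  have := mul_nonneg (sub_nonneg.2 (h1.trans h2)) (sub_nonneg.2 hlt.le)
  linarith

lemma exists_theta (d : PowerForm ι κ) (c : ℝ) :
    ∃ θ : ℝ → ℝ, Continuous θ ∧ ∀ s, θ s ∈ Set.Icc 0 (Real.pi / 2) ∧
      (0 < θ s → 0 ≤ d.gap c s (θ s)) ∧ (θ s < Real.pi / 2 → d.gap c s (θ s) ≤ 0) :=
  exists_continuous_crossing (continuous_gap c) (by have := Real.pi_pos; positivity)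
    fun s _ ht _ ht' => gap_sign_change c s ht ht'

variable (d) in
/-- The argument, between `0` and `π / 2`, at which the function has absolute value `exp c` on the
circle of radius `exp s`; an end point of the interval if there is no such argument. -/
noncomputable def theta (c : ℝ) : ℝ → ℝ := Classical.choose (d.exists_theta c)

lemma continuous_theta (c : ℝ) : Continuous (d.theta c) :=
  (Classical.choose_spec (d.exists_theta c)).1

lemma theta_mem (c s : ℝ) : d.theta c s ∈ Set.Icc 0 (Real.pi / 2) :=
  ((Classical.choose_spec (d.exists_theta c)).2 s).1

lemma gap_theta_nonneg {c s : ℝ} (h : 0 < d.theta c s) : 0 ≤ d.gap c s (d.theta c s) :=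
  ((Classical.choose_spec (d.exists_theta c)).2 s).2.1 h

lemma gap_theta_nonpos {c s : ℝ} (h : d.theta c s < Real.pi / 2) :
    d.gap c s (d.theta c s) ≤ 0 :=
  ((Classical.choose_spec (d.exists_theta c)).2 s).2.2 h

lemma theta_le {c s t : ℝ} (ht : t ∈ Set.Icc 0 (Real.pi / 2)) (h : d.gap c s t ≤ 0) :
    d.theta c s ≤ t := by
  by_contra! hc
  have := gap_sign_change c s ht (theta_mem c s) hc h
  exact absurd (gap_theta_nonneg (ht.1.trans_lt hc)) (not_le.2 this)

lemma le_theta {c s t : ℝ} (ht : t ∈ Set.Icc 0 (Real.pi / 2)) (h : 0 ≤ d.gap c s t) :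
    t ≤ d.theta c s := by
  by_contra! hc
  have := gap_sign_change c s (theta_mem c s) ht hc (gap_theta_nonpos (hc.trans_le ht.2))
  exact absurd h (not_le.2 this)

lemma theta_eq {c s t : ℝ} (ht : t ∈ Set.Icc 0 (Real.pi / 2)) (h : d.gap c s t = 0) :
    d.theta c s = t := le_antisymm (theta_le ht h.le) (le_theta ht h.ge)

lemma theta_eq_zero_iff {c s : ℝ} : d.theta c s = 0 ↔ d.gap c s 0 ≤ 0 := by
  have hpi := Real.pi_pos
  constructor
  · intro h
    have := gap_theta_nonpos (d := d) (c := c) (s := s) (by rw [h]; positivity)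
    rwa [h] at this
  · intro h
    exact le_antisymm (theta_le ⟨le_rfl, by positivity⟩ h) (theta_mem c s).1

lemma theta_eq_pi_div_two_iff {c s : ℝ} :
    d.theta c s = Real.pi / 2 ↔ 0 ≤ d.gap c s (Real.pi / 2) := by
  have hpi := Real.pi_pos
  constructor
  · intro h
    have := gap_theta_nonneg (d := d) (c := c) (s := s) (by rw [h]; positivity)
    rwa [h] at this
  · intro h
    exact le_antisymm (theta_mem c s).2 (le_theta ⟨by positivity, le_rfl⟩ h)

variable (d) in
/-- The point of the level curve over `s`. -/
noncomputable def curve (c s : ℝ) : ℂ := pt s (d.theta c s)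

variable (d) in
/-- The argument of the function at the point of the level curve over `s`. -/
noncomputable def phase (c s : ℝ) : ℝ := (d.logEval (d.curve c s)).im

lemma curve_mem (c s : ℝ) : d.curve c s ∈ halfStrip := theta_mem c s

/-- Clamping goes to the harmless end: a pole on the lower edge pushes the curve up, and a zero on
the upper edge pushes it down. -/
lemma regular_curve (c s : ℝ) : d.Regular (d.curve c s) := by
  have hpi := Real.pi_pos
  rcases lt_or_ge (d.theta c s) (Real.pi / 2) with h | h
  · exact regular_of_gap_nonpos (curve_mem c s) h (gap_theta_nonpos h)
  · have : 0 < d.theta c s := lt_of_lt_of_le (by positivity) h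
    exact regular_of_gap_nonneg (curve_mem c s) this (gap_theta_nonneg this)

lemma logEval_im (u : ℂ) : (d.logEval u).im = d.p * u.im + d.A * (Complex.exp (2 * u)).im +
    (rootLog d.a (Complex.exp (2 * u))).im +
    (rootLog d.b (Complex.exp (2 * stripReflect u))).im := by
  rw [logEval, Complex.sub_im, Complex.conj_im, Complex.add_im, Complex.add_im,
    Complex.im_ofReal_mul]
  have : ((d.p : ℂ) * u).im = d.p * u.im := by
    rw [← Complex.ofReal_intCast, Complex.im_ofReal_mul]
  rw [this]
  ring

lemma continuous_curve (c : ℝ) : Continuous (d.curve c) := by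
  have := continuous_theta (d := d) c
  unfold curve
  simp only [pt_eq]
  fun_prop

lemma continuous_phase (c : ℝ) : Continuous (d.phase c) := by
  have hc := continuous_curve (d := d) c
  unfold phase
  simp only [logEval_im]
  have h1 : Continuous fun s => (rootLog d.a (Complex.exp (2 * d.curve c s))).im :=
    continuous_rootLog_im d.a_pos d.summable_a (by fun_prop)
      (fun s => exp_two_mul_im_nonneg (curve_mem c s)) fun s => (regular_curve c s).1
  have h2 : Continuous fun s => (rootLog d.b (Complex.exp (2 * stripReflect (d.curve c s)))).im :=
    continuous_rootLog_im d.b_pos d.summable_b (by unfold stripReflect; fun_prop)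
      (fun s => exp_two_mul_im_nonneg (stripReflect_mem (curve_mem c s)))
      fun s => (regular_curve c s).reflect_ne_zero
  have h3 : Continuous fun s => (d.curve c s).im := Complex.continuous_im.comp hc
  have h4 : Continuous fun s => (Complex.exp (2 * d.curve c s)).im := by fun_prop
  exact (((h3.const_mul _).add (h4.const_mul _)).add h1).add h2

/-- If `theta` differs at the two places, the lower point is not clamped from above, so `log |F| ≤
c` there, and the upper one is not clamped from below, so `log |F| ≥ c`. Thus clamping does not
spoil the monotonicity of the phase. -/
lemma re_mul_theta_nonneg (c s s' : ℝ) :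
    0 ≤ (d.logEval (d.curve c s') - d.logEval (d.curve c s)).re *
      (d.theta c s' - d.theta c s) := by
  have hm := theta_mem (d := d) c s
  have hm' := theta_mem (d := d) c s'
  have hr := regular_curve (d := d) c s
  have hr' := regular_curve (d := d) c s'
  rw [Complex.sub_re]
  rcases lt_trichotomy (d.theta c s) (d.theta c s') with h | h | h
  · have h1 := hr.gap_nonpos_iff.1 (gap_theta_nonpos (h.trans_le hm'.2))
    have h2 := hr'.gap_nonneg_iff.1 (gap_theta_nonneg (hm.1.trans_lt h))
    exact mul_nonneg (sub_nonneg.2 (h1.trans h2)) (sub_nonneg.2 h.le)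
  · simp [h]
  · have h1 := hr.gap_nonneg_iff.1 (gap_theta_nonneg (hm'.1.trans_lt h))
    have h2 := hr'.gap_nonpos_iff.1 (gap_theta_nonpos (h.trans_le hm.2))
    exact mul_nonneg_of_nonpos_of_nonpos (sub_nonpos.2 (h2.trans h1)) (sub_nonpos.2 h.le)

/-- The basic inequality between two points of the curve reads `Im ΔG * Δs - Re ΔG * Δθ ≥ 0`, and
the second product is nonnegative by `re_mul_theta_nonneg`. -/
lemma monotone_phase (c : ℝ) : Monotone (d.phase c) := by
  intro s s' hss
  rcases eq_or_lt_of_le hss with rfl | hlt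
  · exact le_rfl
  have key := logEval_cross_nonneg (curve_mem (d := d) c s) (curve_mem c s') (regular_curve c s)
    (regular_curve c s')
  have h1 := re_mul_theta_nonneg (d := d) c s s'
  have e : (d.curve c s' - d.curve c s) = pt (s' - s) (d.theta c s' - d.theta c s) := pt_sub _ _ _ _
  rw [e, cross_pt, Complex.sub_im] at key
  have : 0 ≤ (d.phase c s' - d.phase c s) * (s' - s) := by unfold phase; linarith
  have := nonneg_of_mul_nonneg_left this (sub_pos.2 hlt)
  linarith

lemma phase_lt {c s s' : ℝ} (hlt : s < s') (he : ¬ (d.theta c s = d.theta c s' ∧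
    (d.theta c s = 0 ∨ d.theta c s = Real.pi / 2))) : d.phase c s < d.phase c s' := by
  have key := logEval_cross_pos (curve_mem (d := d) c s) (curve_mem c s') (regular_curve c s)
    (regular_curve c s') (fun h => hlt.ne (congrArg Complex.re h)) he
  have h1 := re_mul_theta_nonneg (d := d) c s s'
  have e : (d.curve c s' - d.curve c s) = pt (s' - s) (d.theta c s' - d.theta c s) := pt_sub _ _ _ _
  rw [e, cross_pt, Complex.sub_im] at key
  have : 0 < (d.phase c s' - d.phase c s) * (s' - s) := by unfold phase; linarith
  have := (mul_pos_iff_of_pos_right (sub_pos.2 hlt)).1 this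
  linarith

lemma eval_exp_curve {c s : ℝ} (h : d.gap c s (d.theta c s) = 0) :
    d.eval (Complex.exp (d.curve c s)) = Real.exp c * Complex.exp (d.phase c s * I) := by
  have hr := regular_curve (d := d) c s
  rw [← hr.exp_logEval]
  have h1 : (d.logEval (d.curve c s)).re = c := hr.gap_eq_zero_iff.1 h
  conv_lhs => rw [← Complex.re_add_im (d.logEval (d.curve c s))]
  rw [h1, Complex.exp_add, Complex.ofReal_exp]
  rfl

lemma gap_theta_eq_zero {c s : ℝ} (h0 : 0 < d.theta c s) (h1 : d.theta c s < Real.pi / 2) :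
    d.gap c s (d.theta c s) = 0 := le_antisymm (gap_theta_nonpos h1) (gap_theta_nonneg h0)

/-- On the positive real axis only the denominator contributes to the argument: `π` for each pole
already passed. The nonnegativity is the source of the exception `j = -1` for real `α`. -/
lemma phase_of_theta_eq_zero {c s : ℝ} (h : d.theta c s = 0) :
    0 ≤ d.phase c s ∧ ∃ k : ℤ, d.phase c s = k * Real.pi := by
  have hi : (d.curve c s).im = 0 := h
  have hi' : (stripReflect (d.curve c s)).im = Real.pi / 2 := by rw [stripReflect_im, hi, sub_zero]
  have hr := (regular_curve (d := d) c s).reflect_ne_zero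
  have hn := rootLog_im_nonneg d.b_pos d.summable_b
    (exp_two_mul_im_nonneg (stripReflect_mem (curve_mem (d := d) c s)))
  rw [exp_two_mul_of_im_eq_pi_div_two hi'] at hr hn
  obtain ⟨k, hk⟩ := exists_int_rootLog_im d.b_pos d.summable_b hr
  have h1 : (rootLog d.a (Real.exp (2 * (d.curve c s).re) : ℝ)).im = 0 :=
    rootLog_im_eq_zero d.summable_a fun i => by have := d.a_pos i; positivity
  have e : d.phase c s = k * Real.pi := by
    rw [phase, logEval_im, exp_two_mul_of_im_eq_zero hi, exp_two_mul_of_im_eq_pi_div_two hi', h1, hk,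
      hi, Complex.ofReal_im]
    ring
  exact ⟨by rw [e, ← hk]; exact hn, k, e⟩

lemma phase_of_theta_eq_pi_div_two {c s : ℝ} (h : d.theta c s = Real.pi / 2) :
    d.phase c s = d.p * (Real.pi / 2) + (rootLog d.a (-Real.exp (2 * s) : ℝ)).im ∧
    ∃ k : ℤ, d.phase c s = d.p * (Real.pi / 2) + k * Real.pi := by
  have hi : (d.curve c s).im = Real.pi / 2 := h
  have hi' : (stripReflect (d.curve c s)).im = 0 := by rw [stripReflect_im, hi, sub_self]
  have hr := (regular_curve (d := d) c s).1
  rw [exp_two_mul_of_im_eq_pi_div_two hi] at hr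
  obtain ⟨k, hk⟩ := exists_int_rootLog_im d.a_pos d.summable_a hr
  have h1 : (rootLog d.b (Real.exp (2 * (stripReflect (d.curve c s)).re) : ℝ)).im = 0 :=
    rootLog_im_eq_zero d.summable_b fun i => by have := d.b_pos i; positivity
  have e : d.phase c s = d.p * (Real.pi / 2) + (rootLog d.a (-Real.exp (2 * s) : ℝ)).im := by
    rw [phase, logEval_im, exp_two_mul_of_im_eq_pi_div_two hi, exp_two_mul_of_im_eq_zero hi', h1,
      hi, Complex.ofReal_im]
    simp only [curve, pt_re, mul_zero, add_zero]
  exact ⟨e, k, by rw [e]; simp only [curve, pt_re] at hk; rw [hk]⟩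

lemma phase_near_bot (hp : d.p < 0) (c : ℝ) :
    ∃ s₀, ∀ s ≤ s₀, d.phase c s = d.p * (Real.pi / 2) := by
  obtain ⟨δ, hδ, hle⟩ := exists_pos_le_root d.a_pos d.summable_a
  have ha := (differentiable_rootProd d.a_pos d.summable_a).continuous
  have hb := (differentiable_rootProd d.b_pos d.summable_b).continuous
  have hbot : Tendsto (fun s : ℝ => 2 * s) atBot atBot :=
    tendsto_id.const_mul_atBot (by norm_num)
  have hexp : Tendsto (fun s : ℝ => Real.exp (2 * s)) atBot (𝓝 0) :=
    Real.tendsto_exp_atBot.comp hbot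
  have hw : Tendsto (fun s : ℝ => Complex.exp (2 * pt s (Real.pi / 2))) atBot (𝓝 0) := by
    have : ∀ s : ℝ, Complex.exp (2 * pt s (Real.pi / 2)) = ((-Real.exp (2 * s) : ℝ) : ℂ) :=
      fun s => exp_two_mul_of_im_eq_pi_div_two rfl
    simp only [this]
    have h2 := (Complex.continuous_ofReal.tendsto _).comp hexp.neg
    rw [neg_zero, Complex.ofReal_zero] at h2
    exact h2
  -- The factor `exp (p s)` blows up since `p < 0`, while the other factors tend to `1`. So `|F| >
  -- exp c` even on the upper edge, and the curve is clamped there.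
  have hnum : Tendsto (fun s => ‖d.num (pt s (Real.pi / 2))‖) atBot atTop := by
    have e : ∀ s, ‖d.num (pt s (Real.pi / 2))‖ = Real.exp (d.p * s) *
        ‖Complex.exp (d.A * Complex.exp (2 * pt s (Real.pi / 2))) *
          rootProd d.a (Complex.exp (2 * pt s (Real.pi / 2)))‖ := by
      intro s
      rw [num, Complex.exp_add, mul_assoc, norm_mul, Complex.norm_exp]
      congr 3
      rw [← Complex.ofReal_intCast, Complex.re_ofReal_mul, pt_re]
    simp only [e]
    refine Tendsto.atTop_mul_pos (C := 1) zero_lt_one ?_ ?_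
    · exact Real.tendsto_exp_atTop.comp
        (tendsto_id.const_mul_atBot_of_neg (by exact_mod_cast hp))
    · have hcont : Continuous fun w : ℂ => ‖Complex.exp (d.A * w) * rootProd d.a w‖ := by fun_prop
      have := (hcont.tendsto 0).comp hw
      simp only [mul_zero, Complex.exp_zero, rootProd_zero, mul_one, norm_one] at this
      exact this
  have hden : Tendsto (fun s => Real.exp c * ‖d.den (pt s (Real.pi / 2))‖) atBot
      (𝓝 (Real.exp c)) := by
    have hcont : Continuous fun w : ℂ => Real.exp c * ‖rootProd d.b (-w)‖ := by fun_prop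
    have := (hcont.tendsto 0).comp hw
    simp only [neg_zero, rootProd_zero, norm_one, mul_one] at this
    exact this
  have hgap : ∀ᶠ s in atBot, 0 ≤ d.gap c s (Real.pi / 2) := by
    filter_upwards [hnum.eventually_ge_atTop (Real.exp c + 1),
      hden.eventually (gt_mem_nhds (lt_add_one _))] with s h1 h2
    rw [gap]; linarith
  -- Below the first zero every factor `1 - exp (2 s) / a i` is nonnegative, so the numerator
  -- product adds no argument.
  have hsmall : ∀ᶠ s : ℝ in atBot, Real.exp (2 * s) < δ := hexp.eventually (gt_mem_nhds hδ)
  obtain ⟨s₀, h₀⟩ := (hgap.and hsmall).exists_forall_of_atBot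
  refine ⟨s₀, fun s hs => ?_⟩
  obtain ⟨h1, h2⟩ := h₀ s hs
  rw [(phase_of_theta_eq_pi_div_two (theta_eq_pi_div_two_iff.2 h1)).1,
    rootLog_im_eq_zero d.summable_a fun i => ?_, add_zero]
  have hi := d.a_pos i
  have : Real.exp (2 * s) / d.a i ≤ 1 := by
    rw [div_le_one hi]; exact h2.le.trans (hle i)
  rw [neg_div]; linarith

lemma phase_ge (hp : d.p < 0) (c s : ℝ) : d.p * (Real.pi / 2) ≤ d.phase c s := by
  obtain ⟨s₀, h₀⟩ := phase_near_bot hp c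
  rw [← h₀ (min s s₀) (min_le_right _ _)]
  exact monotone_phase c (min_le_left _ _)

end PowerForm

/-! ### The logarithmic derivative and the multiplicities of `α`-points. -/

section LogNorm

open Complex

lemma hasDerivAt_log_norm {f : ℝ → ℂ} {Q : ℂ} {s : ℝ} (hf : HasDerivAt f (f s * Q) s)
    (h0 : f s ≠ 0) : HasDerivAt (fun t => Real.log ‖f t‖) Q.re s := by
  -- Normalizing by `f s` puts the base value at `1`, away from the cut of the logarithm.
  have h1 : HasDerivAt (fun t => f t / f s) (f s * Q / f s) s := hf.div_const _
  rw [mul_div_cancel_left₀ _ h0] at h1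
  have h2 := h1.clog_real (by rw [div_self h0]; exact Complex.one_mem_slitPlane)
  rw [div_self h0, div_one] at h2
  have h3 : HasDerivAt (fun t => (Complex.log (f t / f s)).re) Q.re s :=
    Complex.reCLM.hasFDerivAt.comp_hasDerivAt s h2
  have h4 := h3.add_const (Real.log ‖f s‖)
  refine h4.congr_of_eventuallyEq ?_
  filter_upwards [hf.continuousAt.eventually_ne h0] with t ht
  rw [Complex.log_re, norm_div, Real.log_div (norm_ne_zero_iff.2 ht) (norm_ne_zero_iff.2 h0)]
  ring

end LogNorm

namespace PowerForm

open Complex Filter Topology ComplexConjugate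

variable {ι κ : Type*} (d : PowerForm ι κ)

/-- The square of the variable is neither a zero nor a pole. -/
def RegularSq (w : ℂ) : Prop := rootProd d.a w ≠ 0 ∧ rootProd d.b (-w) ≠ 0

/-- The logarithmic derivative `z F' / F` as a function of `w = z ^ 2`. -/
noncomputable def logSlope (w : ℂ) : ℂ :=
  d.p + 2 * d.A * w + 2 * w * logDeriv (rootProd d.a) w + 2 * w * logDeriv (rootProd d.b) (-w)

variable {d}

lemma isOpen_regularSq : IsOpen {w | d.RegularSq w} := by
  have ha := (differentiable_rootProd d.a_pos d.summable_a).continuous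
  have hb := (differentiable_rootProd d.b_pos d.summable_b).continuous
  exact (isOpen_ne_fun ha continuous_const).inter
    (isOpen_ne_fun (hb.comp continuous_neg) continuous_const)

lemma differentiableAt_logDeriv_rootProd {ι : Type*} {a : ι → ℝ} (ha : ∀ i, 0 < a i)
    (hs : Summable fun i => 1 / a i) {w : ℂ} (hw : rootProd a w ≠ 0) :
    DifferentiableAt ℂ (logDeriv (rootProd a)) w := by
  have h := differentiable_rootProd ha hs
  have h1 : DifferentiableAt ℂ (deriv (rootProd a)) w :=
    (h.analyticAt w).deriv.differentiableAt
  exact h1.div (h w) hw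

lemma differentiableAt_logSlope {w : ℂ} (hw : d.RegularSq w) :
    DifferentiableAt ℂ d.logSlope w := by
  have h1 := differentiableAt_logDeriv_rootProd d.a_pos d.summable_a hw.1
  have h2 : DifferentiableAt ℂ (fun w => logDeriv (rootProd d.b) (-w)) w :=
    DifferentiableAt.comp w (differentiableAt_logDeriv_rootProd d.b_pos d.summable_b hw.2)
      differentiableAt_id.neg
  unfold logSlope
  fun_prop

lemma hasDerivAt_rootProd {ι : Type*} {a : ι → ℝ} (ha : ∀ i, 0 < a i)
    (hs : Summable fun i => 1 / a i) {w : ℂ} (hw : rootProd a w ≠ 0) :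
    HasDerivAt (rootProd a) (rootProd a w * logDeriv (rootProd a) w) w := by
  rw [logDeriv_apply, mul_div_cancel₀ _ hw]
  exact (differentiable_rootProd ha hs w).hasDerivAt

lemma hasDerivAt_eval {z : ℂ} (hz : z ≠ 0) (hw : d.RegularSq (z ^ 2)) :
    HasDerivAt d.eval (d.eval z * d.logSlope (z ^ 2) / z) z := by
  have hsq : HasDerivAt (fun z : ℂ => z ^ 2) (2 * z) z := by simpa using hasDerivAt_pow 2 z
  have h1 := hasDerivAt_zpow d.p z (Or.inl hz)
  have h2 := (hsq.const_mul (d.A : ℂ)).cexp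
  have h3 := HasDerivAt.comp z (hasDerivAt_rootProd d.a_pos d.summable_a hw.1) hsq
  have hneg : HasDerivAt (fun z : ℂ => -z ^ 2) (-(2 * z)) z := hsq.neg
  have h4 := HasDerivAt.comp z (hasDerivAt_rootProd d.b_pos d.summable_b hw.2) hneg
  have h5 := ((h1.mul h2).mul h3).div h4 hw.2
  refine h5.congr_deriv ?_
  have hb : rootProd d.b (-z ^ 2) ≠ 0 := hw.2
  simp only [Pi.mul_apply, Function.comp_apply, eval, logSlope]
  rw [zpow_sub_one₀ hz]
  field_simp
  ring

lemma im_two_mul_div_add (x : ℝ) {w : ℂ} (h : (x : ℂ) + w ≠ 0) :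
    (2 * w * (1 / ((x : ℂ) + w))).im = w.im * (2 * x / Complex.normSq (x + w)) := by
  have e : 2 * w * (1 / ((x : ℂ) + w)) = 2 - ((2 * x : ℝ) : ℂ) / (x + w) := by
    push_cast; field_simp; ring
  rw [e, Complex.sub_im, Complex.im_ofNat, Complex.div_im, Complex.ofReal_im, Complex.ofReal_re,
    Complex.add_im, Complex.ofReal_im]
  ring

lemma add_ne_zero_of_rootProd {ι : Type*} {a : ι → ℝ} (ha : ∀ i, 0 < a i)
    (hs : Summable fun i => 1 / a i) {w : ℂ} (hw : rootProd a w ≠ 0) (i : ι) :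
    (a i : ℂ) + w ≠ 0 := fun h =>
  hw ((rootProd_eq_zero_iff ha hs w).2 ⟨i, by linear_combination h⟩)

lemma im_two_mul_logDeriv {ι : Type*} {a : ι → ℝ} (ha : ∀ i, 0 < a i)
    (hs : Summable fun i => 1 / a i) {w : ℂ} (hw : rootProd a w ≠ 0) :
    HasSum (fun i => w.im * (2 * a i / Complex.normSq (a i + w)))
      (2 * w * logDeriv (rootProd a) w).im := by
  have h := Complex.hasSum_im ((logDeriv_rootProd ha hs hw).mul_left (2 * w))
  have e : (fun i => (2 * w * (1 / ((a i : ℂ) + w))).im) =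
      fun i => w.im * (2 * a i / Complex.normSq (a i + w)) :=
    funext fun i => im_two_mul_div_add _ (add_ne_zero_of_rootProd ha hs hw i)
  rwa [e] at h

lemma exists_im_two_mul_logDeriv {ι : Type*} {a : ι → ℝ} (ha : ∀ i, 0 < a i)
    (hs : Summable fun i => 1 / a i) {w : ℂ} (hw : rootProd a w ≠ 0) (him : w.im ≠ 0) :
    ∃ M : ℝ, (2 * w * logDeriv (rootProd a) w).im = w.im * M ∧ 0 ≤ M ∧
      ∀ i, 2 * a i / Complex.normSq (a i + w) ≤ M := by
  have h := (im_two_mul_logDeriv ha hs hw).mul_left w.im⁻¹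
  simp only [inv_mul_cancel_left₀ him] at h
  have hn : ∀ i, 0 ≤ 2 * a i / Complex.normSq (a i + w) := fun i =>
    div_nonneg (by linarith [ha i]) (Complex.normSq_nonneg _)
  exact ⟨_, by rw [mul_inv_cancel_left₀ him], h.nonneg hn, fun i => le_hasSum h i fun j _ => hn j⟩

lemma logSlope_im (w : ℂ) : (d.logSlope w).im = 2 * d.A * w.im +
    (2 * w * logDeriv (rootProd d.a) w).im - (2 * -w * logDeriv (rootProd d.b) (-w)).im := by
  have e : d.logSlope w = ((d.p : ℝ) : ℂ) + ((2 * d.A : ℝ) : ℂ) * w +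
      2 * w * logDeriv (rootProd d.a) w - 2 * -w * logDeriv (rootProd d.b) (-w) := by
    rw [logSlope]; push_cast; ring
  rw [e, Complex.sub_im, Complex.add_im, Complex.add_im, Complex.im_ofReal_mul, Complex.ofReal_im,
    zero_add]

lemma logSlope_im_eq_zero {w : ℂ} (hw : d.RegularSq w) (him : w.im = 0) :
    (d.logSlope w).im = 0 := by
  have h1 := im_two_mul_logDeriv d.a_pos d.summable_a hw.1
  have h2 := im_two_mul_logDeriv d.b_pos d.summable_b hw.2
  simp only [Complex.neg_im, him, neg_zero, zero_mul] at h1 h2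
  rw [logSlope_im, him, h1.unique hasSum_zero, h2.unique hasSum_zero]
  simp

/-- The imaginary part of the logarithmic derivative is `Im w` times a factor bounded below by a
positive continuous function. -/
lemma exists_logSlope_im_bound (d : PowerForm ι κ) : ∃ m : ℂ → ℝ, ∀ w, d.RegularSq w → 0 < m w ∧
    ContinuousAt m w ∧ (w.im ≠ 0 → ∃ M, m w ≤ M ∧ (d.logSlope w).im = w.im * M) := by
  have key : ∀ w, d.RegularSq w → w.im ≠ 0 → ∃ M₁ M₂ : ℝ, (d.logSlope w).im =
      w.im * (2 * d.A + M₁ + M₂) ∧ 0 ≤ M₁ ∧ 0 ≤ M₂ ∧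
      (∀ i, 2 * d.a i / Complex.normSq (d.a i + w) ≤ M₁) ∧
      (∀ i, 2 * d.b i / Complex.normSq (d.b i + -w) ≤ M₂) := by
    intro w hw him
    obtain ⟨M₁, h1, h1', h1''⟩ := exists_im_two_mul_logDeriv d.a_pos d.summable_a hw.1 him
    obtain ⟨M₂, h2, h2', h2''⟩ := exists_im_two_mul_logDeriv d.b_pos d.summable_b hw.2
      (by simpa using him)
    refine ⟨M₁, M₂, ?_, h1', h2', h1'', h2''⟩
    rw [logSlope_im, h1, h2, Complex.neg_im]
    ring
  have hA := d.A_nonneg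
  -- A single contribution serves as the bound `m`: unlike the full sum, its continuity is
  -- immediate.
  rcases d.nontrivial with h | ⟨⟨i⟩⟩ | ⟨⟨i⟩⟩
  · refine ⟨fun _ => 2 * d.A, fun w hw => ⟨by positivity, continuousAt_const, fun him => ?_⟩⟩
    obtain ⟨M₁, M₂, h1, h2, h3, -, -⟩ := key w hw him
    exact ⟨_, by linarith, h1⟩
  · refine ⟨fun w => 2 * d.a i / Complex.normSq (d.a i + w), fun w hw => ?_⟩
    have hp := Complex.normSq_pos.2 (add_ne_zero_of_rootProd d.a_pos d.summable_a hw.1 i)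
    have hi := d.a_pos i
    refine ⟨by positivity, ?_, fun him => ?_⟩
    · refine ContinuousAt.div continuousAt_const ?_ hp.ne'
      exact Complex.continuous_normSq.continuousAt.comp (by fun_prop)
    · obtain ⟨M₁, M₂, h1, h2, h3, h4, -⟩ := key w hw him
      exact ⟨_, by linarith [h4 i], h1⟩
  · refine ⟨fun w => 2 * d.b i / Complex.normSq (d.b i + -w), fun w hw => ?_⟩
    have hp := Complex.normSq_pos.2 (add_ne_zero_of_rootProd d.b_pos d.summable_b hw.2 i)
    have hi := d.b_pos i
    refine ⟨by positivity, ?_, fun him => ?_⟩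
    · refine ContinuousAt.div continuousAt_const ?_ hp.ne'
      exact Complex.continuous_normSq.continuousAt.comp (by fun_prop)
    · obtain ⟨M₁, M₂, h1, h2, h3, -, h5⟩ := key w hw him
      exact ⟨_, by linarith [h5 i], h1⟩

lemma logSlope_ne_zero_of_im {w : ℂ} (hw : d.RegularSq w) (him : w.im ≠ 0) :
    d.logSlope w ≠ 0 := by
  obtain ⟨m, hm⟩ := d.exists_logSlope_im_bound
  obtain ⟨h1, -, h2⟩ := hm w hw
  obtain ⟨M, h3, h4⟩ := h2 him
  intro h0
  rw [h0, Complex.zero_im, eq_comm, mul_eq_zero] at h4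
  exact h4.elim him (h1.trans_le h3).ne'

/-- By the Cauchy–Riemann equations this is the derivative of `Im logSlope` in the direction `I`.
The difference quotients `Im logSlope (x + ε I) / ε` are at least `m (x + ε I)`, and the continuity
of `m` keeps the limit positive. -/
lemma deriv_logSlope_re_pos {x : ℝ} (hw : d.RegularSq x) : 0 < (deriv d.logSlope x).re := by
  obtain ⟨m, hm⟩ := d.exists_logSlope_im_bound
  obtain ⟨h1, hc, -⟩ := hm x hw
  refine h1.trans_le ?_
  have hpath : HasDerivAt (fun ε : ℝ => (x : ℂ) + ε * I) I 0 := by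
    have := ((hasDerivAt_id ((0 : ℝ) : ℂ)).mul_const I).const_add (x : ℂ)
    simpa using this.comp_ofReal
  have hd : HasDerivAt d.logSlope (deriv d.logSlope x) ((x : ℂ) + ((0 : ℝ) : ℂ) * I) := by
    simpa using (differentiableAt_logSlope hw).hasDerivAt
  have h2' : HasDerivAt (fun ε : ℝ => d.logSlope (x + ε * I)) (deriv d.logSlope x * I) 0 :=
    HasDerivAt.comp (h₂ := d.logSlope) (0 : ℝ) hd hpath
  have h2 : HasDerivAt (fun ε : ℝ => (d.logSlope (x + ε * I)).im)
      (deriv d.logSlope x * I).im 0 :=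
    Complex.imCLM.hasFDerivAt.comp_hasDerivAt 0 h2'
  have h3 : (deriv d.logSlope x * I).im = (deriv d.logSlope x).re := by simp
  rw [h3] at h2
  have h4 := (hasDerivAt_iff_tendsto_slope.1 h2).mono_left
    (nhdsWithin_mono 0 fun y (hy : (0 : ℝ) < y) => hy.ne')
  have hp0 : Tendsto (fun ε : ℝ => (x : ℂ) + ε * I) (𝓝[>] 0) (𝓝 x) := by
    have := hpath.continuousAt.tendsto.mono_left (nhdsWithin_le_nhds (s := Set.Ioi 0))
    simpa using this
  have h5 : Tendsto (fun ε : ℝ => m (x + ε * I)) (𝓝[>] 0) (𝓝 (m x)) := hc.tendsto.comp hp0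
  refine le_of_tendsto_of_tendsto h5 h4 ?_
  filter_upwards [hp0.eventually (isOpen_regularSq.mem_nhds hw), self_mem_nhdsWithin] with ε hε hpos
  have hpos' : (0 : ℝ) < ε := hpos
  have him : ((x : ℂ) + ε * I).im = ε := by simp
  obtain ⟨M, h6, h7⟩ := (hm _ hε).2.2 (by rw [him]; exact hpos'.ne')
  have h8 : (d.logSlope ((x : ℂ) + ((0 : ℝ) : ℂ) * I)).im = 0 := by
    simpa using logSlope_im_eq_zero hw (Complex.ofReal_im x)
  rw [slope_def_field, h8, h7, him, sub_zero, sub_zero, mul_div_cancel_left₀ _ hpos'.ne']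
  exact h6

/-- With `w = exp (2 s)` this is strict convexity of `log |F|` in `s` on the real axis; with `w =
-exp (2 s)`, which decreases in `s`, it is strict concavity on the imaginary axis. -/
lemma logSlope_re_lt {x y : ℝ} (hxy : x < y)
    (h : ∀ w ∈ Set.Icc x y, d.RegularSq (w : ℝ)) :
    (d.logSlope x).re < (d.logSlope y).re := by
  have hd : ∀ w ∈ Set.Icc x y, HasDerivAt (fun w : ℝ => (d.logSlope w).re)
      (deriv d.logSlope w).re w := fun w hw =>
    Complex.reCLM.hasFDerivAt.comp_hasDerivAt w
      (differentiableAt_logSlope (h w hw)).hasDerivAt.comp_ofReal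
  have hmono : StrictMonoOn (fun w : ℝ => (d.logSlope w).re) (Set.Icc x y) := by
    refine strictMonoOn_of_deriv_pos (convex_Icc x y)
      (fun w hw => (hd w hw).continuousAt.continuousWithinAt) fun w hw => ?_
    rw [interior_Icc] at hw
    have hw' := Set.Ioo_subset_Icc_self hw
    rw [(hd w hw').deriv]
    exact deriv_logSlope_re_pos (h w hw')
  exact hmono (Set.left_mem_Icc.2 hxy.le) (Set.right_mem_Icc.2 hxy.le) hxy

lemma analyticAt_eval {z : ℂ} (hz : z ≠ 0) (hw : d.RegularSq (z ^ 2)) :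
    AnalyticAt ℂ d.eval z := by
  have hopen : IsOpen {z : ℂ | z ≠ 0 ∧ d.RegularSq (z ^ 2)} :=
    isOpen_ne.inter (isOpen_regularSq.preimage (by fun_prop))
  have : DifferentiableOn ℂ d.eval {z : ℂ | z ≠ 0 ∧ d.RegularSq (z ^ 2)} := fun y hy =>
    (hasDerivAt_eval hy.1 hy.2).differentiableAt.differentiableWithinAt
  exact this.analyticAt (hopen.mem_nhds ⟨hz, hw⟩)

lemma eval_ne_zero {z : ℂ} (hz : z ≠ 0) (hw : d.RegularSq (z ^ 2)) : d.eval z ≠ 0 :=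
  div_ne_zero (mul_ne_zero (mul_ne_zero (zpow_ne_zero _ hz) (Complex.exp_ne_zero _)) hw.1) hw.2

lemma alphaMult_eq_one {z : ℂ} (hz : z ≠ 0) (hw : d.RegularSq (z ^ 2))
    (hq : d.logSlope (z ^ 2) ≠ 0) : alphaMult d.eval (d.eval z) z = 1 := by
  refine (analyticAt_eval hz hw).analyticOrderAt_sub_eq_one_of_deriv_ne_zero ?_
  rw [(hasDerivAt_eval hz hw).deriv]
  exact div_ne_zero (mul_ne_zero (eval_ne_zero hz hw) hq) hz

/-- Here `F' = F * logSlope (z ^ 2) / z` has a simple zero, because `deriv_logSlope_re_pos` forbids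
a critical point of `logSlope` at a real argument. The order of `F - α` is one more than that of
`F'`. -/
lemma alphaMult_eq_two {z : ℂ} (hz : z ≠ 0) (hw : d.RegularSq (z ^ 2)) (him : (z ^ 2).im = 0)
    (hq : d.logSlope (z ^ 2) = 0) : alphaMult d.eval (d.eval z) z = 2 := by
  have hopen : IsOpen {z : ℂ | z ≠ 0 ∧ d.RegularSq (z ^ 2)} :=
    isOpen_ne.inter (isOpen_regularSq.preimage (by fun_prop))
  have hder : deriv d.eval =ᶠ[𝓝 z] fun z => d.eval z * d.logSlope (z ^ 2) / z := by
    filter_upwards [hopen.mem_nhds ⟨hz, hw⟩] with y hy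
    exact (hasDerivAt_eval hy.1 hy.2).deriv
  have han := analyticAt_eval hz hw
  have hsq : HasDerivAt (fun z : ℂ => z ^ 2) (2 * z) z := by simpa using hasDerivAt_pow 2 z
  have h1 : HasDerivAt (fun z : ℂ => d.logSlope (z ^ 2)) (deriv d.logSlope (z ^ 2) * (2 * z)) z :=
    HasDerivAt.comp (h₂ := d.logSlope) z (differentiableAt_logSlope hw).hasDerivAt hsq
  have h2 : HasDerivAt (fun z => d.eval z * d.logSlope (z ^ 2) / z)
      (d.eval z * deriv d.logSlope (z ^ 2) * 2) z := by
    refine (((hasDerivAt_eval hz hw).mul h1).div (hasDerivAt_id z) hz).congr_deriv ?_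
    simp only [hq, id, Pi.mul_apply, mul_zero]
    field_simp
    ring
  have h3 : deriv d.logSlope (z ^ 2) ≠ 0 := by
    have e : z ^ 2 = (((z ^ 2).re : ℝ) : ℂ) := by
      apply Complex.ext
      · simp
      · rw [him, Complex.ofReal_im]
    have := deriv_logSlope_re_pos (d := d) (x := (z ^ 2).re) (by rwa [← e])
    rw [← e] at this
    intro h0
    rw [h0] at this
    simp at this
  have h4 : analyticOrderAt (deriv d.eval) z = 1 := by
    refine han.deriv.analyticOrderAt_eq_one_of_zero_deriv_ne_zero ?_ ?_
    · rw [hder.eq_of_nhds, hq]; simp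
    · rw [hder.deriv_eq, h2.deriv]
      exact mul_ne_zero (mul_ne_zero (eval_ne_zero hz hw) h3) two_ne_zero
  have := han.analyticOrderAt_deriv_add_one
  rw [h4] at this
  exact this.symm

lemma exp_sq (u : ℂ) : Complex.exp u ^ 2 = Complex.exp (2 * u) := by
  rw [← Complex.exp_nat_mul]; norm_num

lemma hasDerivAt_log_norm_eval {s t : ℝ} (h : d.Regular (pt s t)) :
    HasDerivAt (fun s => Real.log ‖d.eval (Complex.exp (pt s t))‖)
      (d.logSlope (Complex.exp (2 * pt s t))).re s := by
  have hw : d.RegularSq (Complex.exp (pt s t) ^ 2) := by rw [exp_sq]; exact h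
  have hz := Complex.exp_ne_zero (pt s t)
  refine hasDerivAt_log_norm (f := fun s => d.eval (Complex.exp (pt s t))) ?_ (eval_ne_zero hz hw)
  have h1 : HasDerivAt (fun s : ℝ => pt s t) 1 s := by
    simp only [pt_eq]
    simpa using ((hasDerivAt_id (s : ℂ)).comp_ofReal).add_const ((t : ℂ) * I)
  have h2 := (hasDerivAt_eval hz hw).comp s h1.cexp
  refine h2.congr_deriv ?_
  rw [exp_sq]
  field_simp

end PowerForm

/-! ### Level sets of the phase along an edge and the multiplicity they carry. -/

section Mass

/-- The set `W` is finite and its points, weighted by `m`, have total weight `c`. -/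
def HasMass (m : ℂ → ℕ∞) (W : Set ℂ) (c : ℕ∞) : Prop :=
  ∃ s : Finset ℂ, (s : Set ℂ) = W ∧ ∑ w ∈ s, m w = c

variable {m : ℂ → ℕ∞} {W : Set ℂ}

lemma hasMass_empty : HasMass m ∅ 0 := ⟨∅, by simp⟩

lemma hasMass_singleton {w : ℂ} {c : ℕ∞} (h : m w = c) : HasMass m {w} c := ⟨{w}, by simp [h]⟩

lemma hasMass_pair {w w' : ℂ} (hne : w ≠ w') (h : m w = 1) (h' : m w' = 1) :
    HasMass m {w, w'} 2 := by
  classical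
  refine ⟨{w, w'}, by simp, ?_⟩
  rw [Finset.sum_pair hne, h, h']
  norm_num

end Mass

open Filter Topology in
/-- The behaviour of the phase `Φ` at the level `τ`, where `η ≤ 0` is the condition that the level
curve runs along an edge, and `h` is a strictly convex function along the edge that vanishes
exactly on the level curve. -/
structure EdgeLevel (Φ η h h' : ℝ → ℝ) (τ : ℝ) : Prop where
  mono : Monotone Φ
  cont : Continuous Φ
  cont_edge : Continuous η
  lattice : ∀ s, η s ≤ 0 → ∃ k : ℤ, Φ s = τ + k * Real.pi
  edge_of_ne : ∀ s t, s ≠ t → Φ s = τ → Φ t = τ → η s ≤ 0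
  nonpos : ∀ s, η s ≤ 0 → h s ≤ 0
  zero_iff : ∀ s, η s ≤ 0 → (h s = 0 ↔ η s = 0)
  nonneg_near : ∀ s, η s ≤ 0 → ∀ᶠ t in 𝓝 s, 0 < η t → 0 ≤ h t
  deriv : ∀ s, η s ≤ 0 → HasDerivAt h (h' s) s
  deriv_lt : ∀ s t, s < t → (∀ x ∈ Set.Icc s t, η x ≤ 0) → h' s < h' t

namespace EdgeLevel

open Filter Topology

variable {Φ η h h' : ℝ → ℝ} {τ : ℝ}

lemma eq_of_between (E : EdgeLevel Φ η h h' τ) {s t x : ℝ} (hs : Φ s = τ) (ht : Φ t = τ)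
    (hx : x ∈ Set.Icc s t) : Φ x = τ :=
  le_antisymm (ht ▸ E.mono hx.2) (hs ▸ E.mono hx.1)

lemma edge_on_Icc (E : EdgeLevel Φ η h h' τ) {s t : ℝ} (hst : s < t) (hs : Φ s = τ)
    (ht : Φ t = τ) : ∀ x ∈ Set.Icc s t, η x ≤ 0 := by
  intro x hx
  have h1 := E.eq_of_between hs ht hx
  rcases eq_or_ne x s with rfl | hne
  · exact E.edge_of_ne _ _ hst.ne hs ht
  · exact E.edge_of_ne _ _ hne h1 hs

/-- On the edge the phase takes values in the lattice `τ + π ℤ`, so by continuity it cannot leave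
`τ` there without a jump. -/
lemma near_of_nonpos (E : EdgeLevel Φ η h h' τ) {s : ℝ} (hs : Φ s = τ) :
    ∀ᶠ t in 𝓝 s, η t ≤ 0 → Φ t = τ := by
  have h1 : ∀ᶠ t in 𝓝 s, |Φ t - τ| < Real.pi := by
    have hc : Continuous fun t => |Φ t - τ| := (E.cont.sub continuous_const).abs
    exact hc.continuousAt.eventually (gt_mem_nhds (by simpa [hs] using Real.pi_pos))
  filter_upwards [h1] with t ht h0
  obtain ⟨k, hk⟩ := E.lattice t h0
  rw [hk, add_sub_cancel_left, abs_mul, abs_of_pos Real.pi_pos] at ht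
  have h2 : |(k : ℝ)| < 1 := by
    by_contra! hc
    have := mul_le_mul_of_nonneg_right hc Real.pi_pos.le
    linarith
  have h3 : k = 0 := Int.abs_lt_one_iff.1 (by exact_mod_cast h2)
  rw [hk, h3]; simp

lemma level_near (E : EdgeLevel Φ η h h' τ) {s : ℝ} (hs : Φ s = τ) (h0 : η s < 0) :
    ∀ᶠ t in 𝓝 s, Φ t = τ := by
  filter_upwards [E.near_of_nonpos hs, E.cont_edge.continuousAt.eventually (gt_mem_nhds h0)]
    with t h1 h2 using h1 h2.le

/-- Otherwise strict convexity would make `h` increase strictly from `h s = 0`, against `h ≤ 0` on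
the edge. -/
lemma deriv_neg (E : EdgeLevel Φ η h h' τ) {s t : ℝ} (hst : s < t) (hs : Φ s = τ) (ht : Φ t = τ)
    (h0 : η s = 0) : h' s < 0 := by
  have he := E.edge_on_Icc hst hs ht
  by_contra! hc
  have hmono : StrictMonoOn h (Set.Icc s t) := by
    refine strictMonoOn_of_deriv_pos (convex_Icc s t)
      (fun x hx => (E.deriv x (he x hx)).continuousAt.continuousWithinAt) fun x hx => ?_
    rw [interior_Icc] at hx
    rw [(E.deriv x (he x (Set.Ioo_subset_Icc_self hx))).deriv]
    exact hc.trans_lt (E.deriv_lt s x hx.1 fun y hy => he y ⟨hy.1, hy.2.trans hx.2.le⟩)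
  have h1 := hmono (Set.left_mem_Icc.2 hst.le) (Set.right_mem_Icc.2 hst.le) hst
  have h2 := (E.zero_iff s h0.le).2 h0
  have h3 := E.nonpos t (he t (Set.right_mem_Icc.2 hst.le))
  linarith

lemma deriv_pos (E : EdgeLevel Φ η h h' τ) {s t : ℝ} (hst : s < t) (hs : Φ s = τ) (ht : Φ t = τ)
    (h0 : η t = 0) : 0 < h' t := by
  have he := E.edge_on_Icc hst hs ht
  by_contra! hc
  have hmono : StrictAntiOn h (Set.Icc s t) := by
    refine strictAntiOn_of_deriv_neg (convex_Icc s t)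
      (fun x hx => (E.deriv x (he x hx)).continuousAt.continuousWithinAt) fun x hx => ?_
    rw [interior_Icc] at hx
    rw [(E.deriv x (he x (Set.Ioo_subset_Icc_self hx))).deriv]
    exact (E.deriv_lt x t hx.2 fun y hy => he y ⟨hx.1.le.trans hy.1, hy.2⟩).trans_le hc
  have h1 := hmono (Set.left_mem_Icc.2 hst.le) (Set.right_mem_Icc.2 hst.le) hst
  have h2 := (E.zero_iff t h0.le).2 h0
  have h3 := E.nonpos s (he s (Set.left_mem_Icc.2 hst.le))
  linarith

/-- A zero of `h` inside the interval would have negative slope, seen from the right part, and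
positive slope, seen from the left part. So only the ends of a level interval can be `α`-points. -/
lemma not_between (E : EdgeLevel Φ η h h' τ) {r s t : ℝ} (hrs : r < s) (hst : s < t)
    (hr : Φ r = τ) (ht : Φ t = τ) : η s ≠ 0 := by
  intro h0
  have hs := E.eq_of_between hr ht ⟨hrs.le, hst.le⟩
  linarith [E.deriv_neg hst hs ht h0, E.deriv_pos hrs hr hs h0]

/-- With `η s < 0` the phase would be constant near `s`. If `η s = 0`, the curve leaves the edge on
both sides, so `h` has a local minimum at `s`: a double point. -/
lemma isolated (E : EdgeLevel Φ η h h' τ) {s : ℝ} (hs : Φ s = τ) (hu : ∀ t, Φ t = τ → t = s) :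
    0 ≤ η s ∧ (η s = 0 → h' s = 0) := by
  have hnear : ∀ᶠ t in 𝓝 s, η t ≤ 0 → t = s := (E.near_of_nonpos hs).mono fun t h1 h2 => hu t (h1 h2)
  constructor
  · by_contra! hc
    have h1 := E.level_near hs hc
    have h2 : ∀ᶠ t in 𝓝[>] s, Φ t = τ := h1.filter_mono nhdsWithin_le_nhds
    obtain ⟨t, ht, hgt⟩ := (h2.and self_mem_nhdsWithin).exists
    exact (ne_of_gt hgt) (hu t ht)
  · intro h0
    refine IsLocalMin.hasDerivAt_eq_zero ?_ (E.deriv s h0.le)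
    filter_upwards [hnear, E.nonneg_near s h0.le] with t h1 h2
    rw [(E.zero_iff s h0.le).2 h0]
    rcases le_or_gt (η t) 0 with h3 | h3
    · rw [h1 h3, (E.zero_iff s h0.le).2 h0]
    · exact h2 h3

/-- If `η s < 0`, the phase would stay at the level a little beyond `s`. -/
lemma max_edge_nonneg (E : EdgeLevel Φ η h h' τ) {s : ℝ} (hs : Φ s = τ)
    (hu : ∀ t, Φ t = τ → t ≤ s) : 0 ≤ η s := by
  by_contra! hc
  have h2 : ∀ᶠ t in 𝓝[>] s, Φ t = τ := (E.level_near hs hc).filter_mono nhdsWithin_le_nhds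
  obtain ⟨t, ht, hgt⟩ := (h2.and self_mem_nhdsWithin).exists
  exact (not_le.2 hgt) (hu t ht)

lemma min_edge_nonneg (E : EdgeLevel Φ η h h' τ) {s : ℝ} (hs : Φ s = τ)
    (hu : ∀ t, Φ t = τ → s ≤ t) : 0 ≤ η s := by
  by_contra! hc
  have h2 : ∀ᶠ t in 𝓝[<] s, Φ t = τ := (E.level_near hs hc).filter_mono nhdsWithin_le_nhds
  obtain ⟨t, ht, hgt⟩ := (h2.and self_mem_nhdsWithin).exists
  exact (not_le.2 hgt) (hu t ht)

lemma exists_max (E : EdgeLevel Φ η h h' τ) {s₀ s₁ : ℝ} (h0 : Φ s₀ = τ) (h1 : τ < Φ s₁) :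
    ∃ s, Φ s = τ ∧ ∀ t, Φ t = τ → t ≤ s := by
  have hcl : IsClosed {s | Φ s = τ} := isClosed_eq E.cont continuous_const
  have hbd : BddAbove {s | Φ s = τ} := ⟨s₁, fun t (ht : Φ t = τ) => by
    by_contra! hc
    have := E.mono hc.le
    linarith⟩
  exact ⟨sSup {s | Φ s = τ}, hcl.csSup_mem ⟨s₀, h0⟩ hbd, fun t ht => le_csSup hbd ht⟩

lemma exists_min (E : EdgeLevel Φ η h h' τ) {s₀ s₁ : ℝ} (h0 : Φ s₀ = τ) (h1 : Φ s₁ < τ) :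
    ∃ s, Φ s = τ ∧ ∀ t, Φ t = τ → s ≤ t := by
  have hcl : IsClosed {s | Φ s = τ} := isClosed_eq E.cont continuous_const
  have hbd : BddBelow {s | Φ s = τ} := ⟨s₁, fun t (ht : Φ t = τ) => by
    by_contra! hc
    have := E.mono hc.le
    linarith⟩
  exact ⟨sInf {s | Φ s = τ}, hcl.csInf_mem ⟨s₀, h0⟩ hbd, fun t ht => csInf_le hbd ht⟩

end EdgeLevel

/-- The points of `W` lie over the points of the level set of `Φ` at `τ`, two simple points over a
point off the edge, and one point over a point of the edge on the level curve. -/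
structure EdgeFiber (Φ η h h' : ℝ → ℝ) (τ : ℝ) (m : ℂ → ℕ∞) (W : Set ℂ) (P : ℝ → Bool → ℂ) : Prop
    extends EdgeLevel Φ η h h' τ where
  mem_iff : ∀ z, z ∈ W ↔ ∃ s ε, Φ s = τ ∧ 0 ≤ η s ∧ z = P s ε
  off_edge : ∀ s, 0 < η s → Φ s = τ → P s true ≠ P s false ∧ ∀ ε, m (P s ε) = 1
  on_edge : ∀ s, η s = 0 → Φ s = τ → P s true = P s false ∧
    (h' s = 0 → m (P s true) = 2) ∧ (h' s ≠ 0 → m (P s true) = 1)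
  norm_eq : ∀ s ε, ‖P s ε‖ = Real.exp s

namespace EdgeFiber

variable {Φ η h h' : ℝ → ℝ} {τ : ℝ} {m : ℂ → ℕ∞} {W : Set ℂ} {P : ℝ → Bool → ℂ}

lemma hasMass_of_forall_not (E : EdgeFiber Φ η h h' τ m W P) (hn : ∀ s, Φ s = τ → ¬ 0 ≤ η s) :
    HasMass m W 0 := by
  have : W = ∅ := by
    ext z
    rw [E.mem_iff]
    simp only [Set.mem_empty_iff_false, iff_false]
    rintro ⟨s, ε, h1, h2, -⟩
    exact hn s h1 h2
  rw [this]
  exact hasMass_empty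

/-- Off the edge there are two simple mirror points; on the edge they merge, and the vanishing
derivative from `isolated` makes the common point double. -/
lemma hasMass_of_unique (E : EdgeFiber Φ η h h' τ m W P) {s : ℝ} (hs : Φ s = τ)
    (hu : ∀ t, Φ t = τ → t = s) : HasMass m W 2 := by
  obtain ⟨h1, h2⟩ := E.toEdgeLevel.isolated hs hu
  have hW : W = {P s true, P s false} := by
    ext z
    rw [E.mem_iff]
    constructor
    · rintro ⟨t, ε, h3, -, rfl⟩
      rw [hu t h3]
      cases ε <;> simp
    · rintro (rfl | rfl)
      · exact ⟨s, true, hs, h1, rfl⟩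
      · exact ⟨s, false, hs, h1, rfl⟩
  rw [hW]
  rcases eq_or_lt_of_le h1 with h3 | h3
  · obtain ⟨h4, h5, -⟩ := E.on_edge s h3.symm hs
    rw [← h4, Set.pair_eq_singleton]
    exact hasMass_singleton (h5 (h2 h3.symm))
  · obtain ⟨h4, h5⟩ := E.off_edge s h3 hs
    exact hasMass_pair h4 (h5 _) (h5 _)

lemma deriv_ne_zero (E : EdgeFiber Φ η h h' τ m W P) {s t : ℝ} (hs : Φ s = τ) (ht : Φ t = τ)
    (hne : s ≠ t) (h0 : η s = 0) : h' s ≠ 0 := by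
  rcases lt_or_gt_of_ne hne with hlt | hlt
  · exact (E.toEdgeLevel.deriv_neg hlt hs ht h0).ne
  · exact (E.toEdgeLevel.deriv_pos hlt ht hs h0).ne'

lemma hasMass_one (E : EdgeFiber Φ η h h' τ m W P) {s t : ℝ} (hs : Φ s = τ) (ht : Φ t = τ)
    (hne : s ≠ t) (h0 : 0 ≤ η s) (hu : ∀ x, Φ x = τ → 0 ≤ η x → x = s) : HasMass m W 1 := by
  have h1 : η s = 0 := le_antisymm (E.edge_of_ne s t hne hs ht) h0
  obtain ⟨h4, -, h5⟩ := E.on_edge s h1 hs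
  have hW : W = {P s true} := by
    ext z
    rw [E.mem_iff]
    constructor
    · rintro ⟨t, ε, h3, h3', rfl⟩
      rw [hu t h3 h3']
      cases ε <;> simp [h4]
    · rintro rfl
      exact ⟨s, true, hs, h0, rfl⟩
  rw [hW]
  exact hasMass_singleton (h5 (E.deriv_ne_zero hs ht hne h1))

/-- If the phase crosses the level, there are two points, counted with multiplicity. -/
lemma hasMass_two (E : EdgeFiber Φ η h h' τ m W P) {r t : ℝ} (hr : Φ r < τ) (ht : τ < Φ t) :
    HasMass m W 2 := by
  obtain ⟨s₀, h0⟩ : ∃ s, Φ s = τ := mem_range_of_exists_le_of_exists_ge E.cont ⟨r, hr.le⟩ ⟨t, ht.le⟩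
  obtain ⟨s₁, h1, hmin⟩ := E.toEdgeLevel.exists_min h0 hr
  obtain ⟨s₂, h2, hmax⟩ := E.toEdgeLevel.exists_max h0 ht
  rcases eq_or_lt_of_le (hmin s₂ h2) with h12 | h12
  · exact E.hasMass_of_unique h1 fun x hx => le_antisymm (h12 ▸ hmax x hx) (hmin x hx)
  have e1 : η s₁ = 0 := le_antisymm (E.edge_of_ne _ _ h12.ne h1 h2)
    (E.toEdgeLevel.min_edge_nonneg h1 hmin)
  have e2 : η s₂ = 0 := le_antisymm (E.edge_of_ne _ _ h12.ne' h2 h1)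
    (E.toEdgeLevel.max_edge_nonneg h2 hmax)
  obtain ⟨h4, -, h5⟩ := E.on_edge s₁ e1 h1
  obtain ⟨h4', -, h5'⟩ := E.on_edge s₂ e2 h2
  have hW : W = {P s₁ true, P s₂ true} := by
    ext z
    rw [E.mem_iff]
    constructor
    · rintro ⟨x, ε, hx, hx', rfl⟩
      rcases eq_or_lt_of_le (hmin x hx) with h6 | h6
      · rw [← h6]; cases ε <;> simp [h4]
      rcases eq_or_lt_of_le (hmax x hx) with h7 | h7
      · rw [h7]; cases ε <;> simp [h4']
      · exact absurd (le_antisymm (E.edge_of_ne _ _ h6.ne' hx h1) hx')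
          (E.toEdgeLevel.not_between h6 h7 h1 h2)
    · rintro (rfl | rfl)
      · exact ⟨s₁, true, h1, e1.ge, rfl⟩
      · exact ⟨s₂, true, h2, e2.ge, rfl⟩
  rw [hW]
  refine hasMass_pair (fun h => ?_) (h5 (E.deriv_ne_zero h1 h2 h12.ne e1))
    (h5' (E.deriv_ne_zero h2 h1 h12.ne' e2))
  have := congrArg norm h
  rw [E.norm_eq, E.norm_eq, Real.exp_eq_exp] at this
  exact h12.ne this

/-- If the level set is unbounded below, there is at most one point. -/
lemma hasMass_of_bot (E : EdgeFiber Φ η h h' τ m W P) {s₀ : ℝ} (h0 : ∀ s ≤ s₀, Φ s = τ) :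
    (∃ c ≤ 1, HasMass m W c) ∧ ((∃ t, τ < Φ t) → HasMass m W 1) := by
  have huniq : ∀ s, Φ s = τ → 0 ≤ η s → ∀ x, Φ x = τ → 0 ≤ η x → x = s := by
    have key : ∀ s x, Φ s = τ → 0 ≤ η s → Φ x = τ → s < x → False := by
      intro s x hs hs' hx hlt
      have hr := h0 (min s₀ (s - 1)) (min_le_left _ _)
      have hrs : min s₀ (s - 1) < s := (min_le_right _ _).trans_lt (by linarith)
      -- The level set extends to the left of any of its points, so only its right end can carry an
      -- `α`-point.
      exact E.toEdgeLevel.not_between hrs hlt hr hx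
        (le_antisymm (E.edge_of_ne _ _ hlt.ne hs hx) hs')
    intro s hs hs' x hx hx'
    rcases lt_trichotomy s x with h | h | h
    · exact (key s x hs hs' hx h).elim
    · exact h.symm
    · exact (key x s hx hx' hs h).elim
  have one : ∀ s, Φ s = τ → 0 ≤ η s → HasMass m W 1 := by
    intro s hs hs'
    have hr := h0 (min s₀ (s - 1)) (min_le_left _ _)
    have hrs : min s₀ (s - 1) < s := (min_le_right _ _).trans_lt (by linarith)
    exact E.hasMass_one hs hr hrs.ne' hs' (huniq s hs hs')
  constructor
  · by_cases hex : ∃ s, Φ s = τ ∧ 0 ≤ η s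
    · obtain ⟨s, hs, hs'⟩ := hex
      exact ⟨1, le_rfl, one s hs hs'⟩
    · push Not at hex
      exact ⟨0, by simp, E.hasMass_of_forall_not fun s hs => not_le.2 (hex s hs)⟩
  · rintro ⟨t, ht⟩
    obtain ⟨s, hs, hmax⟩ := E.toEdgeLevel.exists_max (h0 s₀ le_rfl) ht
    exact one s hs (E.toEdgeLevel.max_edge_nonneg hs hmax)

/-- If the phase starts below the level, there are at most two points. -/
lemma hasMass_le_two (E : EdgeFiber Φ η h h' τ m W P) {r : ℝ} (hr : Φ r < τ) :
    ∃ c ≤ 2, HasMass m W c := by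
  by_cases hex : ∃ t, τ < Φ t
  · obtain ⟨t, ht⟩ := hex
    exact ⟨2, le_rfl, E.hasMass_two hr ht⟩
  push Not at hex
  by_cases hex0 : ∃ s, Φ s = τ
  swap
  · push Not at hex0
    exact ⟨0, by simp, E.hasMass_of_forall_not fun s hs => (hex0 s hs).elim⟩
  obtain ⟨s₀, h0⟩ := hex0
  obtain ⟨s, hs, hmin⟩ := E.toEdgeLevel.exists_min h0 hr
  -- The phase reaches the level but never exceeds it, so the level set is a half-line and only its
  -- left end counts.
  have hup : ∀ t, s ≤ t → Φ t = τ := fun t ht => le_antisymm (hex t) (hs ▸ E.mono ht)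
  refine ⟨1, by norm_num, E.hasMass_one hs (hup (s + 1) (by linarith)) (by linarith)
    (E.toEdgeLevel.min_edge_nonneg hs hmin) fun x hx hx' => ?_⟩
  by_contra hne
  have hlt : s < x := lt_of_le_of_ne (hmin x hx) (Ne.symm hne)
  exact E.toEdgeLevel.not_between hlt (lt_add_one x) hs (hup _ (by linarith))
    (le_antisymm (E.edge_of_ne _ _ hne hx hs) hx')

end EdgeFiber

/-! ### Symmetry in the quadrants and the description of `α`-points by the phase. -/

/-- The point with the coordinates of `z` multiplied by `σ` and `ρ`. -/
noncomputable def signed (σ ρ : ℝ) (z : ℂ) : ℂ := ⟨σ * z.re, ρ * z.im⟩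

/-- The two signs. -/
def IsSign (σ : ℝ) : Prop := σ = 1 ∨ σ = -1

lemma IsSign.mul_self {σ : ℝ} (h : IsSign σ) : σ * σ = 1 := by
  rcases h with rfl | rfl <;> norm_num

lemma IsSign.ne_zero {σ : ℝ} (h : IsSign σ) : σ ≠ 0 := by
  rcases h with rfl | rfl <;> norm_num

lemma exists_isSign_mul_eq_abs (x : ℝ) : ∃ σ, IsSign σ ∧ σ * x = |x| := by
  rcases le_total 0 x with h | h
  · exact ⟨1, Or.inl rfl, by rw [abs_of_nonneg h, one_mul]⟩
  · exact ⟨-1, Or.inr rfl, by rw [abs_of_nonpos h]; ring⟩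

lemma norm_signed {σ ρ : ℝ} (hσ : IsSign σ) (hρ : IsSign ρ) (z : ℂ) : ‖signed σ ρ z‖ = ‖z‖ := by
  rw [Complex.norm_def, Complex.norm_def, Complex.normSq_apply, Complex.normSq_apply]
  congr 1
  simp only [signed]
  linear_combination z.re * z.re * hσ.mul_self + z.im * z.im * hρ.mul_self

lemma signed_signed {σ ρ : ℝ} (hσ : IsSign σ) (hρ : IsSign ρ) (z : ℂ) :
    signed σ ρ (signed σ ρ z) = z := by
  apply Complex.ext
  · simp only [signed]; linear_combination z.re * hσ.mul_self
  · simp only [signed]; linear_combination z.im * hρ.mul_self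

/-- The sign attached to a truth value. -/
def boolSign (ε : Bool) : ℝ := if ε then 1 else -1

lemma isSign_boolSign (ε : Bool) : IsSign (boolSign ε) := by
  cases ε
  · exact Or.inr rfl
  · exact Or.inl rfl

lemma IsSign.exists_bool {σ : ℝ} (h : IsSign σ) : ∃ ε, σ = boolSign ε := by
  rcases h with rfl | rfl
  · exact ⟨true, rfl⟩
  · exact ⟨false, rfl⟩

namespace PowerForm

open Complex Filter Topology ComplexConjugate

variable {ι κ : Type*} {d : PowerForm ι κ}

lemma eval_neg (hodd : Odd d.p) (z : ℂ) : d.eval (-z) = -d.eval z := by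
  rw [eval, eval, hodd.neg_zpow, neg_sq]
  ring

lemma eval_conj (z : ℂ) : d.eval (conj z) = conj (d.eval z) := by
  have h1 : rootProd d.a (conj z ^ 2) = conj (rootProd d.a (z ^ 2)) := by
    rw [← rootProd_conj d.summable_a, map_pow]
  have h2 : rootProd d.b (-conj z ^ 2) = conj (rootProd d.b (-z ^ 2)) := by
    rw [← rootProd_conj d.summable_b, map_neg, map_pow]
  rw [eval, eval, h1, h2, map_div₀, map_mul, map_mul, map_zpow₀, ← Complex.exp_conj, map_mul,
    map_pow, Complex.conj_ofReal]

lemma eval_signed (hodd : Odd d.p) {σ ρ : ℝ} (hσ : IsSign σ) (hρ : IsSign ρ) (z : ℂ) :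
    d.eval (signed σ ρ z) = signed σ ρ (d.eval z) := by
  have e1 : ∀ z, signed 1 1 z = z := fun z => by apply Complex.ext <;> simp [signed]
  have e2 : ∀ z, signed 1 (-1) z = conj z := fun z => by apply Complex.ext <;> simp [signed]
  have e3 : ∀ z, signed (-1) 1 z = -conj z := fun z => by apply Complex.ext <;> simp [signed]
  have e4 : ∀ z, signed (-1) (-1) z = -z := fun z => by apply Complex.ext <;> simp [signed]
  rcases hσ with rfl | rfl <;> rcases hρ with rfl | rfl
  · rw [e1, e1]
  · rw [e2, e2, eval_conj]
  · rw [e3, e3, eval_neg hodd, eval_conj]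
  · rw [e4, e4, eval_neg hodd]

lemma exp_curve_re (c s : ℝ) :
    (Complex.exp (d.curve c s)).re = Real.exp s * Real.cos (d.theta c s) := by
  rw [Complex.exp_re]; rfl

lemma exp_curve_im (c s : ℝ) :
    (Complex.exp (d.curve c s)).im = Real.exp s * Real.sin (d.theta c s) := by
  rw [Complex.exp_im]; rfl

lemma norm_exp_curve (c s : ℝ) : ‖Complex.exp (d.curve c s)‖ = Real.exp s := by
  rw [Complex.norm_exp]; rfl

/-- The point of the quadrant with signs `σ`, `ρ` which corresponds to the point of the level
curve over `s`. -/
noncomputable def lift (d : PowerForm ι κ) (c σ ρ s : ℝ) : ℂ :=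
  signed σ ρ (Complex.exp (d.curve c s))

lemma lift_re (c σ ρ s : ℝ) :
    (d.lift c σ ρ s).re = σ * (Real.exp s * Real.cos (d.theta c s)) := by
  rw [← exp_curve_re]; rfl

lemma lift_im (c σ ρ s : ℝ) :
    (d.lift c σ ρ s).im = ρ * (Real.exp s * Real.sin (d.theta c s)) := by
  rw [← exp_curve_im]; rfl

lemma norm_lift {σ ρ : ℝ} (hσ : IsSign σ) (hρ : IsSign ρ) (c s : ℝ) :
    ‖d.lift c σ ρ s‖ = Real.exp s := by
  rw [lift, norm_signed hσ hρ, norm_exp_curve]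

lemma log_norm_lift {σ ρ : ℝ} (hσ : IsSign σ) (hρ : IsSign ρ) (c s : ℝ) :
    Real.log ‖d.lift c σ ρ s‖ = s := by
  rw [norm_lift hσ hρ, Real.log_exp]

/-- The position of an `α`-point with respect to the level curve `|F| = |α|`. -/
structure LevelPoint (d : PowerForm ι κ) (α : ℂ) (s σ ρ : ℝ) : Prop where
  sign_re : IsSign σ
  sign_im : IsSign ρ
  gap : d.gap (Real.log ‖α‖) s (d.theta (Real.log ‖α‖) s) = 0
  cos : ‖α‖ * Real.cos (d.phase (Real.log ‖α‖) s) = σ * α.re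
  sin : ‖α‖ * Real.sin (d.phase (Real.log ‖α‖) s) = ρ * α.im

lemma norm_exp_phase {α : ℂ} (hα : α ≠ 0) {s : ℝ}
    (h : d.gap (Real.log ‖α‖) s (d.theta (Real.log ‖α‖) s) = 0) :
    d.eval (Complex.exp (d.curve (Real.log ‖α‖) s)) =
      ⟨‖α‖ * Real.cos (d.phase (Real.log ‖α‖) s), ‖α‖ * Real.sin (d.phase (Real.log ‖α‖) s)⟩ := by
  rw [eval_exp_curve h, Real.exp_log (norm_pos_iff.2 hα)]
  apply Complex.ext
  · rw [Complex.re_ofReal_mul, Complex.exp_ofReal_mul_I_re]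
  · rw [Complex.im_ofReal_mul, Complex.exp_ofReal_mul_I_im]

lemma LevelPoint.eval_eq (hodd : Odd d.p) {α : ℂ} (hα : α ≠ 0) {s σ ρ : ℝ}
    (h : d.LevelPoint α s σ ρ) : d.eval (d.lift (Real.log ‖α‖) σ ρ s) = α := by
  rw [lift, eval_signed hodd h.sign_re h.sign_im, norm_exp_phase hα h.gap, h.cos, h.sin]
  exact signed_signed h.sign_re h.sign_im α

/-- The value at a pole is `0` by the convention for division, so `α ≠ 0` excludes poles as well as
zeros; at the origin `0 ^ p = 0`, as an odd `p` is not `0`. -/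
lemma ne_zero_of_eval (hodd : Odd d.p) {α z : ℂ} (hα : α ≠ 0) (h : d.eval z = α) :
    z ≠ 0 ∧ d.RegularSq (z ^ 2) := by
  have h0 : d.eval z ≠ 0 := h ▸ hα
  rw [eval] at h0
  obtain ⟨h1, h2⟩ := div_ne_zero_iff.1 h0
  obtain ⟨h3, h4⟩ := mul_ne_zero_iff.1 h1
  obtain ⟨h5, -⟩ := mul_ne_zero_iff.1 h3
  refine ⟨fun hz => h5 ?_, h4, h2⟩
  rw [hz, zero_zpow]
  rintro h6
  rw [h6] at hodd
  simp at hodd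

/-- Reflect `z` into the closed first quadrant. There `|F| = |α|` holds at most once on the circle
through the point, so uniqueness of `theta` places it on the level curve. -/
lemma exists_levelPoint (hodd : Odd d.p) {α z : ℂ} (hα : α ≠ 0) (h : d.eval z = α) :
    ∃ σ ρ, d.LevelPoint α (Real.log ‖z‖) σ ρ ∧
      z = d.lift (Real.log ‖α‖) σ ρ (Real.log ‖z‖) := by
  have hz := (ne_zero_of_eval hodd hα h).1
  obtain ⟨σ, hσ, hre⟩ := exists_isSign_mul_eq_abs z.re
  obtain ⟨ρ, hρ, him⟩ := exists_isSign_mul_eq_abs z.im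
  set ζ := signed σ ρ z with hζ
  have hnorm : ‖ζ‖ = ‖z‖ := norm_signed hσ hρ z
  have hζ0 : ζ ≠ 0 := norm_ne_zero_iff.1 (hnorm ▸ norm_ne_zero_iff.2 hz)
  have hζre : 0 ≤ ζ.re := by
    change 0 ≤ σ * z.re
    rw [hre]; exact abs_nonneg _
  have hζim : 0 ≤ ζ.im := by
    change 0 ≤ ρ * z.im
    rw [him]; exact abs_nonneg _
  have harg : Complex.arg ζ ∈ Set.Icc 0 (Real.pi / 2) :=
    ⟨Complex.arg_nonneg_iff.2 hζim,
      (le_abs_self _).trans (Complex.abs_arg_le_pi_div_two_iff.2 hζre)⟩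
  have hu : pt (Real.log ‖z‖) (Complex.arg ζ) = Complex.log ζ := by
    apply Complex.ext
    · rw [Complex.log_re, hnorm]; rfl
    · rw [Complex.log_im]; rfl
  have hexp : Complex.exp (pt (Real.log ‖z‖) (Complex.arg ζ)) = ζ := by
    rw [hu, Complex.exp_log hζ0]
  have heval : d.eval ζ = signed σ ρ α := by rw [hζ, eval_signed hodd hσ hρ, h]
  have hevn : ‖d.eval ζ‖ = ‖α‖ := by rw [heval, norm_signed hσ hρ]
  have hreg : d.Regular (pt (Real.log ‖z‖) (Complex.arg ζ)) := by
    have h0 : d.eval ζ ≠ 0 := norm_ne_zero_iff.1 (hevn ▸ norm_ne_zero_iff.2 hα)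
    rw [← hexp, eval_exp] at h0
    obtain ⟨h1, h2⟩ := div_ne_zero_iff.1 h0
    exact ⟨mt (num_eq_zero_iff _).2 h1, h2⟩
  have hgap : d.gap (Real.log ‖α‖) (Real.log ‖z‖) (Complex.arg ζ) = 0 := by
    rw [hreg.gap_eq_zero_iff, ← Real.exp_eq_exp, ← hreg.norm_eval, hexp, hevn,
      Real.exp_log (norm_pos_iff.2 hα)]
  have hth := theta_eq harg hgap
  have hcurve : Complex.exp (d.curve (Real.log ‖α‖) (Real.log ‖z‖)) = ζ := by
    rw [curve, hth, hexp]
  have hgap' : d.gap (Real.log ‖α‖) (Real.log ‖z‖) (d.theta (Real.log ‖α‖) (Real.log ‖z‖)) = 0 := by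
    rw [hth, hgap]
  have hval := norm_exp_phase hα hgap'
  rw [hcurve, heval] at hval
  refine ⟨σ, ρ, ⟨hσ, hρ, hgap', ?_, ?_⟩, ?_⟩
  · exact (congrArg Complex.re hval).symm
  · exact (congrArg Complex.im hval).symm
  · rw [lift, hcurve, hζ, signed_signed hσ hρ]

lemma lift_sq_im (c σ ρ s : ℝ) : (d.lift c σ ρ s ^ 2).im =
    2 * (σ * (Real.exp s * Real.cos (d.theta c s))) * (ρ * (Real.exp s * Real.sin (d.theta c s))) := by
  rw [sq, Complex.mul_im, lift_re, lift_im]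
  ring

lemma alphaMult_interior (hodd : Odd d.p) {α : ℂ} (hα : α ≠ 0) {s σ ρ : ℝ}
    (h : d.LevelPoint α s σ ρ) (h0 : 0 < d.theta (Real.log ‖α‖) s)
    (h1 : d.theta (Real.log ‖α‖) s < Real.pi / 2) :
    alphaMult d.eval α (d.lift (Real.log ‖α‖) σ ρ s) = 1 := by
  have he := h.eval_eq hodd hα
  obtain ⟨hz, hw⟩ := ne_zero_of_eval hodd hα he
  have := alphaMult_eq_one hz hw (logSlope_ne_zero_of_im hw ?_)
  · rwa [he] at this
  · rw [lift_sq_im]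
    have := Real.exp_pos s
    have := Real.cos_pos_of_mem_Ioo ⟨by linarith, h1⟩
    have := Real.sin_pos_of_pos_of_lt_pi h0 (by linarith)
    have := h.sign_re.ne_zero
    have := h.sign_im.ne_zero
    positivity

lemma alphaMult_edge (hodd : Odd d.p) {α z : ℂ} (hα : α ≠ 0) (he : d.eval z = α) {x : ℝ}
    (hx : z ^ 2 = x) :
    ((d.logSlope x).re = 0 → alphaMult d.eval α z = 2) ∧
    ((d.logSlope x).re ≠ 0 → alphaMult d.eval α z = 1) := by
  obtain ⟨hz, hw⟩ := ne_zero_of_eval hodd hα he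
  have him : (z ^ 2).im = 0 := by rw [hx, Complex.ofReal_im]
  subst he
  rw [← hx]
  exact ⟨fun h => alphaMult_eq_two hz hw him (Complex.ext h (logSlope_im_eq_zero hw him)),
    fun h => alphaMult_eq_one hz hw fun h0 => h (by rw [h0, Complex.zero_re])⟩

lemma Regular.log_norm_eval {u : ℂ} (h : d.Regular u) :
    Real.log ‖d.eval (Complex.exp u)‖ = (d.logEval u).re := by
  rw [h.norm_eval, Real.log_exp]

lemma Regular.eventually {s t : ℝ} (h : d.Regular (pt s t)) :
    ∀ᶠ s' in 𝓝 s, d.Regular (pt s' t) := by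
  have hc : Continuous fun s' : ℝ => Complex.exp (2 * pt s' t) := by
    simp only [pt_eq]; fun_prop
  exact hc.continuousAt.eventually (isOpen_regularSq.mem_nhds h)

lemma continuous_gap_left (c t : ℝ) : Continuous fun s => d.gap c s t := by
  have h : Continuous fun s : ℝ => (s, t) := by fun_prop
  have := (continuous_gap (d := d) c).comp h
  exact this

lemma exp_two_mul_pt_zero (s : ℝ) : Complex.exp (2 * pt s 0) = (Real.exp (2 * s) : ℝ) :=
  exp_two_mul_of_im_eq_zero rfl

lemma exp_two_mul_pt_pi_div_two (s : ℝ) :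
    Complex.exp (2 * pt s (Real.pi / 2)) = (-Real.exp (2 * s) : ℝ) :=
  exp_two_mul_of_im_eq_pi_div_two rfl

lemma pt_zero_mem (s : ℝ) : pt s 0 ∈ halfStrip := ⟨le_rfl, by have := Real.pi_pos; simp; positivity⟩

lemma pt_pi_div_two_mem (s : ℝ) : pt s (Real.pi / 2) ∈ halfStrip :=
  ⟨by have := Real.pi_pos; simp; positivity, le_rfl⟩

lemma regular_real {c s : ℝ} (h : d.gap c s 0 ≤ 0) : d.Regular (pt s 0) :=
  regular_of_gap_nonpos (pt_zero_mem s) (by have := Real.pi_pos; positivity) h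

lemma regular_imag {c s : ℝ} (h : 0 ≤ d.gap c s (Real.pi / 2)) :
    d.Regular (pt s (Real.pi / 2)) :=
  regular_of_gap_nonneg (pt_pi_div_two_mem s) (by have := Real.pi_pos; positivity) h

/-- On the upper edge the phase is `p * π / 2` modulo `π`, an odd multiple of `π / 2` because `p` is
odd. -/
lemma theta_ne_of_phase_real (hodd : Odd d.p) {c s : ℝ} {k : ℤ} (h : d.phase c s = k * Real.pi) :
    d.theta c s ≠ Real.pi / 2 := by
  intro h0
  obtain ⟨-, l, hl⟩ := phase_of_theta_eq_pi_div_two h0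
  obtain ⟨j, hj⟩ := hodd
  rw [h, hj] at hl
  push_cast at hl
  have : (2 * (k - l - j) : ℝ) = 1 := by
    have := Real.pi_ne_zero
    field_simp at hl
    linarith
  have h2 : 2 * (k - l - j) = 1 := by exact_mod_cast this
  omega

lemma theta_ne_of_phase_imag {c s : ℝ} {k : ℤ}
    (h : d.phase c s = k * Real.pi + Real.pi / 2) : d.theta c s ≠ 0 := by
  intro h0
  obtain ⟨-, l, hl⟩ := phase_of_theta_eq_zero h0
  rw [h] at hl
  have : (2 * (l - k) : ℝ) = 1 := by
    have := Real.pi_ne_zero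
    field_simp at hl
    linarith
  have h2 : 2 * (l - k) = 1 := by exact_mod_cast this
  omega

/-- This is strict monotonicity off the edges: the phase can only rest along an edge. -/
lemma theta_edge_of_ne {c s t : ℝ} (hne : s ≠ t) (h : d.phase c s = d.phase c t) :
    d.theta c s = 0 ∨ d.theta c s = Real.pi / 2 := by
  by_contra hc
  rcases lt_or_gt_of_ne hne with hlt | hlt
  · exact (phase_lt hlt fun h => hc h.2).ne h
  · exact (phase_lt hlt fun h => hc (h.1 ▸ h.2)).ne' h

lemma edgeLevel_real (hodd : Odd d.p) (c : ℝ) (k : ℤ) :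
    EdgeLevel (d.phase c) (fun s => d.gap c s 0)
      (fun s => Real.log ‖d.eval (Complex.exp (pt s 0))‖ - c)
      (fun s => (d.logSlope (Real.exp (2 * s) : ℝ)).re) (k * Real.pi) where
  mono := monotone_phase c
  cont := continuous_phase c
  cont_edge := continuous_gap_left c 0
  lattice s h := by
    obtain ⟨-, l, hl⟩ := phase_of_theta_eq_zero (theta_eq_zero_iff.2 h)
    exact ⟨l - k, by rw [hl]; push_cast; ring⟩
  edge_of_ne s t hne hs ht := theta_eq_zero_iff.1
    ((theta_edge_of_ne hne (hs.trans ht.symm)).resolve_right (theta_ne_of_phase_real hodd hs))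
  nonpos s h := by
    have hr := regular_real h
    rw [hr.log_norm_eval]
    linarith [hr.gap_nonpos_iff.1 h]
  zero_iff s h := by
    have hr := regular_real h
    rw [hr.log_norm_eval, hr.gap_eq_zero_iff, sub_eq_zero]
  nonneg_near s h := by
    filter_upwards [(regular_real h).eventually] with t hr ht
    rw [hr.log_norm_eval]
    linarith [hr.gap_pos_iff.1 ht]
  deriv s h := by
    have := (hasDerivAt_log_norm_eval (regular_real h)).sub_const c
    rwa [exp_two_mul_pt_zero] at this
  deriv_lt s t hst h := by
    refine logSlope_re_lt (Real.exp_lt_exp.2 (by linarith)) fun w hw => ?_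
    have hw0 : 0 < w := (Real.exp_pos _).trans_le hw.1
    -- Every `w` between the two squares is the square of a point of the edge over a parameter in
    -- the interval.
    have e : w = Real.exp (2 * (Real.log w / 2)) := by
      rw [mul_div_cancel₀ _ two_ne_zero, Real.exp_log hw0]
    have h1 := (Real.le_log_iff_exp_le hw0).2 hw.1
    have h2 := (Real.log_le_iff_le_exp hw0).2 hw.2
    have hr := regular_real (h (Real.log w / 2) ⟨by linarith, by linarith⟩)
    rw [Regular, exp_two_mul_pt_zero, ← e] at hr
    exact hr

/-- All signs are reversed relative to the real edge: the curve runs along the upper edge where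
`|F|` is at least `exp c`, and `log |F|` is concave there. -/
lemma edgeLevel_imag (c : ℝ) (k : ℤ) (hodd : Odd d.p) :
    EdgeLevel (d.phase c) (fun s => -d.gap c s (Real.pi / 2))
      (fun s => c - Real.log ‖d.eval (Complex.exp (pt s (Real.pi / 2)))‖)
      (fun s => -(d.logSlope (-Real.exp (2 * s) : ℝ)).re) (k * Real.pi + Real.pi / 2) where
  mono := monotone_phase c
  cont := continuous_phase c
  cont_edge := (continuous_gap_left c _).neg
  lattice s h := by
    obtain ⟨-, l, hl⟩ := phase_of_theta_eq_pi_div_two (theta_eq_pi_div_two_iff.2 (neg_nonpos.1 h))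
    obtain ⟨j, hj⟩ := hodd
    exact ⟨l + j - k, by rw [hl, hj]; push_cast; ring⟩
  edge_of_ne s t hne hs ht := neg_nonpos.2 (theta_eq_pi_div_two_iff.1
    ((theta_edge_of_ne hne (hs.trans ht.symm)).resolve_left (theta_ne_of_phase_imag hs)))
  nonpos s h := by
    have hr := regular_imag (neg_nonpos.1 h)
    rw [hr.log_norm_eval]
    linarith [hr.gap_nonneg_iff.1 (neg_nonpos.1 h)]
  zero_iff s h := by
    have hr := regular_imag (neg_nonpos.1 h)
    rw [hr.log_norm_eval, neg_eq_zero, hr.gap_eq_zero_iff, sub_eq_zero, eq_comm]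
  nonneg_near s h := by
    filter_upwards [(regular_imag (neg_nonpos.1 h)).eventually] with t hr ht
    rw [hr.log_norm_eval]
    linarith [hr.gap_neg_iff.1 (neg_pos.1 ht)]
  deriv s h := by
    have := (hasDerivAt_log_norm_eval (regular_imag (neg_nonpos.1 h))).const_sub c
    rwa [exp_two_mul_pt_pi_div_two] at this
  deriv_lt s t hst h := by
    refine neg_lt_neg (logSlope_re_lt (neg_lt_neg (Real.exp_lt_exp.2 (by linarith)))
      fun w hw => ?_)
    have hw0 : 0 < -w := (Real.exp_pos _).trans_le (le_neg.1 hw.2)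
    have e : -w = Real.exp (2 * (Real.log (-w) / 2)) := by
      rw [mul_div_cancel₀ _ two_ne_zero, Real.exp_log hw0]
    have h1 := (Real.le_log_iff_exp_le hw0).2 (le_neg.1 hw.2)
    have h2 := (Real.log_le_iff_le_exp hw0).2 (neg_le.1 hw.1)
    have hr := regular_imag (neg_nonpos.1 (h (Real.log (-w) / 2) ⟨by linarith, by linarith⟩))
    rw [Regular, exp_two_mul_pt_pi_div_two, ← e, neg_neg] at hr
    exact hr

/-- The `α`-points at which the phase has the value `τ`. -/
def phaseFiber (d : PowerForm ι κ) (α : ℂ) (τ : ℝ) : Set ℂ :=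
  {z | d.eval z = α ∧ d.phase (Real.log ‖α‖) (Real.log ‖z‖) = τ}

/-- The phase fixes the sign `σ` of the real part, while `α.im = 0` leaves that of the imaginary
part free. The two lifts are conjugate and merge when `theta` is `0`. -/
lemma edgeFiber_real (hodd : Odd d.p) {α : ℂ} (hα : α ≠ 0) (him : α.im = 0) (k : ℤ) {σ : ℝ}
    (hσ : IsSign σ) (hcos : ‖α‖ * Real.cos (k * Real.pi) = σ * α.re) :
    EdgeFiber (d.phase (Real.log ‖α‖)) (fun s => d.gap (Real.log ‖α‖) s 0)
      (fun s => Real.log ‖d.eval (Complex.exp (pt s 0))‖ - Real.log ‖α‖)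
      (fun s => (d.logSlope (Real.exp (2 * s) : ℝ)).re) (k * Real.pi)
      (alphaMult d.eval α) (d.phaseFiber α (k * Real.pi))
      (fun s ε => d.lift (Real.log ‖α‖) σ (boolSign ε) s) := by
  have hre : α.re ≠ 0 := fun h => hα (Complex.ext h him)
  have hlp : ∀ s ε, d.phase (Real.log ‖α‖) s = k * Real.pi → 0 ≤ d.gap (Real.log ‖α‖) s 0 →
      d.LevelPoint α s σ (boolSign ε) := by
    intro s ε hs hg
    refine ⟨hσ, isSign_boolSign ε, ?_, by rw [hs, hcos], by
      rw [hs, Real.sin_int_mul_pi, him, mul_zero, mul_zero]⟩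
    rcases eq_or_lt_of_le (theta_mem (d := d) (Real.log ‖α‖) s).1 with h0 | h0
    · rw [← h0]
      exact le_antisymm (theta_eq_zero_iff.1 h0.symm) hg
    · exact gap_theta_eq_zero h0 (lt_of_le_of_ne (theta_mem _ s).2 (theta_ne_of_phase_real hodd hs))
  refine { edgeLevel_real hodd _ k with mem_iff := ?_, off_edge := ?_, on_edge := ?_, norm_eq := ?_ }
  · intro z
    constructor
    · rintro ⟨hz, hs⟩
      obtain ⟨σ', ρ, hl, hz'⟩ := exists_levelPoint hodd hα hz
      obtain ⟨ε, rfl⟩ := hl.sign_im.exists_bool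
      have hσ' : σ' = σ := by
        have := hl.cos
        rw [hs, hcos] at this
        exact (mul_right_cancel₀ hre this).symm
      subst hσ'
      refine ⟨_, ε, hs, ?_, hz'⟩
      by_contra! hc
      have h0 := theta_eq_zero_iff.2 hc.le
      have := hl.gap
      rw [h0] at this
      exact hc.ne this
    · rintro ⟨s, ε, hs, hg, rfl⟩
      refine ⟨(hlp s ε hs hg).eval_eq hodd hα, ?_⟩
      rw [log_norm_lift hσ (isSign_boolSign ε), hs]
  · intro s hpos hs
    have hl := hlp s
    have h0 : 0 < d.theta (Real.log ‖α‖) s := lt_of_le_of_ne (theta_mem _ s).1 fun h =>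
      absurd (theta_eq_zero_iff.1 h.symm) (not_le.2 hpos)
    have h1 := lt_of_le_of_ne (theta_mem (d := d) (Real.log ‖α‖) s).2 (theta_ne_of_phase_real hodd hs)
    refine ⟨fun h => ?_, fun ε => alphaMult_interior hodd hα (hl ε hs hpos.le) h0 h1⟩
    have h2 := congrArg Complex.im h
    rw [lift_im, lift_im] at h2
    have h3 := mul_pos (Real.exp_pos s) (Real.sin_pos_of_pos_of_lt_pi h0 (by linarith))
    simp only [boolSign, if_true, Bool.false_eq_true, if_false] at h2
    linarith
  · intro s hg hs
    have h0 := theta_eq_zero_iff.2 (le_of_eq hg)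
    have e : ∀ ε, d.lift (Real.log ‖α‖) σ (boolSign ε) s = ((σ * Real.exp s : ℝ) : ℂ) := by
      intro ε
      apply Complex.ext
      · rw [lift_re, h0, Real.cos_zero, mul_one, Complex.ofReal_re]
      · rw [lift_im, h0, Real.sin_zero, mul_zero, mul_zero, Complex.ofReal_im]
    refine ⟨by rw [e, e], alphaMult_edge hodd hα ((hlp s true hs (ge_of_eq hg)).eval_eq hodd hα) ?_⟩
    rw [e, ← Complex.ofReal_pow, mul_pow, sq σ, hσ.mul_self, one_mul, ← Real.exp_nat_mul]
    norm_num
  · exact fun s ε => norm_lift hσ (isSign_boolSign ε) _ s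

lemma edgeFiber_imag (hodd : Odd d.p) {α : ℂ} (hα : α ≠ 0) (hre : α.re = 0) (k : ℤ) {ρ : ℝ}
    (hρ : IsSign ρ) (hsin : ‖α‖ * Real.sin (k * Real.pi + Real.pi / 2) = ρ * α.im) :
    EdgeFiber (d.phase (Real.log ‖α‖)) (fun s => -d.gap (Real.log ‖α‖) s (Real.pi / 2))
      (fun s => Real.log ‖α‖ - Real.log ‖d.eval (Complex.exp (pt s (Real.pi / 2)))‖)
      (fun s => -(d.logSlope (-Real.exp (2 * s) : ℝ)).re) (k * Real.pi + Real.pi / 2)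
      (alphaMult d.eval α) (d.phaseFiber α (k * Real.pi + Real.pi / 2))
      (fun s ε => d.lift (Real.log ‖α‖) (boolSign ε) ρ s) := by
  have him : α.im ≠ 0 := fun h => hα (Complex.ext hre h)
  have hlp : ∀ s ε, d.phase (Real.log ‖α‖) s = k * Real.pi + Real.pi / 2 →
      0 ≤ -d.gap (Real.log ‖α‖) s (Real.pi / 2) → d.LevelPoint α s (boolSign ε) ρ := by
    intro s ε hs hg
    refine ⟨isSign_boolSign ε, hρ, ?_, by
      rw [hs, Real.cos_add_pi_div_two, Real.sin_int_mul_pi, hre, neg_zero, mul_zero, mul_zero],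
      by rw [hs, hsin]⟩
    rcases eq_or_lt_of_le (theta_mem (d := d) (Real.log ‖α‖) s).2 with h0 | h0
    · rw [h0]
      exact le_antisymm (by linarith) (theta_eq_pi_div_two_iff.1 h0)
    · exact gap_theta_eq_zero
        (lt_of_le_of_ne (theta_mem _ s).1 (theta_ne_of_phase_imag hs).symm) h0
  refine { edgeLevel_imag _ k hodd with mem_iff := ?_, off_edge := ?_, on_edge := ?_, norm_eq := ?_ }
  · intro z
    constructor
    · rintro ⟨hz, hs⟩
      obtain ⟨σ, ρ', hl, hz'⟩ := exists_levelPoint hodd hα hz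
      obtain ⟨ε, rfl⟩ := hl.sign_re.exists_bool
      have hρ' : ρ' = ρ := by
        have := hl.sin
        rw [hs, hsin] at this
        exact (mul_right_cancel₀ him this).symm
      subst hρ'
      refine ⟨_, ε, hs, ?_, hz'⟩
      by_contra! hc
      have hc' := neg_lt_zero.1 hc
      have h0 := theta_eq_pi_div_two_iff.2 hc'.le
      have := hl.gap
      rw [h0] at this
      exact hc'.ne' this
    · rintro ⟨s, ε, hs, hg, rfl⟩
      refine ⟨(hlp s ε hs hg).eval_eq hodd hα, ?_⟩
      rw [log_norm_lift (isSign_boolSign ε) hρ, hs]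
  · intro s hpos hs
    have hl := hlp s
    have h1 : d.theta (Real.log ‖α‖) s < Real.pi / 2 := lt_of_le_of_ne (theta_mem _ s).2 fun h =>
      absurd (theta_eq_pi_div_two_iff.1 h) (not_le.2 (neg_pos.1 hpos))
    have h0 := lt_of_le_of_ne (theta_mem (d := d) (Real.log ‖α‖) s).1 (theta_ne_of_phase_imag hs).symm
    refine ⟨fun h => ?_, fun ε => alphaMult_interior hodd hα (hl ε hs hpos.le) h0 h1⟩
    have h2 := congrArg Complex.re h
    rw [lift_re, lift_re] at h2
    have h3 := mul_pos (Real.exp_pos s) (Real.cos_pos_of_mem_Ioo ⟨by linarith, h1⟩)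
    simp only [boolSign, if_true, Bool.false_eq_true, if_false] at h2
    linarith
  · intro s hg hs
    have h0 := theta_eq_pi_div_two_iff.2 (neg_eq_zero.1 hg).ge
    have e : ∀ ε, d.lift (Real.log ‖α‖) (boolSign ε) ρ s = ((ρ * Real.exp s : ℝ) : ℂ) * I := by
      intro ε
      apply Complex.ext
      · rw [lift_re, h0, Real.cos_pi_div_two, mul_zero, mul_zero, Complex.re_ofReal_mul, Complex.I_re,
          mul_zero]
      · rw [lift_im, h0, Real.sin_pi_div_two, mul_one, Complex.im_ofReal_mul, Complex.I_im, mul_one]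
    have hm := alphaMult_edge hodd hα ((hlp s true hs (ge_of_eq hg)).eval_eq hodd hα)
      (x := -Real.exp (2 * s)) (by
        rw [e, mul_pow, Complex.I_sq, ← Complex.ofReal_pow, mul_pow, sq ρ, hρ.mul_self, one_mul,
          ← Real.exp_nat_mul]
        push_cast
        ring_nf)
    exact ⟨by rw [e, e], fun h => hm.1 (neg_eq_zero.1 h), fun h => hm.2 fun h' => h (by rw [h', neg_zero])⟩
  · exact fun s ε => norm_lift (isSign_boolSign ε) hρ _ s

end PowerForm

/-! ### Numbering by modulus and the relation between index and class. -/

section Enumeration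

/-- A type with a real function whose sublevel sets are finite can be numbered so that the function
is monotone. -/
lemma exists_monotone_numbering {T : Type*} (f : T → ℝ) (hf : ∀ R, {t | f t ≤ R}.Finite) :
    ∃ (ω : ℕ∞) (e : IndexUpTo ω ≃ T), ∀ m n : IndexUpTo ω, (m : ℕ) ≤ n → f (e m) ≤ f (e n) := by
  classical
  have hcount : Countable T := by
    have hu : (Set.univ : Set T) = ⋃ n : ℕ, {t | f t ≤ n} := by
      ext t
      simpa using exists_nat_ge (f t)
    rw [← Set.countable_univ_iff, hu]
    exact Set.countable_iUnion fun n => (hf n).countable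
  obtain ⟨c, hc⟩ := exists_injective_nat T
  -- An injective code breaks the ties of `f`, giving a linear order with finitely many predecessors
  -- for each element.
  set key : T → ℝ ×ₗ ℕ := fun t => toLex (f t, c t)
  have hkey : Function.Injective key := fun t t' h => hc (congrArg (fun x => (ofLex x).2) h)
  have hle : ∀ t t', key t ≤ key t' → f t ≤ f t' := by
    intro t t' h
    rcases Prod.Lex.le_iff.1 h with h | h
    · exact h.le
    · exact h.1.le
  have hfin : ∀ t, {t' | key t' < key t}.Finite := fun t =>
    (hf (f t)).subset fun t' (h : key t' < key t) => hle _ _ h.le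
  set g : T → ℕ := fun t => {t' | key t' < key t}.ncard
  have hg : ∀ t t', key t < key t' → g t < g t' := fun t t' h =>
    Set.ncard_lt_ncard ⟨fun x (hx : key x < key t) => hx.trans h,
      fun hs => lt_irrefl (key t) (hs h)⟩ (hfin t')
  have hginj : Function.Injective g := by
    intro t t' h
    by_contra hne
    rcases lt_or_gt_of_ne (hkey.ne hne) with h1 | h1
    · exact (hg _ _ h1).ne h
    · exact (hg _ _ h1).ne' h
  have hgle : ∀ t t', g t ≤ g t' → f t ≤ f t' := by
    intro t t' h
    refine hle _ _ ?_
    by_contra! hc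
    exact absurd h (not_le.2 (hg _ _ hc))
  -- Counting values of `g` with `Nat.count` gives consecutive positions without a proof that the
  -- range of `g` is an initial segment.
  set p : ℕ → Prop := fun n => n ∈ Set.range g
  set ω : ℕ∞ := (Set.ofPred p).encard
  have hvalid : ∀ n : ℕ, ((n + 1 : ℕ) : ℕ∞) ≤ ω ↔ ∀ h : (Set.ofPred p).Finite, n < h.toFinset.card := by
    intro n
    by_cases h : (Set.ofPred p).Finite
    · have : ω = h.toFinset.card := h.encard_eq_coe_toFinset_card
      rw [this, Nat.cast_le]
      exact ⟨fun h1 _ => h1, fun h1 => h1 h⟩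
    · have : ω = ⊤ := Set.encard_eq_top_iff.2 h
      simp [this, h]
  have hcard : ∀ t, ((Nat.count p (g t) + 1 : ℕ) : ℕ∞) ≤ ω := fun t =>
    (hvalid _).2 fun h => Nat.count_lt_card h ⟨t, rfl⟩
  set r : T → IndexUpTo ω := fun t => ⟨Nat.count p (g t) + 1, by omega, hcard t⟩
  have hr : Function.Bijective r := by
    constructor
    · intro t t' h
      have h1 : Nat.count p (g t) + 1 = Nat.count p (g t') + 1 := congrArg Subtype.val h
      exact hginj (Nat.count_injective ⟨t, rfl⟩ ⟨t', rfl⟩ (Nat.succ_injective h1))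
    · rintro ⟨n, h1, h2⟩
      obtain ⟨n, rfl⟩ : ∃ m, n = m + 1 := ⟨n - 1, by omega⟩
      have h3 := (hvalid n).1 h2
      obtain ⟨t, ht⟩ := Nat.nth_mem n h3
      refine ⟨t, Subtype.ext ?_⟩
      change Nat.count p (g t) + 1 = n + 1
      rw [ht, Nat.count_nth h3]
  refine ⟨ω, (Equiv.ofBijective r hr).symm, fun m n hmn => ?_⟩
  obtain ⟨t, rfl⟩ := hr.2 m
  obtain ⟨t', rfl⟩ := hr.2 n
  have e : ∀ t, (Equiv.ofBijective r hr).symm (r t) = t := fun t =>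
    (Equiv.ofBijective r hr).symm_apply_apply t
  rw [e, e]
  refine hgle _ _ ?_
  by_contra! hc
  have h1 : Nat.count p (g t') < Nat.count p (g t) := Nat.count_strict_mono ⟨t', rfl⟩ hc
  have h2 : Nat.count p (g t) + 1 ≤ Nat.count p (g t') + 1 := hmn
  omega

variable {F : ℂ → ℂ} {α : ℂ}

/-- The `α`-points are distributed into classes `K = 0, 1, 2, …`, the class being monotone in the
absolute value, with `c k` points in the class `k`, counted with multiplicity, unless there are no
points in higher classes. -/
structure ClassIndex (F : ℂ → ℂ) (α : ℂ) (K : ℂ → ℕ) (c : ℕ → ℕ) : Prop where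
  mono : ∀ z w, F z = α → F w = α → ‖z‖ ≤ ‖w‖ → K z ≤ K w
  bounded : ∀ R : ℝ, ∃ B, ∀ z, F z = α → ‖z‖ ≤ R → K z ≤ B
  mass_le : ∀ k, ∃ n ≤ (c k : ℕ∞), HasMass (alphaMult F α) {z | F z = α ∧ K z = k} n
  mass_eq : ∀ k, (∃ z, F z = α ∧ k < K z) →
    HasMass (alphaMult F α) {z | F z = α ∧ K z = k} (c k)

namespace ClassIndex

variable {K : ℂ → ℕ} {c : ℕ → ℕ}

lemma alphaMult_ne_top (H : ClassIndex F α K c) {z : ℂ} (hz : F z = α) :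
    alphaMult F α z ≠ ⊤ := by
  obtain ⟨n, hn, s, hs, hsum⟩ := H.mass_le (K z)
  have hzs : z ∈ s := by
    have : z ∈ (s : Set ℂ) := by rw [hs]; exact ⟨hz, rfl⟩
    exact this
  have h1 : alphaMult F α z ≤ ∑ w ∈ s, alphaMult F α w :=
    Finset.single_le_sum (fun _ _ => zero_le) hzs
  exact ne_top_of_le_ne_top (ENat.natCast_ne_top (c (K z))) (h1.trans (hsum.le.trans hn))

lemma finite_norm_le (H : ClassIndex F α K c) (R : ℝ) : {z | F z = α ∧ ‖z‖ ≤ R}.Finite := by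
  obtain ⟨B, hB⟩ := H.bounded R
  have : {z | F z = α ∧ ‖z‖ ≤ R} ⊆ ⋃ k ∈ Finset.range (B + 1), {z | F z = α ∧ K z = k} := by
    rintro z ⟨h1, h2⟩
    simp only [Set.mem_iUnion, Finset.mem_range]
    exact ⟨K z, Nat.lt_succ_of_le (hB z h1 h2), h1, rfl⟩
  refine Set.Finite.subset (Set.Finite.biUnion (Finset.finite_toSet _) fun k _ => ?_) this
  obtain ⟨n, -, s, hs, -⟩ := H.mass_le k
  rw [← hs]
  exact s.finite_toSet

lemma exists_enumeration (H : ClassIndex F α K c) :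
    ∃ (ω : ℕ∞) (z : ℕ → ℂ), IsAlphaEnumeration F α ω z := by
  classical
  -- One copy `(z, i)` for each unit of multiplicity, so that a bijective numbering of `T` repeats
  -- each point as required.
  set T : Type := {x : ℂ × ℕ // F x.1 = α ∧ (x.2 : ℕ∞) < alphaMult F α x.1}
  have hfin : ∀ R, {t : T | ‖t.1.1‖ ≤ R}.Finite := by
    intro R
    have h1 : (⋃ z ∈ {z | F z = α ∧ ‖z‖ ≤ R},
        (fun i : ℕ => (z, i)) '' Set.Iio (alphaMult F α z).toNat).Finite :=
      Set.Finite.biUnion (H.finite_norm_le R) fun z _ => (Set.finite_Iio _).image _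
    refine Set.Finite.of_finite_image (f := Subtype.val) (h1.subset ?_) Subtype.val_injective.injOn
    rintro _ ⟨⟨⟨z, i⟩, hz, hi⟩, hR, rfl⟩
    simp only [Set.mem_iUnion]
    refine ⟨z, ⟨hz, hR⟩, i, ?_, rfl⟩
    rw [← ENat.natCast_toNat (H.alphaMult_ne_top hz)] at hi
    exact_mod_cast hi
  obtain ⟨ω, e, he⟩ := exists_monotone_numbering (fun t : T => ‖t.1.1‖) hfin
  set z : ℕ → ℂ := fun n => if h : 1 ≤ n ∧ (n : ℕ∞) ≤ ω then (e ⟨n, h⟩).1.1 else 0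
  have hz : ∀ (n : ℕ) (h : 1 ≤ n ∧ (n : ℕ∞) ≤ ω), z n = (e ⟨n, h⟩).1.1 := fun n h => dif_pos h
  refine ⟨ω, z, ⟨fun n h1 h2 => ?_, fun w hw => ?_, fun n h1 h2 => ?_⟩⟩
  · rw [hz n ⟨h1, h2⟩]
    exact (e _).2.1
  · have e1 : {n : ℕ | 1 ≤ n ∧ (n : ℕ∞) ≤ ω ∧ z n = w} =
        (fun t : T => ((e.symm t : IndexUpTo ω) : ℕ)) '' {t | t.1.1 = w} := by
      ext n
      constructor
      · rintro ⟨h1, h2, h3⟩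
        exact ⟨e ⟨n, h1, h2⟩, by rw [hz n ⟨h1, h2⟩] at h3; exact h3, by simp⟩
      · rintro ⟨t, ht, rfl⟩
        refine ⟨(e.symm t).2.1, (e.symm t).2.2, ?_⟩
        rw [hz _ (e.symm t).2]
        simpa using ht
    rw [e1, Function.Injective.encard_image (f := fun t : T => ((e.symm t : IndexUpTo ω) : ℕ))
      (Subtype.val_injective.comp e.symm.injective)]
    have e2 : (fun t : T => t.1.2) '' {t | t.1.1 = w} = Finset.range (alphaMult F α w).toNat := by
      ext i
      simp only [Set.mem_image, Set.mem_ofPred_eq, Finset.coe_range, Set.mem_Iio]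
      constructor
      · rintro ⟨⟨⟨z, i⟩, hz, hi⟩, rfl, rfl⟩
        rw [← ENat.natCast_toNat (H.alphaMult_ne_top hz)] at hi
        exact_mod_cast hi
      · intro hi
        refine ⟨⟨(w, i), hw, ?_⟩, rfl, rfl⟩
        change (i : ℕ∞) < alphaMult F α w
        rw [← ENat.natCast_toNat (H.alphaMult_ne_top hw)]
        exact_mod_cast hi
    have hinj : Set.InjOn (fun t : T => t.1.2) {t | t.1.1 = w} := by
      rintro ⟨⟨z, i⟩, hz⟩ h1 ⟨⟨z', i'⟩, hz'⟩ h2 h3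
      simp only [Set.mem_ofPred_eq] at h1 h2 h3
      subst h1 h2 h3
      rfl
    rw [← hinj.encard_image, e2, Set.encard_coe_eq_coe_finsetCard, Finset.card_range,
      ENat.natCast_toNat (H.alphaMult_ne_top hw)]
  · have h3 : (n : ℕ∞) ≤ ω := le_trans (by exact_mod_cast Nat.le_succ n) h2
    rw [hz n ⟨h1, h3⟩, hz (n + 1) ⟨by omega, h2⟩]
    exact he _ _ (Nat.le_succ n)

end ClassIndex

namespace IsAlphaEnumeration

variable {ω : ℕ∞} {z : ℕ → ℂ}

lemma norm_mono (E : IsAlphaEnumeration F α ω z) {m n : ℕ} (hm : 1 ≤ m) (hmn : m ≤ n)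
    (hn : (n : ℕ∞) ≤ ω) : ‖z m‖ ≤ ‖z n‖ := by
  induction n, hmn using Nat.le_induction with
  | base => exact le_rfl
  | succ n hmn ih =>
    exact (ih (le_trans (by exact_mod_cast Nat.le_succ n) hn)).trans
      (E.norm_le n (hm.trans hmn) hn)

lemma encard_of_hasMass (E : IsAlphaEnumeration F α ω z) {W : Set ℂ} (hW : ∀ w ∈ W, F w = α)
    {c : ℕ∞} (h : HasMass (alphaMult F α) W c) :
    {n : ℕ | 1 ≤ n ∧ (n : ℕ∞) ≤ ω ∧ z n ∈ W}.encard = c := by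
  classical
  obtain ⟨s, rfl, rfl⟩ := h
  induction s using Finset.induction_on with
  | empty => simp
  | insert w s hw ih =>
    have e : {n : ℕ | 1 ≤ n ∧ (n : ℕ∞) ≤ ω ∧ z n ∈ ((insert w s : Finset ℂ) : Set ℂ)} =
        {n : ℕ | 1 ≤ n ∧ (n : ℕ∞) ≤ ω ∧ z n = w} ∪
        {n : ℕ | 1 ≤ n ∧ (n : ℕ∞) ≤ ω ∧ z n ∈ (s : Set ℂ)} := by
      ext n
      simp only [Finset.coe_insert, Set.mem_insert_iff, Set.mem_ofPred_eq, Set.mem_union]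
      tauto
    rw [e, Set.encard_union_eq, Finset.sum_insert hw, E.count w (hW w (by simp)),
      ih fun x hx => hW x (by simp [Finset.mem_coe.1 hx])]
    rw [Set.disjoint_left]
    rintro n ⟨-, -, h1⟩ ⟨-, -, h2⟩
    exact hw (h1 ▸ h2)

/-- The position in the list determines the class. -/
lemma class_bounds (E : IsAlphaEnumeration F α ω z) {K : ℂ → ℕ} {c : ℕ → ℕ}
    (H : ClassIndex F α K c) {n : ℕ} (h1 : 1 ≤ n) (h2 : (n : ℕ∞) ≤ ω) :
    ∑ i ∈ Finset.range (K (z n)), c i < n ∧ n ≤ ∑ i ∈ Finset.range (K (z n) + 1), c i := by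
  -- The entries of classes below `k`: at most `∑ i < k, c i` of them, and exactly so many for `k ≤
  -- K (z n)`, because `z n` witnesses that the lower classes are full. All entries of lower class
  -- precede `n`, and all entries up to `n` have class at most `K (z n)`.
  set S : ℕ → Set ℕ := fun k => {m : ℕ | 1 ≤ m ∧ (m : ℕ∞) ≤ ω ∧ K (z m) < k}
  have hstep : ∀ k, (S (k + 1)).encard = (S k).encard +
      {m : ℕ | 1 ≤ m ∧ (m : ℕ∞) ≤ ω ∧ z m ∈ {w | F w = α ∧ K w = k}}.encard := by
    intro k
    rw [← Set.encard_union_eq]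
    · congr 1
      ext m
      simp only [S, Set.mem_ofPred_eq, Set.mem_union]
      constructor
      · rintro ⟨h3, h4, h5⟩
        rcases Nat.lt_succ_iff_lt_or_eq.1 h5 with h6 | h6
        · exact Or.inl ⟨h3, h4, h6⟩
        · exact Or.inr ⟨h3, h4, E.isAlphaPoint m h3 h4, h6⟩
      · rintro (⟨h3, h4, h5⟩ | ⟨h3, h4, -, h5⟩)
        · exact ⟨h3, h4, by omega⟩
        · exact ⟨h3, h4, by omega⟩
    · rw [Set.disjoint_left]
      rintro m ⟨-, -, h3⟩ ⟨-, -, -, h4⟩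
      omega
  have hS0 : (S 0).encard = 0 := by simp [S]
  have hle : ∀ k, (S k).encard ≤ ((∑ i ∈ Finset.range k, c i : ℕ) : ℕ∞) := by
    intro k
    induction k with
    | zero => simp [hS0]
    | succ k ih =>
      obtain ⟨x, hx, hm⟩ := H.mass_le k
      rw [hstep, E.encard_of_hasMass (fun w hw => hw.1) hm, Finset.sum_range_succ, Nat.cast_add]
      exact add_le_add ih hx
  have heq : ∀ k, k ≤ K (z n) → (S k).encard = ((∑ i ∈ Finset.range k, c i : ℕ) : ℕ∞) := by
    intro k
    induction k with
    | zero => intro _; simp [hS0]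
    | succ k ih =>
      intro hk
      rw [hstep, ih (by omega), E.encard_of_hasMass (fun w hw => hw.1)
        (H.mass_eq k ⟨z n, E.isAlphaPoint n h1 h2, hk⟩), Finset.sum_range_succ, Nat.cast_add]
  constructor
  · have hsub : S (K (z n)) ⊆ (Finset.Ico 1 n : Finset ℕ) := by
      rintro m ⟨h3, h4, h5⟩
      rw [Finset.coe_Ico, Set.mem_Ico]
      refine ⟨h3, ?_⟩
      by_contra! hc
      have := H.mono _ _ (E.isAlphaPoint n h1 h2) (E.isAlphaPoint m h3 h4) (E.norm_mono h1 hc h4)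
      omega
    have h3 := Set.encard_le_encard hsub
    rw [heq _ le_rfl, Set.encard_coe_eq_coe_finsetCard, Nat.card_Ico, Nat.cast_le] at h3
    omega
  · have hsub : ((Finset.Icc 1 n : Finset ℕ) : Set ℕ) ⊆ S (K (z n) + 1) := by
      intro m hm
      rw [Finset.coe_Icc, Set.mem_Icc] at hm
      have h3 : (m : ℕ∞) ≤ ω := le_trans (by exact_mod_cast hm.2) h2
      have := H.mono _ _ (E.isAlphaPoint m hm.1 h3) (E.isAlphaPoint n h1 h2)
        (E.norm_mono hm.1 hm.2 h2)
      exact ⟨hm.1, h3, by omega⟩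
    have h3 := (Set.encard_le_encard hsub).trans (hle _)
    rw [Set.encard_coe_eq_coe_finsetCard, Nat.card_Icc, Nat.cast_le] at h3
    omega

end IsAlphaEnumeration

end Enumeration

/-! ### Angles in the open quarter turns. -/

section Trigonometry

lemma abs_neg_one_zpow_eq (n : ℤ) : |(-1 : ℝ) ^ n| = 1 := by
  rw [abs_zpow, abs_neg, abs_one, one_zpow]

lemma floor_quarter_iff {x : ℝ} {m : ℤ} (h : x ≠ m * (Real.pi / 2)) :
    ⌊x / (Real.pi / 2)⌋ = m ↔ m * (Real.pi / 2) < x ∧ x < (m + 1) * (Real.pi / 2) := by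
  have hp : 0 < Real.pi / 2 := by have := Real.pi_pos; positivity
  rw [Int.floor_eq_iff, le_div_iff₀ hp, div_lt_iff₀ hp]
  exact ⟨fun h1 => ⟨lt_of_le_of_ne h1.1 h.symm, h1.2⟩, fun h1 => ⟨h1.1.le, h1.2⟩⟩

/-- Every such quarter lies in some `(k * π, (k + 1) * π)`, where the sine has the sign of `(-1) ^
k`. -/
lemma sin_mul_sin_pos {x y : ℝ} {m : ℤ} (hx : m * (Real.pi / 2) < x)
    (hx' : x < (m + 1) * (Real.pi / 2)) (hy : m * (Real.pi / 2) < y)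
    (hy' : y < (m + 1) * (Real.pi / 2)) : 0 < Real.sin x * Real.sin y := by
  obtain ⟨k, hk⟩ : ∃ k : ℤ, k * Real.pi ≤ m * (Real.pi / 2) ∧
      (m + 1) * (Real.pi / 2) ≤ (k + 1) * Real.pi := by
    have hp := Real.pi_pos
    rcases Int.even_or_odd' m with ⟨k, rfl | rfl⟩
    · exact ⟨k, by push_cast; linarith, by push_cast; nlinarith⟩
    · exact ⟨k, by push_cast; nlinarith, by push_cast; nlinarith⟩
  have key : ∀ t, m * (Real.pi / 2) < t → t < (m + 1) * (Real.pi / 2) →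
      0 < (-1 : ℝ) ^ k * Real.sin t := by
    intro t h1 h2
    have h3 := Real.sin_add_int_mul_pi (t - k * Real.pi) k
    rw [sub_add_cancel] at h3
    have h4 : (-1 : ℝ) ^ k * (-1 : ℝ) ^ k = 1 := by
      rw [← abs_mul_abs_self, abs_neg_one_zpow_eq, one_mul]
    rw [h3, ← mul_assoc, h4, one_mul]
    exact Real.sin_pos_of_pos_of_lt_pi (by linarith) (by linarith)
  have h := mul_pos (key x hx hx') (key y hy hy')
  have h4 : (-1 : ℝ) ^ k * (-1 : ℝ) ^ k = 1 := by
    rw [← abs_mul_abs_self, abs_neg_one_zpow_eq, one_mul]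
  have e : (-1 : ℝ) ^ k * Real.sin x * ((-1 : ℝ) ^ k * Real.sin y) =
      Real.sin x * Real.sin y := by linear_combination (Real.sin x * Real.sin y) * h4
  rwa [e] at h

lemma cos_mul_cos_pos {x y : ℝ} {m : ℤ} (hx : m * (Real.pi / 2) < x)
    (hx' : x < (m + 1) * (Real.pi / 2)) (hy : m * (Real.pi / 2) < y)
    (hy' : y < (m + 1) * (Real.pi / 2)) : 0 < Real.cos x * Real.cos y := by
  rw [← Real.sin_add_pi_div_two, ← Real.sin_add_pi_div_two]
  refine sin_mul_sin_pos (m := m + 1) ?_ ?_ ?_ ?_ <;> push_cast <;> linarith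

lemma eq_of_abs_eq_of_mul_pos {x y : ℝ} (h : |x| = |y|) (hp : 0 < x * y) : x = y := by
  rcases abs_eq_abs.1 h with h | h
  · exact h
  · rw [h] at hp
    nlinarith [mul_self_nonneg y]

lemma eq_of_same_quarter {x y : ℝ} {m : ℤ} (hx : m * (Real.pi / 2) < x)
    (hx' : x < (m + 1) * (Real.pi / 2)) (hy : m * (Real.pi / 2) < y)
    (hy' : y < (m + 1) * (Real.pi / 2)) (hc : |Real.cos x| = |Real.cos y|)
    (hs : |Real.sin x| = |Real.sin y|) : x = y := by
  have h1 := eq_of_abs_eq_of_mul_pos hc (cos_mul_cos_pos hx hx' hy hy')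
  have h2 := eq_of_abs_eq_of_mul_pos hs (sin_mul_sin_pos hx hx' hy hy')
  have h3 : Real.cos (x - y) = 1 := by
    rw [Real.cos_sub, h1, h2]
    nlinarith [Real.sin_sq_add_cos_sq y]
  have hp := Real.pi_pos
  have := (Real.cos_eq_one_iff_of_lt_of_lt (by linarith) (by linarith)).1 h3
  linarith

lemma exists_angle_in_quarter {α : ℂ} (hre : α.re ≠ 0) (him : α.im ≠ 0) (m : ℤ) :
    ∃ t, m * (Real.pi / 2) < t ∧ t < (m + 1) * (Real.pi / 2) ∧
      |‖α‖ * Real.cos t| = |α.re| ∧ |‖α‖ * Real.sin t| = |α.im| := by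
  set ζ : ℂ := ⟨|α.re|, |α.im|⟩
  have hn : ‖ζ‖ = ‖α‖ := by
    rw [Complex.norm_def, Complex.norm_def, Complex.normSq_apply, Complex.normSq_apply]
    simp only [ζ, abs_mul_abs_self]
  have hc : ‖α‖ * Real.cos (Complex.arg ζ) = |α.re| := by
    rw [← hn, Complex.norm_mul_cos_arg]
  have hs : ‖α‖ * Real.sin (Complex.arg ζ) = |α.im| := by
    rw [← hn, Complex.norm_mul_sin_arg]
  have h0 : 0 < Complex.arg ζ := by
    refine lt_of_le_of_ne (Complex.arg_nonneg_iff.2 (abs_nonneg _)) fun h => ?_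
    rw [← h, Real.sin_zero, mul_zero, eq_comm, abs_eq_zero] at hs
    exact him hs
  have h1 : Complex.arg ζ < Real.pi / 2 := by
    refine lt_of_le_of_ne ((le_abs_self _).trans
      (Complex.abs_arg_le_pi_div_two_iff.2 (abs_nonneg _))) fun h => ?_
    rw [h, Real.cos_pi_div_two, mul_zero, eq_comm, abs_eq_zero] at hc
    exact hre hc
  have hc' : |‖α‖ * Real.cos (Complex.arg ζ)| = |α.re| := by rw [hc, abs_abs]
  have hs' : |‖α‖ * Real.sin (Complex.arg ζ)| = |α.im| := by rw [hs, abs_abs]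
  rw [abs_mul] at hc' hs'
  -- The angle of `(|Re α|, |Im α|)` lies in the first quarter. Even quarters are translates of it
  -- by multiples of `π`; odd ones also need a reflection.
  rcases Int.even_or_odd' m with ⟨k, rfl | rfl⟩
  · refine ⟨Complex.arg ζ + k * Real.pi, by push_cast; linarith, by push_cast; linarith, ?_, ?_⟩
    · rw [Real.cos_add_int_mul_pi, abs_mul, abs_mul, abs_neg_one_zpow_eq, one_mul, hc']
    · rw [Real.sin_add_int_mul_pi, abs_mul, abs_mul, abs_neg_one_zpow_eq, one_mul, hs']
  · refine ⟨-Complex.arg ζ + (k + 1 : ℤ) * Real.pi, by push_cast; linarith, by push_cast; linarith,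
      ?_, ?_⟩
    · rw [Real.cos_add_int_mul_pi, abs_mul, abs_mul, abs_neg_one_zpow_eq, one_mul, Real.cos_neg, hc']
    · rw [Real.sin_add_int_mul_pi, abs_mul, abs_mul, abs_neg_one_zpow_eq, one_mul, Real.sin_neg,
        abs_neg, hs']

lemma exists_isSign_of_abs_eq {x y : ℝ} (h : |x| = |y|) : ∃ σ, IsSign σ ∧ x = σ * y := by
  rcases abs_eq_abs.1 h with h | h
  · exact ⟨1, Or.inl rfl, by rw [h, one_mul]⟩
  · exact ⟨-1, Or.inr rfl, by rw [h]; ring⟩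

end Trigonometry

/-! ### The classes of `α`-points by phase and the multiplicity in each class. -/

namespace PowerForm

open Complex Filter Topology ComplexConjugate

variable {ι κ : Type*} {d : PowerForm ι κ} {α : ℂ}

/-- The phase at the point of the level curve which corresponds to the `α`-point `z`. -/
noncomputable def pointPhase (d : PowerForm ι κ) (α z : ℂ) : ℝ :=
  d.phase (Real.log ‖α‖) (Real.log ‖z‖)

lemma sin_phase_of_theta {c s : ℝ} (h : d.theta c s = 0) : Real.sin (d.phase c s) = 0 := by
  obtain ⟨-, k, hk⟩ := phase_of_theta_eq_zero h
  rw [hk, Real.sin_int_mul_pi]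

lemma cos_phase_of_theta (hodd : Odd d.p) {c s : ℝ} (h : d.theta c s = Real.pi / 2) :
    Real.cos (d.phase c s) = 0 := by
  obtain ⟨-, k, hk⟩ := phase_of_theta_eq_pi_div_two h
  obtain ⟨j, hj⟩ := hodd
  have : d.phase c s = (j + k : ℤ) * Real.pi + Real.pi / 2 := by
    rw [hk, hj]; push_cast; ring
  rw [this, Real.cos_add_pi_div_two, Real.sin_int_mul_pi, neg_zero]

lemma theta_lt_of_cos_ne_zero (hodd : Odd d.p) {c s : ℝ} (h : Real.cos (d.phase c s) ≠ 0) :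
    d.theta c s < Real.pi / 2 :=
  lt_of_le_of_ne (theta_mem c s).2 fun h0 => h (cos_phase_of_theta hodd h0)

lemma theta_pos_of_sin_ne_zero {c s : ℝ} (h : Real.sin (d.phase c s) ≠ 0) :
    0 < d.theta c s :=
  lt_of_le_of_ne (theta_mem c s).1 fun h0 => h (sin_phase_of_theta h0.symm)

/-- Both `z.re` and `|α| * cos` of the phase carry the same sign `σ`, the latter as `σ * α.re`; so
`σ` cancels and a positive multiple of the squared cosine remains. -/
lemma re_mul_cos_pos (hodd : Odd d.p) (hα : α ≠ 0) (hre : α.re ≠ 0) {z : ℂ} (hz : d.eval z = α) :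
    0 < z.re * α.re * Real.cos (d.pointPhase α z) := by
  obtain ⟨σ, ρ, h, h1⟩ := exists_levelPoint hodd hα hz
  have hσ := h.sign_re.ne_zero
  have hc : Real.cos (d.pointPhase α z) ≠ 0 := by
    intro h0
    have := h.cos
    change _ * Real.cos (d.pointPhase α z) = _ at this
    rw [h0, mul_zero, eq_comm, mul_eq_zero] at this
    exact this.elim hσ hre
  have hth := Real.cos_pos_of_mem_Ioo ⟨by
    have := (theta_mem (d := d) (Real.log ‖α‖) (Real.log ‖z‖)).1
    have := Real.pi_pos
    linarith, theta_lt_of_cos_ne_zero hodd hc⟩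
  have e : z.re * α.re * Real.cos (d.pointPhase α z) = ‖α‖ * (Real.exp (Real.log ‖z‖) *
      Real.cos (d.theta (Real.log ‖α‖) (Real.log ‖z‖))) * Real.cos (d.pointPhase α z) ^ 2 := by
    have h2 : z.re = _ := (congrArg Complex.re h1).trans (lift_re _ _ _ _)
    have h3 := h.cos
    change _ * Real.cos (d.pointPhase α z) = _ at h3
    rw [h2]
    linear_combination -(Real.exp (Real.log ‖z‖) *
      Real.cos (d.theta (Real.log ‖α‖) (Real.log ‖z‖))) * Real.cos (d.pointPhase α z) * h3
  rw [e]
  have := norm_pos_iff.2 hα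
  have := Real.exp_pos (Real.log ‖z‖)
  positivity

lemma im_mul_sin_pos (hodd : Odd d.p) (hα : α ≠ 0) (him : α.im ≠ 0) {z : ℂ} (hz : d.eval z = α) :
    0 < z.im * α.im * Real.sin (d.pointPhase α z) := by
  obtain ⟨σ, ρ, h, h1⟩ := exists_levelPoint hodd hα hz
  have hρ := h.sign_im.ne_zero
  have hs : Real.sin (d.pointPhase α z) ≠ 0 := by
    intro h0
    have := h.sin
    change _ * Real.sin (d.pointPhase α z) = _ at this
    rw [h0, mul_zero, eq_comm, mul_eq_zero] at this
    exact this.elim hρ him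
  have hth := Real.sin_pos_of_pos_of_lt_pi (theta_pos_of_sin_ne_zero hs) (by
    have := (theta_mem (d := d) (Real.log ‖α‖) (Real.log ‖z‖)).2
    have := Real.pi_pos
    linarith)
  have e : z.im * α.im * Real.sin (d.pointPhase α z) = ‖α‖ * (Real.exp (Real.log ‖z‖) *
      Real.sin (d.theta (Real.log ‖α‖) (Real.log ‖z‖))) * Real.sin (d.pointPhase α z) ^ 2 := by
    have h2 : z.im = _ := (congrArg Complex.im h1).trans (lift_im _ _ _ _)
    have h3 := h.sin
    change _ * Real.sin (d.pointPhase α z) = _ at h3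
    rw [h2]
    linear_combination -(Real.exp (Real.log ‖z‖) *
      Real.sin (d.theta (Real.log ‖α‖) (Real.log ‖z‖))) * Real.sin (d.pointPhase α z) * h3
  rw [e]
  have := norm_pos_iff.2 hα
  have := Real.exp_pos (Real.log ‖z‖)
  positivity

lemma pointPhase_mono (hodd : Odd d.p) (hα : α ≠ 0) {z w : ℂ} (hz : d.eval z = α)
    (h : ‖z‖ ≤ ‖w‖) : d.pointPhase α z ≤ d.pointPhase α w :=
  monotone_phase _ (Real.log_le_log (norm_pos_iff.2 (ne_zero_of_eval hodd hα hz).1) h)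

lemma class_mono (hodd : Odd d.p) (hα : α ≠ 0) {x : ℝ} (hx : 0 < x) (k : ℤ) {z w : ℂ}
    (hz : d.eval z = α) (h : ‖z‖ ≤ ‖w‖) : (⌊d.pointPhase α z / x⌋ - k).toNat ≤
      (⌊d.pointPhase α w / x⌋ - k).toNat := by
  exact Int.toNat_le_toNat (sub_le_sub_right (Int.floor_le_floor
    (div_le_div_of_nonneg_right (pointPhase_mono hodd hα hz h) hx.le)) _)

lemma class_bounded (hodd : Odd d.p) (hα : α ≠ 0) {x : ℝ} (hx : 0 < x) (k : ℤ) (R : ℝ) :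
    ∃ B, ∀ z, d.eval z = α → ‖z‖ ≤ R → (⌊d.pointPhase α z / x⌋ - k).toNat ≤ B := by
  -- The phase depends on the modulus only, so the real number `R` stands for its circle, whether or
  -- not it is an `α`-point.
  refine ⟨(⌊d.pointPhase α R / x⌋ - k).toNat, fun z hz h => class_mono hodd hα hx k hz ?_⟩
  rw [Complex.norm_real]
  exact h.trans (le_abs_self R)

section Classes

variable {j : ℤ}

lemma odd_of_eq (hp : d.p = 2 * j + 1) : Odd d.p := ⟨j, hp⟩

lemma neg_of_eq (hj : j < 0) (hp : d.p = 2 * j + 1) : d.p < 0 := by omega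

lemma pointPhase_ge (hj : j < 0) (hp : d.p = 2 * j + 1) (z : ℂ) :
    (2 * j + 1 : ℤ) * (Real.pi / 2) ≤ d.pointPhase α z := by
  rw [← hp]
  exact phase_ge (neg_of_eq hj hp) _ _

lemma exists_pointPhase_real (hj : j < 0) (hp : d.p = 2 * j + 1) (hα : α ≠ 0) (him : α.im = 0)
    {z : ℂ} (hz : d.eval z = α) : ∃ l : ℕ, d.pointPhase α z = (j + 1 + l : ℤ) * Real.pi := by
  obtain ⟨σ, ρ, h, -⟩ := exists_levelPoint (odd_of_eq hp) hα hz
  have h1 := h.sin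
  rw [him, mul_zero] at h1
  obtain ⟨k, hk⟩ := Real.sin_eq_zero_iff.1 ((mul_eq_zero.1 h1).resolve_left (norm_ne_zero_iff.2 hα))
  change _ = d.pointPhase α z at hk
  have h2 := pointPhase_ge (α := α) hj hp z
  rw [← hk] at h2 ⊢
  have h3 : j < k := by
    by_contra! hc
    have hc' : (k : ℝ) ≤ j := by exact_mod_cast hc
    push_cast at h2
    nlinarith [Real.pi_pos]
  obtain ⟨l, hl⟩ := Int.eq_ofNat_of_zero_le (by omega : 0 ≤ k - (j + 1))
  refine ⟨l, ?_⟩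
  rw [← hl]; push_cast; ring

lemma exists_pointPhase_imag (hj : j < 0) (hp : d.p = 2 * j + 1) (hα : α ≠ 0) (hre : α.re = 0)
    {z : ℂ} (hz : d.eval z = α) :
    ∃ l : ℕ, d.pointPhase α z = (j + l : ℤ) * Real.pi + Real.pi / 2 := by
  obtain ⟨σ, ρ, h, -⟩ := exists_levelPoint (odd_of_eq hp) hα hz
  have h1 := h.cos
  rw [hre, mul_zero] at h1
  obtain ⟨k, hk⟩ := Real.cos_eq_zero_iff.1 ((mul_eq_zero.1 h1).resolve_left (norm_ne_zero_iff.2 hα))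
  change d.pointPhase α z = _ at hk
  have h2 := pointPhase_ge (α := α) hj hp z
  rw [hk] at h2 ⊢
  have h3 : j ≤ k := by
    by_contra! hc
    have hc' : (k : ℝ) + 1 ≤ j := by exact_mod_cast hc
    push_cast at h2
    nlinarith [Real.pi_pos]
  obtain ⟨l, hl⟩ := Int.eq_ofNat_of_zero_le (by omega : 0 ≤ k - j)
  refine ⟨l, ?_⟩
  rw [← hl]; push_cast; ring

/-- The class of an `α`-point for real `α`. -/
noncomputable def realClass (d : PowerForm ι κ) (α : ℂ) (j : ℤ) (z : ℂ) : ℕ :=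
  (⌊d.pointPhase α z / Real.pi⌋ - (j + 1)).toNat

/-- The class of an `α`-point for purely imaginary `α`. -/
noncomputable def imagClass (d : PowerForm ι κ) (α : ℂ) (j : ℤ) (z : ℂ) : ℕ :=
  (⌊d.pointPhase α z / Real.pi⌋ - j).toNat

/-- The class of an `α`-point for `α` off the axes. -/
noncomputable def genericClass (d : PowerForm ι κ) (α : ℂ) (j : ℤ) (z : ℂ) : ℕ :=
  (⌊d.pointPhase α z / (Real.pi / 2)⌋ - (2 * j + 1)).toNat

lemma pointPhase_eq_realClass (hj : j < 0) (hp : d.p = 2 * j + 1) (hα : α ≠ 0) (him : α.im = 0)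
    {z : ℂ} (hz : d.eval z = α) :
    d.pointPhase α z = (j + 1 + d.realClass α j z : ℤ) * Real.pi := by
  obtain ⟨l, hl⟩ := exists_pointPhase_real hj hp hα him hz
  have : d.realClass α j z = l := by
    rw [realClass, hl, mul_div_cancel_right₀ _ Real.pi_ne_zero, Int.floor_intCast]
    omega
  rw [this, hl]

lemma pointPhase_eq_imagClass (hj : j < 0) (hp : d.p = 2 * j + 1) (hα : α ≠ 0) (hre : α.re = 0)
    {z : ℂ} (hz : d.eval z = α) :
    d.pointPhase α z = (j + d.imagClass α j z : ℤ) * Real.pi + Real.pi / 2 := by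
  obtain ⟨l, hl⟩ := exists_pointPhase_imag hj hp hα hre hz
  have : d.imagClass α j z = l := by
    have e : ((j + l : ℤ) * Real.pi + Real.pi / 2) / Real.pi = (j + l : ℤ) + 1 / 2 := by
      have := Real.pi_ne_zero
      field_simp
    have e2 : ⌊((j + l : ℤ) : ℝ) + 1 / 2⌋ = j + l := by
      rw [Int.floor_eq_iff]
      constructor <;> linarith
    rw [imagClass, hl, e, e2]
    omega
  rw [this, hl]

lemma realClass_fiber (hj : j < 0) (hp : d.p = 2 * j + 1) (hα : α ≠ 0) (him : α.im = 0) (k : ℕ) :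
    {z | d.eval z = α ∧ d.realClass α j z = k} = d.phaseFiber α ((j + 1 + k : ℤ) * Real.pi) := by
  ext z
  refine and_congr_right fun hz => ?_
  have h := pointPhase_eq_realClass hj hp hα him hz
  change _ ↔ d.pointPhase α z = _
  rw [h]
  constructor
  · intro h1; rw [h1]
  · intro h1
    have := Int.cast_injective (mul_right_cancel₀ Real.pi_ne_zero h1)
    omega

lemma imagClass_fiber (hj : j < 0) (hp : d.p = 2 * j + 1) (hα : α ≠ 0) (hre : α.re = 0) (k : ℕ) :
    {z | d.eval z = α ∧ d.imagClass α j z = k} =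
      d.phaseFiber α ((j + k : ℤ) * Real.pi + Real.pi / 2) := by
  ext z
  refine and_congr_right fun hz => ?_
  have h := pointPhase_eq_imagClass hj hp hα hre hz
  change _ ↔ d.pointPhase α z = _
  rw [h]
  constructor
  · intro h1; rw [h1]
  · intro h1
    have := Int.cast_injective (mul_right_cancel₀ Real.pi_ne_zero (add_right_cancel h1))
    omega

/-- The initial phase `j * π + π / 2` lies below all admissible levels `(j + 1 + k) * π`, so each
level that is passed is crossed from below. -/
lemma classIndex_real (hj : j < 0) (hp : d.p = 2 * j + 1) (hα : α ≠ 0) (him : α.im = 0) :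
    ClassIndex d.eval α (d.realClass α j) fun _ => 2 := by
  have hodd := odd_of_eq hp
  have hpi := Real.pi_pos
  obtain ⟨s₀, h₀⟩ := phase_near_bot (neg_of_eq hj hp) (Real.log ‖α‖)
  have hbot : ∀ k : ℕ, d.phase (Real.log ‖α‖) s₀ < (j + 1 + k : ℤ) * Real.pi := by
    intro k
    rw [h₀ s₀ le_rfl, hp]
    push_cast
    nlinarith [(Nat.cast_nonneg k : (0 : ℝ) ≤ k)]
  have hfib : ∀ k : ℕ, ∃ σ, IsSign σ ∧
      ‖α‖ * Real.cos ((j + 1 + k : ℤ) * Real.pi) = σ * α.re := by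
    intro k
    refine exists_isSign_of_abs_eq ?_
    rw [abs_mul, Real.abs_cos_int_mul_pi, mul_one, abs_norm]
    exact Complex.abs_re_eq_norm.2 him |>.symm
  refine ⟨fun z w hz _ h => class_mono hodd hα hpi _ hz h, class_bounded hodd hα hpi _,
    fun k => ?_, fun k => ?_⟩
  · obtain ⟨σ, hσ, hcos⟩ := hfib k
    rw [realClass_fiber hj hp hα him]
    exact (edgeFiber_real hodd hα him _ hσ hcos).hasMass_le_two (hbot k)
  · rintro ⟨z, hz, hk⟩
    obtain ⟨σ, hσ, hcos⟩ := hfib k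
    rw [realClass_fiber hj hp hα him]
    refine (edgeFiber_real hodd hα him _ hσ hcos).hasMass_two (hbot k) (t := Real.log ‖z‖) ?_
    change _ < d.pointPhase α z
    rw [pointPhase_eq_realClass hj hp hα him hz]
    refine mul_lt_mul_of_pos_right ?_ hpi
    exact_mod_cast (by omega : j + 1 + (k : ℤ) < j + 1 + d.realClass α j z)

/-- The level of class `0` is the initial phase itself; its level set is unbounded to the left, so
it loses one point. -/
lemma classIndex_imag (hj : j < 0) (hp : d.p = 2 * j + 1) (hα : α ≠ 0) (hre : α.re = 0) :
    ClassIndex d.eval α (d.imagClass α j) fun k => if k = 0 then 1 else 2 := by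
  have hodd := odd_of_eq hp
  have hpi := Real.pi_pos
  obtain ⟨s₀, h₀⟩ := phase_near_bot (neg_of_eq hj hp) (Real.log ‖α‖)
  have hbot0 : ∀ s ≤ s₀, d.phase (Real.log ‖α‖) s = (j + (0 : ℕ) : ℤ) * Real.pi + Real.pi / 2 := by
    intro s hs
    rw [h₀ s hs, hp]
    push_cast
    ring
  have hbot : ∀ k : ℕ, k ≠ 0 →
      d.phase (Real.log ‖α‖) s₀ < (j + k : ℤ) * Real.pi + Real.pi / 2 := by
    intro k hk
    rw [hbot0 s₀ le_rfl]
    have : (1 : ℝ) ≤ k := by exact_mod_cast Nat.one_le_iff_ne_zero.2 hk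
    push_cast
    nlinarith
  have hfib : ∀ k : ℕ, ∃ ρ, IsSign ρ ∧
      ‖α‖ * Real.sin ((j + k : ℤ) * Real.pi + Real.pi / 2) = ρ * α.im := by
    intro k
    refine exists_isSign_of_abs_eq ?_
    rw [Real.sin_add_pi_div_two, abs_mul, Real.abs_cos_int_mul_pi, mul_one, abs_norm]
    exact Complex.abs_im_eq_norm.2 hre |>.symm
  refine ⟨fun z w hz _ h => class_mono hodd hα hpi _ hz h, class_bounded hodd hα hpi _,
    fun k => ?_, fun k => ?_⟩
  · obtain ⟨ρ, hρ, hsin⟩ := hfib k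
    rw [imagClass_fiber hj hp hα hre]
    have E := edgeFiber_imag hodd hα hre _ hρ hsin
    rcases eq_or_ne k 0 with rfl | hk
    · simpa using (E.hasMass_of_bot hbot0).1
    · simpa [hk] using E.hasMass_le_two (hbot k hk)
  · rintro ⟨z, hz, hk⟩
    obtain ⟨ρ, hρ, hsin⟩ := hfib k
    rw [imagClass_fiber hj hp hα hre]
    have E := edgeFiber_imag hodd hα hre _ hρ hsin
    have htop : (j + k : ℤ) * Real.pi + Real.pi / 2 < d.phase (Real.log ‖α‖) (Real.log ‖z‖) := by
      change _ < d.pointPhase α z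
      rw [pointPhase_eq_imagClass hj hp hα hre hz]
      have : ((j + (k : ℤ) : ℤ) : ℝ) < (j + d.imagClass α j z : ℤ) := by
        exact_mod_cast (by omega : j + (k : ℤ) < j + d.imagClass α j z)
      have := mul_lt_mul_of_pos_right this hpi
      linarith
    rcases eq_or_ne k 0 with rfl | hk
    · simpa using (E.hasMass_of_bot hbot0).2 ⟨_, htop⟩
    · simpa [hk] using E.hasMass_two (hbot k hk) htop

lemma re_ne_zero_and_im_ne_zero (h : (α ^ 2).im ≠ 0) : α.re ≠ 0 ∧ α.im ≠ 0 := by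
  rw [sq, Complex.mul_im] at h
  constructor <;> rintro h0 <;> simp [h0] at h

lemma pointPhase_generic (hodd : Odd d.p) (h2 : (α ^ 2).im ≠ 0) {z : ℂ} (hz : d.eval z = α) :
    Real.cos (d.pointPhase α z) ≠ 0 ∧ Real.sin (d.pointPhase α z) ≠ 0 := by
  obtain ⟨hre, him⟩ := re_ne_zero_and_im_ne_zero h2
  have hα : α ≠ 0 := by rintro rfl; simp at hre
  constructor
  · intro h0
    have := re_mul_cos_pos hodd hα hre hz
    rw [h0, mul_zero] at this
    exact lt_irrefl _ this
  · intro h0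
    have := im_mul_sin_pos hodd hα him hz
    rw [h0, mul_zero] at this
    exact lt_irrefl _ this

lemma ne_int_mul_pi_div_two {x : ℝ} (hc : Real.cos x ≠ 0) (hs : Real.sin x ≠ 0) (m : ℤ) :
    x ≠ m * (Real.pi / 2) := by
  intro h
  have h1 : 2 * x = m * Real.pi := by rw [h]; ring
  have h2 := Real.sin_two_mul x
  rw [h1, Real.sin_int_mul_pi] at h2
  have := mul_ne_zero (mul_ne_zero two_ne_zero hs) hc
  exact this h2.symm

lemma genericClass_bounds (hj : j < 0) (hp : d.p = 2 * j + 1) (h2 : (α ^ 2).im ≠ 0) {z : ℂ}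
    (hz : d.eval z = α) :
    (2 * j + 1 + d.genericClass α j z : ℤ) * (Real.pi / 2) < d.pointPhase α z ∧
    d.pointPhase α z < ((2 * j + 1 + d.genericClass α j z : ℤ) + 1) * (Real.pi / 2) := by
  obtain ⟨hc, hs⟩ := pointPhase_generic (odd_of_eq hp) h2 hz
  have hpi : 0 < Real.pi / 2 := by have := Real.pi_pos; positivity
  have h1 : 2 * j + 1 ≤ ⌊d.pointPhase α z / (Real.pi / 2)⌋ := by
    rw [Int.le_floor, le_div_iff₀ hpi]
    exact pointPhase_ge hj hp z
  have h3 : (2 * j + 1 + d.genericClass α j z : ℤ) = ⌊d.pointPhase α z / (Real.pi / 2)⌋ := by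
    rw [genericClass]; omega
  exact (floor_quarter_iff (ne_int_mul_pi_div_two hc hs _)).1 h3.symm

/-- Within a quarter the absolute values of cosine and sine determine the phase. Equal phases at
different radii would force an edge, where the cosine or the sine vanishes; equal phases at one
radius give equal signs. -/
lemma genericClass_injective (hj : j < 0) (hp : d.p = 2 * j + 1) (h2 : (α ^ 2).im ≠ 0) {z w : ℂ}
    (hz : d.eval z = α) (hw : d.eval w = α) (h : d.genericClass α j z = d.genericClass α j w) :
    z = w := by
  have hodd := odd_of_eq hp
  obtain ⟨hre, him⟩ := re_ne_zero_and_im_ne_zero h2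
  have hα : α ≠ 0 := by rintro rfl; simp at hre
  obtain ⟨a1, a2⟩ := genericClass_bounds hj hp h2 hz
  obtain ⟨b1, b2⟩ := genericClass_bounds hj hp h2 hw
  rw [← h] at b1 b2
  obtain ⟨σ, ρ, l1, e1⟩ := exists_levelPoint hodd hα hz
  obtain ⟨σ', ρ', l2, e2⟩ := exists_levelPoint hodd hα hw
  have hn := norm_pos_iff.2 hα
  have habs : ∀ {σ : ℝ}, IsSign σ → |σ| = 1 := by
    rintro σ (rfl | rfl) <;> simp
  have hcos : |Real.cos (d.pointPhase α z)| = |Real.cos (d.pointPhase α w)| := by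
    have h3 := congrArg abs l1.cos
    have h4 := congrArg abs l2.cos
    rw [abs_mul, abs_mul, habs l1.sign_re, one_mul, abs_norm] at h3
    rw [abs_mul, abs_mul, habs l2.sign_re, one_mul, abs_norm] at h4
    exact mul_left_cancel₀ hn.ne' (h3.trans h4.symm)
  have hsin : |Real.sin (d.pointPhase α z)| = |Real.sin (d.pointPhase α w)| := by
    have h3 := congrArg abs l1.sin
    have h4 := congrArg abs l2.sin
    rw [abs_mul, abs_mul, habs l1.sign_im, one_mul, abs_norm] at h3
    rw [abs_mul, abs_mul, habs l2.sign_im, one_mul, abs_norm] at h4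
    exact mul_left_cancel₀ hn.ne' (h3.trans h4.symm)
  have hph := eq_of_same_quarter a1 a2 b1 b2 hcos hsin
  obtain ⟨hc, hs⟩ := pointPhase_generic hodd h2 hz
  have hlog : Real.log ‖z‖ = Real.log ‖w‖ := by
    by_contra hne
    rcases theta_edge_of_ne hne hph with h5 | h5
    · exact hs (sin_phase_of_theta h5)
    · exact hc (cos_phase_of_theta hodd h5)
  have hσ : σ = σ' := by
    have h3 := l1.cos
    have h4 := l2.cos
    rw [← hlog] at h4
    exact mul_right_cancel₀ hre (h3.symm.trans h4)
  have hρ : ρ = ρ' := by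
    have h3 := l1.sin
    have h4 := l2.sin
    rw [← hlog] at h4
    exact mul_right_cancel₀ him (h3.symm.trans h4)
  rw [e1, e2, hσ, hρ, hlog]

lemma alphaMult_generic (hodd : Odd d.p) (h2 : (α ^ 2).im ≠ 0) {z : ℂ} (hz : d.eval z = α) :
    alphaMult d.eval α z = 1 := by
  obtain ⟨hre, him⟩ := re_ne_zero_and_im_ne_zero h2
  have hα : α ≠ 0 := by rintro rfl; simp at hre
  obtain ⟨hc, hs⟩ := pointPhase_generic hodd h2 hz
  obtain ⟨σ, ρ, l, e⟩ := exists_levelPoint hodd hα hz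
  rw [e]
  exact alphaMult_interior hodd hα l (theta_pos_of_sin_ne_zero hs) (theta_lt_of_cos_ne_zero hodd hc)

lemma classIndex_generic (hj : j < 0) (hp : d.p = 2 * j + 1) (h2 : (α ^ 2).im ≠ 0) :
    ClassIndex d.eval α (d.genericClass α j) fun _ => 1 := by
  have hodd := odd_of_eq hp
  have hpi : 0 < Real.pi / 2 := by have := Real.pi_pos; positivity
  obtain ⟨hre, him⟩ := re_ne_zero_and_im_ne_zero h2
  have hα : α ≠ 0 := by rintro rfl; simp at hre
  have one : ∀ k z, d.eval z = α → d.genericClass α j z = k →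
      HasMass (alphaMult d.eval α) {z | d.eval z = α ∧ d.genericClass α j z = k} 1 := by
    intro k z hz hk
    have : {z | d.eval z = α ∧ d.genericClass α j z = k} = {z} := by
      ext w
      constructor
      · rintro ⟨h3, h4⟩
        exact genericClass_injective hj hp h2 h3 hz (h4.trans hk.symm)
      · rintro rfl
        exact ⟨hz, hk⟩
    rw [this]
    exact hasMass_singleton (alphaMult_generic hodd h2 hz)
  refine ⟨fun z w hz _ h => class_mono hodd hα hpi _ hz h, class_bounded hodd hα hpi _,
    fun k => ?_, fun k => ?_⟩
  · by_cases hex : ∃ z, d.eval z = α ∧ d.genericClass α j z = k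
    · obtain ⟨z, hz, hk⟩ := hex
      exact ⟨1, by simp, one k z hz hk⟩
    · refine ⟨0, by simp, ?_⟩
      have : {z | d.eval z = α ∧ d.genericClass α j z = k} = ∅ := by
        ext z
        simp only [Set.mem_empty_iff_false, iff_false]
        exact fun h => hex ⟨z, h⟩
      rw [this]
      exact hasMass_empty
  · rintro ⟨z, hz, hk⟩
    -- The phase starts below this admissible angle and exceeds it at `z`. The value taken in
    -- between produces a point of class `k`.
    obtain ⟨t, t1, t2, hc, hs⟩ := exists_angle_in_quarter hre him (2 * j + 1 + k)
    obtain ⟨s₀, h₀⟩ := phase_near_bot (neg_of_eq hj hp) (Real.log ‖α‖)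
    have hlow : d.phase (Real.log ‖α‖) s₀ ≤ t := by
      rw [h₀ s₀ le_rfl, hp]
      refine le_trans ?_ t1.le
      refine mul_le_mul_of_nonneg_right ?_ hpi.le
      exact_mod_cast (by omega : 2 * j + 1 ≤ 2 * j + 1 + (k : ℤ))
    have hhigh : t ≤ d.phase (Real.log ‖α‖) (Real.log ‖z‖) := by
      refine t2.le.trans (le_trans ?_ (genericClass_bounds hj hp h2 hz).1.le)
      refine mul_le_mul_of_nonneg_right ?_ hpi.le
      exact_mod_cast (by omega : 2 * j + 1 + (k : ℤ) + 1 ≤ 2 * j + 1 + d.genericClass α j z)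
    obtain ⟨s, hs'⟩ := mem_range_of_exists_le_of_exists_ge (continuous_phase (d := d) (Real.log ‖α‖))
      ⟨s₀, hlow⟩ ⟨_, hhigh⟩
    have hct : Real.cos t ≠ 0 := by
      intro h0
      rw [h0, mul_zero, abs_zero, eq_comm, abs_eq_zero] at hc
      exact hre hc
    have hst : Real.sin t ≠ 0 := by
      intro h0
      rw [h0, mul_zero, abs_zero, eq_comm, abs_eq_zero] at hs
      exact him hs
    obtain ⟨σ, hσ, hcos⟩ := exists_isSign_of_abs_eq hc
    obtain ⟨ρ, hρ, hsin⟩ := exists_isSign_of_abs_eq hs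
    have hl : d.LevelPoint α s σ ρ := by
      refine ⟨hσ, hρ, gap_theta_eq_zero (theta_pos_of_sin_ne_zero ?_)
        (theta_lt_of_cos_ne_zero hodd ?_), ?_, ?_⟩
      · rwa [hs']
      · rwa [hs']
      · rw [hs', hcos]
      · rw [hs', hsin]
    have hev := hl.eval_eq hodd hα
    have hph : d.pointPhase α (d.lift (Real.log ‖α‖) σ ρ s) = t := by
      rw [pointPhase, log_norm_lift hσ hρ, hs']
    refine one k _ hev ?_
    rw [genericClass, hph, (floor_quarter_iff (ne_int_mul_pi_div_two hct hst _)).2 ⟨t1, t2⟩]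
    omega

end Classes

end PowerForm

/-! ### The open quadrants in terms of signs. -/

section Sectors

open Complex

lemma unitRay_two_neg (l : ℤ) : unitRay 2 (-l) = I ^ (-l) := by
  rw [unitRay]
  have : (((((-l : ℤ) : ℝ) * Real.pi / ((2 : ℕ) : ℝ) : ℝ) : ℂ) * I) =
      ((-l : ℤ) : ℂ) * ((Real.pi / 2 : ℂ) * I) := by
    push_cast; ring
  rw [this, Complex.exp_int_mul, Complex.exp_pi_div_two_mul_I]

lemma arg_mem_Ioo_iff (w : ℂ) : (w ≠ 0 ∧ 0 < Complex.arg w ∧ Complex.arg w < Real.pi / 2) ↔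
    0 < w.re ∧ 0 < w.im := by
  constructor
  · rintro ⟨h0, h1, h2⟩
    have hn := norm_pos_iff.2 h0
    rw [← Complex.norm_mul_cos_arg w, ← Complex.norm_mul_sin_arg w]
    exact ⟨mul_pos hn (Real.cos_pos_of_mem_Ioo ⟨by linarith, h2⟩),
      mul_pos hn (Real.sin_pos_of_pos_of_lt_pi h1 (by linarith))⟩
  · rintro ⟨h1, h2⟩
    have h0 : w ≠ 0 := by rintro rfl; simp at h1
    refine ⟨h0, lt_of_le_of_ne (Complex.arg_nonneg_iff.2 h2.le) fun h => ?_,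
      lt_of_le_of_ne ((le_abs_self _).trans (Complex.abs_arg_le_pi_div_two_iff.2 h1.le)) fun h => ?_⟩
    · have := Complex.norm_mul_sin_arg w
      rw [← h, Real.sin_zero, mul_zero] at this
      exact h2.ne this
    · have := Complex.norm_mul_cos_arg w
      rw [h, Real.cos_pi_div_two, mul_zero] at this
      exact h1.ne this

lemma mem_openSector_two_iff (z : ℂ) (l : ℤ) :
    z ∈ openSector 2 l ↔ 0 < (z * I ^ (-l)).re ∧ 0 < (z * I ^ (-l)).im := by
  rw [← arg_mem_Ioo_iff, ← unitRay_two_neg]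
  have h0 : unitRay 2 (-l) ≠ 0 := Complex.exp_ne_zero _
  simp only [openSector, Set.mem_ofPred_eq, Nat.cast_ofNat, mul_ne_zero_iff, h0, ne_eq,
    not_false_eq_true, and_true]

/-- Multiplying both points by `I` exchanges the two sign conditions. The pair is therefore
invariant under rotation and can be tested in the first quadrant. -/
lemma cross_mul_I_zpow (z w : ℂ) (l : ℤ) :
    ((w * I ^ l).re * (z * I ^ l).im < 0 ∧ 0 < (w * I ^ l).im * (z * I ^ l).re) ↔
      (w.re * z.im < 0 ∧ 0 < w.im * z.re) := by
  have step : ∀ x y : ℂ, ((x * I).re * (y * I).im < 0 ∧ 0 < (x * I).im * (y * I).re) ↔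
      (x.re * y.im < 0 ∧ 0 < x.im * y.re) := by
    intro x y
    simp only [Complex.mul_I_re, Complex.mul_I_im]
    constructor
    · rintro ⟨h1, h2⟩; constructor <;> linarith
    · rintro ⟨h1, h2⟩; constructor <;> linarith
  induction l using Int.induction_on with
  | zero => simp
  | succ n ih =>
    rw [zpow_add_one₀ Complex.I_ne_zero, ← mul_assoc w, ← mul_assoc z]
    exact (step _ _).trans ih
  | pred n ih =>
    have e : I ^ (-(n : ℤ)) = I ^ (-(n : ℤ) - 1) * I := by
      rw [← zpow_add_one₀ Complex.I_ne_zero, sub_add_cancel]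
    rw [e, ← mul_assoc w, ← mul_assoc z] at ih
    exact (step _ _).symm.trans ih

/-- A quarter turn, anticlockwise or clockwise, moves a point to the next open quadrant. -/
lemma mem_openSector_next {z w : ℂ} {l : ℤ} (hz : z ∈ openSector 2 l) :
    (w.re * z.im < 0 ∧ 0 < w.im * z.re → w ∈ openSector 2 (l + 1)) ∧
    (0 < w.re * z.im ∧ w.im * z.re < 0 → w ∈ openSector 2 (l + -1)) := by
  rw [mem_openSector_two_iff] at hz
  obtain ⟨h1, h2⟩ := hz
  constructor
  · intro h
    obtain ⟨h3, h4⟩ := (cross_mul_I_zpow z w (-l)).2 h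
    have h5 : (w * I ^ (-l)).re < 0 := by nlinarith
    have h6 : 0 < (w * I ^ (-l)).im := (pos_iff_pos_of_mul_pos h4).2 h1
    rw [mem_openSector_two_iff, show -(l + 1) = -l + -1 by ring, zpow_add₀ Complex.I_ne_zero,
      zpow_neg_one, Complex.inv_I, ← mul_assoc, mul_neg, Complex.neg_re, Complex.neg_im,
      Complex.mul_I_re, Complex.mul_I_im]
    constructor <;> linarith
  · rintro ⟨h, h'⟩
    obtain ⟨h3, h4⟩ := (cross_mul_I_zpow z (-w) (-l)).2
      ⟨by rw [Complex.neg_re]; linarith, by rw [Complex.neg_im]; linarith⟩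
    rw [neg_mul, Complex.neg_re] at h3
    rw [neg_mul, Complex.neg_im] at h4
    have h5 : 0 < (w * I ^ (-l)).re := by nlinarith
    have h6 : (w * I ^ (-l)).im < 0 := by nlinarith
    rw [mem_openSector_two_iff, show -(l + -1) = -l + 1 by ring, zpow_add_one₀ Complex.I_ne_zero,
      ← mul_assoc, Complex.mul_I_re, Complex.mul_I_im]
    constructor <;> linarith

end Sectors

/-! ### The three distributions of `α`-points. -/

namespace PowerForm

open Complex ComplexConjugate

variable {ι κ : Type*} {d : PowerForm ι κ} {α : ℂ} {j : ℤ} {ω : ℕ∞} {z : ℕ → ℂ}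

lemma pointPhase_congr {z w : ℂ} (h : ‖z‖ = ‖w‖) : d.pointPhase α z = d.pointPhase α w := by
  rw [pointPhase, pointPhase, h]

lemma neg_one_zpow_mul_self (j : ℤ) : (-1 : ℝ) ^ j * (-1 : ℝ) ^ j = 1 := by
  rw [← abs_mul_abs_self, abs_neg_one_zpow_eq, one_mul]

theorem distributionGeneric (hj : j < 0) (hp : d.p = 2 * j + 1) (h2 : (α ^ 2).im ≠ 0)
    (E : IsAlphaEnumeration d.eval α ω z) : DistributionGeneric j d.eval α ω z := by
  have hodd := odd_of_eq hp
  obtain ⟨hre, him⟩ := re_ne_zero_and_im_ne_zero h2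
  have hα : α ≠ 0 := by rintro rfl; simp at hre
  have H := classIndex_generic (d := d) hj hp h2
  -- One point per class: the entry `n` has class `n - 1`, so its phase lies in the quarter number
  -- `2 * j + n`.
  have hb : ∀ n : ℕ, 1 ≤ n → (n : ℕ∞) ≤ ω →
      (2 * j + n : ℝ) * (Real.pi / 2) < d.pointPhase α (z n) ∧
      d.pointPhase α (z n) < (2 * j + n + 1 : ℝ) * (Real.pi / 2) := by
    intro n h1 h3
    have h4 := E.class_bounds H h1 h3
    simp only [Finset.sum_const, Finset.card_range, smul_eq_mul, mul_one] at h4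
    have h5 := genericClass_bounds hj hp h2 (E.isAlphaPoint n h1 h3)
    have e : (2 * j + 1 + d.genericClass α j (z n) : ℤ) = 2 * j + n := by omega
    rw [e] at h5
    push_cast at h5
    exact h5
  refine ⟨fun n h1 h3 => ?_, fun n h1 h3 => ?_, fun h1 => ?_⟩
  · have hz := E.isAlphaPoint n h1 h3
    have a1 := re_mul_cos_pos hodd hα hre hz
    have a2 := im_mul_sin_pos hodd hα him hz
    refine ⟨alphaMult_generic hodd h2 hz, norm_pos_iff.2 (ne_zero_of_eval hodd hα hz).1, ?_⟩
    have r0 : (z n).re ≠ 0 := by intro h; rw [h] at a1; simp at a1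
    have i0 : (z n).im ≠ 0 := by intro h; rw [h] at a2; simp at a2
    rw [sq, Complex.mul_im, mul_comm (z n).im, ← two_mul]
    exact mul_ne_zero two_ne_zero (mul_ne_zero r0 i0)
  · have h3' : (n : ℕ∞) ≤ ω := le_trans (by exact_mod_cast Nat.le_succ n) h3
    have hz := E.isAlphaPoint n h1 h3'
    have hz' := E.isAlphaPoint (n + 1) (by omega) h3
    obtain ⟨b1, b2⟩ := hb n h1 h3'
    obtain ⟨c1, c2⟩ := hb (n + 1) (by omega) h3
    push_cast at c1 c2
    have hlt : d.pointPhase α (z n) < d.pointPhase α (z (n + 1)) := by linarith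
    refine ⟨lt_of_le_of_ne (E.norm_le n h1 h3) fun h => hlt.ne (pointPhase_congr h),
      fun l hl => ?_⟩
    -- Shifting the phase of the next point back by `π / 2` brings it into the same quarter, which
    -- relates cosine and sine of consecutive points.
    have s1 : 0 < Real.sin (d.pointPhase α (z n)) *
        Real.sin (d.pointPhase α (z (n + 1)) - Real.pi / 2) := by
      refine sin_mul_sin_pos (m := 2 * j + n) ?_ ?_ ?_ ?_ <;> push_cast <;> linarith
    have s2 : 0 < Real.cos (d.pointPhase α (z n)) *
        Real.cos (d.pointPhase α (z (n + 1)) - Real.pi / 2) := by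
      refine cos_mul_cos_pos (m := 2 * j + n) ?_ ?_ ?_ ?_ <;> push_cast <;> linarith
    rw [Real.sin_sub_pi_div_two] at s1
    rw [Real.cos_sub_pi_div_two] at s2
    have a1 := re_mul_cos_pos hodd hα hre hz
    have a2 := im_mul_sin_pos hodd hα him hz
    have a1' := re_mul_cos_pos hodd hα hre hz'
    have a2' := im_mul_sin_pos hodd hα him hz'
    set C := Real.cos (d.pointPhase α (z n))
    set S := Real.sin (d.pointPhase α (z n))
    set C' := Real.cos (d.pointPhase α (z (n + 1)))
    set S' := Real.sin (d.pointPhase α (z (n + 1)))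
    have t1 : 0 < -((z (n + 1)).re * (z n).im) * (α.re * α.im) := by
      have := mul_pos (mul_pos a1' a2) s1
      have e : (z (n + 1)).re * α.re * C' * ((z n).im * α.im * S) * (S * -C') =
          (-((z (n + 1)).re * (z n).im) * (α.re * α.im)) * (C' * S) ^ 2 := by ring
      rw [e] at this
      exact pos_of_mul_pos_left this (sq_nonneg _)
    have t2 : 0 < (z (n + 1)).im * (z n).re * (α.re * α.im) := by
      have := mul_pos (mul_pos a2' a1) s2
      have e : (z (n + 1)).im * α.im * S' * ((z n).re * α.re * C) * (C * S') =
          ((z (n + 1)).im * (z n).re * (α.re * α.im)) * (C * S') ^ 2 := by ring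
      rw [e] at this
      exact pos_of_mul_pos_left this (sq_nonneg _)
    have e2 : (α ^ 2).im = 2 * (α.re * α.im) := by rw [sq, Complex.mul_im]; ring
    rcases lt_or_gt_of_ne h2 with h | h
    · rw [sign_neg h]
      rw [e2] at h
      have h' : α.re * α.im < 0 := by linarith
      exact (mem_openSector_next hl).2 ⟨by nlinarith, by nlinarith⟩
    · rw [sign_pos h]
      rw [e2] at h
      have h' : 0 < α.re * α.im := by linarith
      exact (mem_openSector_next hl).1 ⟨by nlinarith, by nlinarith⟩
  · have hz := E.isAlphaPoint 1 le_rfl (by exact_mod_cast h1)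
    obtain ⟨b1, b2⟩ := hb 1 le_rfl (by exact_mod_cast h1)
    push_cast at b1 b2
    have a1 := re_mul_cos_pos hodd hα hre hz
    have a2 := im_mul_sin_pos hodd hα him hz
    set x := d.pointPhase α (z 1)
    have hs : 0 < (-1 : ℝ) ^ j * Real.sin x := by
      have h3 := Real.sin_add_int_mul_pi (x - j * Real.pi) j
      rw [sub_add_cancel] at h3
      rw [h3, ← mul_assoc, neg_one_zpow_mul_self, one_mul]
      exact Real.sin_pos_of_pos_of_lt_pi (by linarith [Real.pi_pos]) (by linarith)
    have hc : (-1 : ℝ) ^ j * Real.cos x < 0 := by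
      have h3 := Real.cos_add_int_mul_pi (x - j * Real.pi) j
      rw [sub_add_cancel] at h3
      rw [h3, ← mul_assoc, neg_one_zpow_mul_self, one_mul]
      exact Real.cos_neg_of_pi_div_two_lt_of_lt (by linarith) (by linarith [Real.pi_pos])
    constructor
    · have := mul_pos a2 hs
      have e : (z 1).im * α.im * Real.sin x * ((-1 : ℝ) ^ j * Real.sin x) =
          ((-1 : ℝ) ^ j * α.im * (z 1).im) * Real.sin x ^ 2 := by ring
      rw [e] at this
      exact pos_of_mul_pos_left this (sq_nonneg _)
    · have h3 := mul_pos (mul_pos a1 a2) (mul_pos_of_neg_of_neg hc (neg_neg_of_pos hs))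
      have e : (z 1).re * α.re * Real.cos x * ((z 1).im * α.im * Real.sin x) *
          ((-1 : ℝ) ^ j * Real.cos x * -((-1 : ℝ) ^ j * Real.sin x)) =
          -((α ^ 2).im * (z 1).re * (z 1).im) *
            (((-1 : ℝ) ^ j * (-1 : ℝ) ^ j) * (Real.cos x * Real.sin x) ^ 2 / 2) := by
        rw [sq α, Complex.mul_im]; ring
      rw [e, neg_one_zpow_mul_self] at h3
      have := pos_of_mul_pos_left h3 (by positivity)
      linarith

lemma theta_eq_zero_of_im (hodd : Odd d.p) (hα : α ≠ 0) (hre : α.re ≠ 0) {z : ℂ}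
    (hz : d.eval z = α) :
    d.theta (Real.log ‖α‖) (Real.log ‖z‖) < Real.pi / 2 ∧
    (z.im = 0 ↔ d.theta (Real.log ‖α‖) (Real.log ‖z‖) = 0) := by
  obtain ⟨σ, ρ, l, e⟩ := exists_levelPoint hodd hα hz
  have hc : d.theta (Real.log ‖α‖) (Real.log ‖z‖) < Real.pi / 2 := by
    refine theta_lt_of_cos_ne_zero hodd fun h => ?_
    have := l.cos
    rw [h, mul_zero, eq_comm, mul_eq_zero] at this
    exact this.elim l.sign_re.ne_zero hre
  refine ⟨hc, ?_⟩
  have h1 : z.im = _ := (congrArg Complex.im e).trans (lift_im _ _ _ _)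
  rw [h1]
  constructor
  · intro h
    by_contra hne
    have h0 := lt_of_le_of_ne (theta_mem (d := d) (Real.log ‖α‖) (Real.log ‖z‖)).1 (Ne.symm hne)
    have := mul_pos (Real.exp_pos (Real.log ‖z‖))
      (Real.sin_pos_of_pos_of_lt_pi h0 (by linarith [Real.pi_pos]))
    exact mul_ne_zero l.sign_im.ne_zero this.ne' h
  · intro h
    rw [h, Real.sin_zero, mul_zero, mul_zero]

lemma theta_eq_pi_div_two_of_re (hodd : Odd d.p) (hα : α ≠ 0) (him : α.im ≠ 0) {z : ℂ}
    (hz : d.eval z = α) :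
    0 < d.theta (Real.log ‖α‖) (Real.log ‖z‖) ∧
    (z.re = 0 ↔ d.theta (Real.log ‖α‖) (Real.log ‖z‖) = Real.pi / 2) := by
  obtain ⟨σ, ρ, l, e⟩ := exists_levelPoint hodd hα hz
  have hc : 0 < d.theta (Real.log ‖α‖) (Real.log ‖z‖) := by
    refine theta_pos_of_sin_ne_zero fun h => ?_
    have := l.sin
    rw [h, mul_zero, eq_comm, mul_eq_zero] at this
    exact this.elim l.sign_im.ne_zero him
  refine ⟨hc, ?_⟩
  have h1 : z.re = _ := (congrArg Complex.re e).trans (lift_re _ _ _ _)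
  rw [h1]
  constructor
  · intro h
    by_contra hne
    have h0 := lt_of_le_of_ne (theta_mem (d := d) (Real.log ‖α‖) (Real.log ‖z‖)).2 hne
    have := mul_pos (Real.exp_pos (Real.log ‖z‖))
      (Real.cos_pos_of_mem_Ioo ⟨by linarith [Real.pi_pos], h0⟩)
    exact mul_ne_zero l.sign_re.ne_zero this.ne' h
  · intro h
    rw [h, Real.cos_pi_div_two, mul_zero, mul_zero]

lemma alphaMult_real_axis (hodd : Odd d.p) (hα : α ≠ 0) {z : ℂ} (hz : d.eval z = α)
    (h : z.im = 0 ∨ z.re = 0) : alphaMult d.eval α z = 1 ∨ alphaMult d.eval α z = 2 := by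
  have e : z ^ 2 = (((z ^ 2).re : ℝ) : ℂ) := by
    apply Complex.ext
    · simp
    · rw [Complex.ofReal_im, sq, Complex.mul_im]
      rcases h with h | h <;> simp [h]
  obtain ⟨h1, h2⟩ := alphaMult_edge hodd hα hz e
  by_cases h0 : (d.logSlope (((z ^ 2).re : ℝ) : ℂ)).re = 0
  · exact Or.inr (h1 h0)
  · exact Or.inl (h2 h0)

lemma alphaMult_off_axes (hodd : Odd d.p) (hα : α ≠ 0) {z : ℂ} (hz : d.eval z = α)
    (him : z.im ≠ 0) (hre : z.re ≠ 0) : alphaMult d.eval α z = 1 := by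
  obtain ⟨h0, hw⟩ := ne_zero_of_eval hodd hα hz
  have := alphaMult_eq_one h0 hw (logSlope_ne_zero_of_im hw ?_)
  · rwa [hz] at this
  · rw [sq, Complex.mul_im, mul_comm z.im, ← two_mul]
    exact mul_ne_zero two_ne_zero (mul_ne_zero hre him)

/-- A simple point occupies a single index of the list. -/
lemma ne_of_alphaMult_one (E : IsAlphaEnumeration d.eval α ω z) {m n : ℕ} (hm : 1 ≤ m)
    (hmn : m < n) (hn : (n : ℕ∞) ≤ ω) (h : alphaMult d.eval α (z m) = 1) : z m ≠ z n := by
  intro he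
  have hm' : (m : ℕ∞) ≤ ω := le_trans (by exact_mod_cast hmn.le) hn
  have h1 := E.count (z m) (E.isAlphaPoint m hm hm')
  rw [h, Set.encard_eq_one] at h1
  obtain ⟨x, hx⟩ := h1
  have h2 : m ∈ ({x} : Set ℕ) := hx ▸ ⟨hm, hm', rfl⟩
  have h3 : n ∈ ({x} : Set ℕ) := hx ▸ ⟨hm.trans hmn.le, hn, he.symm⟩
  rw [Set.mem_singleton_iff] at h2 h3
  omega

lemma cos_int_mul_pi_eq (j : ℤ) : Real.cos (j * Real.pi) = (-1 : ℝ) ^ j := by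
  have := Real.cos_add_int_mul_pi 0 j
  rwa [zero_add, Real.cos_zero, mul_one] at this

lemma cos_int_succ_mul_pi (j : ℤ) :
    Real.cos ((j + 1 : ℤ) * Real.pi) = -Real.cos (j * Real.pi) := by
  rw [cos_int_mul_pi_eq, cos_int_mul_pi_eq, zpow_add_one₀ (by norm_num)]
  ring

theorem distributionReal (hj : j < 0) (hp : d.p = 2 * j + 1) (hα : α ≠ 0) (him : α.im = 0)
    (E : IsAlphaEnumeration d.eval α ω z) : DistributionReal j d.eval α ω z := by
  have hodd := odd_of_eq hp
  have hre : α.re ≠ 0 := fun h => hα (Complex.ext h him)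
  have H := classIndex_real (d := d) hj hp hα him
  have hphase : ∀ n : ℕ, 1 ≤ n → (n : ℕ∞) ≤ ω → ∀ k : ℕ, n = 2 * k + 1 ∨ n = 2 * k + 2 →
      d.pointPhase α (z n) = (j + 1 + k : ℤ) * Real.pi := by
    intro n h1 h3 k hk
    have h4 := E.class_bounds H h1 h3
    simp only [Finset.sum_const, Finset.card_range, smul_eq_mul] at h4
    rw [pointPhase_eq_realClass hj hp hα him (E.isAlphaPoint n h1 h3)]
    have : d.realClass α j (z n) = k := by omega
    rw [this]
  have hre0 : ∀ n : ℕ, 1 ≤ n → (n : ℕ∞) ≤ ω → (z n).re ≠ 0 := by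
    intro n h1 h3 h
    have := re_mul_cos_pos hodd hα hre (E.isAlphaPoint n h1 h3)
    rw [h] at this
    simp at this
  refine ⟨fun n h1 h3 => ?_, fun n h1 h3 => ?_, fun n h1 h3 => ?_, fun h1 => ?_, fun h1 hlt => ?_⟩
  · have hz := E.isAlphaPoint n h1 h3
    exact ⟨norm_pos_iff.2 (ne_zero_of_eval hodd hα hz).1, hre0 n h1 h3,
      fun h => alphaMult_real_axis hodd hα hz (Or.inl h),
      fun h => alphaMult_off_axes hodd hα hz h (hre0 n h1 h3)⟩
  · have h3' : ((2 * n - 1 : ℕ) : ℕ∞) ≤ ω := le_trans (by exact_mod_cast Nat.sub_le _ _) h3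
    have hz := E.isAlphaPoint (2 * n - 1) (by omega) h3'
    have hz' := E.isAlphaPoint (2 * n) (by omega) h3
    have hp1 := hphase (2 * n - 1) (by omega) h3' (n - 1) (by omega)
    have hp2 := hphase (2 * n) (by omega) h3 (n - 1) (by omega)
    have heq : d.pointPhase α (z (2 * n - 1)) = d.pointPhase α (z (2 * n)) := hp1.trans hp2.symm
    obtain ⟨σ, ρ, l, e⟩ := exists_levelPoint hodd hα hz
    obtain ⟨σ', ρ', l', e'⟩ := exists_levelPoint hodd hα hz'
    have hσ : σ = σ' := by
      have h4 := l.cos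
      have h5 := l'.cos
      change _ * Real.cos (d.pointPhase α _) = _ at h4 h5
      rw [← heq, h4] at h5
      exact mul_right_cancel₀ hre h5
    subst hσ
    refine ⟨E.norm_mono (by omega) (Nat.sub_le _ _) h3, fun hn => ?_, fun hn => ?_⟩
    · rw [← hn] at e'
      have hr : (z (2 * n - 1)).re = (z (2 * n)).re := by
        conv_lhs => rw [e]
        conv_rhs => rw [e']
        rw [lift_re, lift_re]
      by_cases hi : (z (2 * n - 1)).im = 0
      · have hi' : (z (2 * n)).im = 0 := by
          rw [(theta_eq_zero_of_im hodd hα hre hz').2, ← hn,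
            ← (theta_eq_zero_of_im hodd hα hre hz).2, hi]
        apply Complex.ext
        · rw [Complex.conj_re, hr]
        · rw [Complex.conj_im, hi, hi', neg_zero]
      · have hne := ne_of_alphaMult_one E (by omega) (by omega : 2 * n - 1 < 2 * n) h3
          -- A nonreal point is simple, so the two entries differ. Modulus and `σ` agree, hence only
          -- `ρ` can distinguish them.
          (alphaMult_off_axes hodd hα hz hi (hre0 _ (by omega) h3'))
        have hρ : ρ' = -ρ := by
          rcases l.sign_im with h4 | h4 <;> rcases l'.sign_im with h5 | h5
          · exact absurd (by rw [e, e', h4, h5]) hne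
          · rw [h4, h5]
          · rw [h4, h5]; norm_num
          · exact absurd (by rw [e, e', h4, h5]) hne
        apply Complex.ext
        · rw [Complex.conj_re, hr]
        · have h4 : (z (2 * n - 1)).im = _ := (congrArg Complex.im e).trans (lift_im _ _ _ _)
          have h5 : (z (2 * n)).im = _ := (congrArg Complex.im e').trans (lift_im _ _ _ _)
          rw [Complex.conj_im, h4, h5, hρ]
          ring
    -- Equal phase at different radii puts both points on the real edge, on the half axis of sign
    -- `σ`.
    · have hlog : Real.log ‖z (2 * n - 1)‖ ≠ Real.log ‖z (2 * n)‖ :=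
        (Real.log_lt_log (norm_pos_iff.2 (ne_zero_of_eval hodd hα hz).1) hn).ne
      have hth := (theta_edge_of_ne hlog heq).resolve_right (theta_eq_zero_of_im hodd hα hre hz).1.ne
      have hth' := (theta_edge_of_ne hlog.symm heq.symm).resolve_right
        (theta_eq_zero_of_im hodd hα hre hz').1.ne
      have f : z (2 * n - 1) = ((σ * Real.exp (Real.log ‖z (2 * n - 1)‖) : ℝ) : ℂ) := by
        conv_lhs => rw [e]
        apply Complex.ext
        · rw [lift_re, hth, Real.cos_zero, mul_one, Complex.ofReal_re]
        · rw [lift_im, hth, Real.sin_zero, mul_zero, mul_zero, Complex.ofReal_im]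
      have f' : z (2 * n) = ((σ * Real.exp (Real.log ‖z (2 * n)‖) : ℝ) : ℂ) := by
        conv_lhs => rw [e']
        apply Complex.ext
        · rw [lift_re, hth', Real.cos_zero, mul_one, Complex.ofReal_re]
        · rw [lift_im, hth', Real.sin_zero, mul_zero, mul_zero, Complex.ofReal_im]
      have p1 := Real.exp_pos (Real.log ‖z (2 * n - 1)‖)
      have p2 := Real.exp_pos (Real.log ‖z (2 * n)‖)
      rcases l.sign_re with h4 | h4
      · rw [f, f', h4, Complex.arg_ofReal_of_nonneg (by linarith),
          Complex.arg_ofReal_of_nonneg (by linarith)]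
        exact ⟨rfl, Or.inl rfl⟩
      · rw [f, f', h4, Complex.arg_ofReal_of_neg (by linarith),
          Complex.arg_ofReal_of_neg (by linarith)]
        exact ⟨rfl, Or.inr rfl⟩
  · have h3' : ((2 * n : ℕ) : ℕ∞) ≤ ω := le_trans (by exact_mod_cast Nat.le_succ _) h3
    have hz := E.isAlphaPoint (2 * n) (by omega) h3'
    have hz' := E.isAlphaPoint (2 * n + 1) (by omega) h3
    have hp1 := hphase (2 * n) (by omega) h3' (n - 1) (by omega)
    have hp2 := hphase (2 * n + 1) (by omega) h3 n (by omega)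
    have en : (j + 1 + n : ℤ) = (j + 1 + (n - 1 : ℕ)) + 1 := by omega
    rw [en] at hp2
    constructor
    · refine lt_of_le_of_ne (E.norm_le _ (by omega) h3) fun h => ?_
      have := pointPhase_congr (d := d) (α := α) h
      rw [hp1, hp2] at this
      have := Int.cast_injective (mul_right_cancel₀ Real.pi_ne_zero this)
      omega
    · have a1 := re_mul_cos_pos hodd hα hre hz
      have a2 := re_mul_cos_pos hodd hα hre hz'
      rw [hp1] at a1
      rw [hp2, cos_int_succ_mul_pi] at a2
      set C := Real.cos ((j + 1 + (n - 1 : ℕ) : ℤ) * Real.pi)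
      have h4 := mul_pos a1 a2
      have e : (z (2 * n)).re * α.re * C * ((z (2 * n + 1)).re * α.re * -C) =
          -((z (2 * n)).re * (z (2 * n + 1)).re) * (α.re * C) ^ 2 := by ring
      rw [e] at h4
      have := pos_of_mul_pos_left h4 (sq_nonneg _)
      linarith
  · have h1' : ((1 : ℕ) : ℕ∞) ≤ ω := by exact_mod_cast h1
    have a1 := re_mul_cos_pos hodd hα hre (E.isAlphaPoint 1 le_rfl h1')
    rw [hphase 1 le_rfl h1' 0 (by omega)] at a1
    simp only [Nat.cast_zero, add_zero] at a1
    rw [cos_int_succ_mul_pi, cos_int_mul_pi_eq] at a1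
    linarith
  · have h1' : ((2 : ℕ) : ℕ∞) ≤ ω := by exact_mod_cast h1
    have h0' : ((1 : ℕ) : ℕ∞) ≤ ω := le_trans (by norm_num) h1'
    have hz := E.isAlphaPoint 1 le_rfl h0'
    have hp1 := hphase 1 le_rfl h0' 0 (by omega)
    have hp2 := hphase 2 (by omega) h1' 0 (by omega)
    have hlog := (Real.log_lt_log (norm_pos_iff.2 (ne_zero_of_eval hodd hα hz).1) hlt).ne
    have hth := (theta_edge_of_ne hlog (hp1.trans hp2.symm)).resolve_right
      (theta_eq_zero_of_im hodd hα hre hz).1.ne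
    have h4 := (phase_of_theta_eq_zero hth).1
    change 0 ≤ d.pointPhase α (z 1) at h4
    rw [hp1] at h4
    -- The common phase `(j + 1) * π` occurs on the real edge, where phases are nonnegative; with `j
    -- < 0` this leaves `j = -1`.
    have h5 : (0 : ℝ) ≤ (j + 1 + (0 : ℕ) : ℤ) := by
      by_contra! hc
      linarith [mul_neg_of_neg_of_pos hc Real.pi_pos]
    have h6 : (0 : ℤ) ≤ j + 1 + (0 : ℕ) := by exact_mod_cast h5
    omega

lemma sum_range_one_two (k : ℕ) :
    ∑ i ∈ Finset.range (k + 1), (if i = 0 then 1 else 2) = 2 * k + 1 := by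
  induction k with
  | zero => simp
  | succ k ih => rw [Finset.sum_range_succ, ih]; simp; ring

theorem distributionImaginary (hj : j < 0) (hp : d.p = 2 * j + 1) (hα : α ≠ 0) (hre : α.re = 0)
    (E : IsAlphaEnumeration d.eval α ω z) : DistributionImaginary j d.eval α ω z := by
  have hodd := odd_of_eq hp
  have him : α.im ≠ 0 := fun h => hα (Complex.ext hre h)
  have H := classIndex_imag (d := d) hj hp hα hre
  -- Class `0` consists of the index `1` alone, which shifts the pairing by one compared with real
  -- `α`.
  have hphase : ∀ n : ℕ, 1 ≤ n → (n : ℕ∞) ≤ ω → ∀ k : ℕ, n = 2 * k ∨ n = 2 * k + 1 →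
      d.pointPhase α (z n) = (j + k : ℤ) * Real.pi + Real.pi / 2 := by
    intro n h1 h3 k hk
    have h4 := E.class_bounds H h1 h3
    rw [sum_range_one_two] at h4
    rw [pointPhase_eq_imagClass hj hp hα hre (E.isAlphaPoint n h1 h3)]
    have : d.imagClass α j (z n) = k := by
      obtain ⟨h5, h6⟩ := h4
      rcases Nat.eq_zero_or_pos (d.imagClass α j (z n)) with h7 | h7
      · omega
      · obtain ⟨q, hq⟩ : ∃ q, d.imagClass α j (z n) = q + 1 := ⟨_, (Nat.succ_pred_eq_of_pos h7).symm⟩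
        rw [hq, sum_range_one_two] at h5
        omega
    rw [this]
  have him0 : ∀ n : ℕ, 1 ≤ n → (n : ℕ∞) ≤ ω → (z n).im ≠ 0 := by
    intro n h1 h3 h
    have := im_mul_sin_pos hodd hα him (E.isAlphaPoint n h1 h3)
    rw [h] at this
    simp at this
  refine ⟨fun n h1 h3 => ?_, fun n h1 h3 => ?_, fun n h1 h3 => ?_, fun h1 => ?_⟩
  · have hz := E.isAlphaPoint n h1 h3
    exact ⟨norm_pos_iff.2 (ne_zero_of_eval hodd hα hz).1, him0 n h1 h3,
      fun h => alphaMult_real_axis hodd hα hz (Or.inr h),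
      fun h => alphaMult_off_axes hodd hα hz (him0 n h1 h3) h⟩
  · have h3' : ((2 * n - 1 : ℕ) : ℕ∞) ≤ ω := le_trans (by exact_mod_cast Nat.sub_le _ _) h3
    have hz := E.isAlphaPoint (2 * n - 1) (by omega) h3'
    have hz' := E.isAlphaPoint (2 * n) (by omega) h3
    have hp1 := hphase (2 * n - 1) (by omega) h3' (n - 1) (by omega)
    have hp2 := hphase (2 * n) (by omega) h3 n (by omega)
    have en : (j + n : ℤ) = (j + (n - 1 : ℕ)) + 1 := by omega
    rw [en] at hp2
    constructor
    · refine lt_of_le_of_ne (E.norm_mono (by omega) (Nat.sub_le _ _) h3) fun h => ?_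
      have := pointPhase_congr (d := d) (α := α) h
      rw [hp1, hp2] at this
      have := Int.cast_injective (mul_right_cancel₀ Real.pi_ne_zero (add_right_cancel this))
      omega
    · have a1 := im_mul_sin_pos hodd hα him hz
      have a2 := im_mul_sin_pos hodd hα him hz'
      rw [hp1, Real.sin_add_pi_div_two] at a1
      rw [hp2, Real.sin_add_pi_div_two, cos_int_succ_mul_pi] at a2
      set C := Real.cos ((j + (n - 1 : ℕ) : ℤ) * Real.pi)
      have h4 := mul_pos a1 a2
      have e : (z (2 * n - 1)).im * α.im * C * ((z (2 * n)).im * α.im * -C) =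
          -((z (2 * n - 1)).im * (z (2 * n)).im) * (α.im * C) ^ 2 := by ring
      rw [e] at h4
      have := pos_of_mul_pos_left h4 (sq_nonneg _)
      linarith
  · have h3' : ((2 * n : ℕ) : ℕ∞) ≤ ω := le_trans (by exact_mod_cast Nat.le_succ _) h3
    have hz := E.isAlphaPoint (2 * n) (by omega) h3'
    have hz' := E.isAlphaPoint (2 * n + 1) (by omega) h3
    have hp1 := hphase (2 * n) (by omega) h3' n (by omega)
    have hp2 := hphase (2 * n + 1) (by omega) h3 n (by omega)
    have heq : d.pointPhase α (z (2 * n)) = d.pointPhase α (z (2 * n + 1)) := hp1.trans hp2.symm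
    obtain ⟨σ, ρ, l, e⟩ := exists_levelPoint hodd hα hz
    obtain ⟨σ', ρ', l', e'⟩ := exists_levelPoint hodd hα hz'
    have hρ : ρ = ρ' := by
      have h4 := l.sin
      have h5 := l'.sin
      change _ * Real.sin (d.pointPhase α _) = _ at h4 h5
      rw [← heq, h4] at h5
      exact mul_right_cancel₀ him h5
    subst hρ
    refine ⟨E.norm_le _ (by omega) h3, fun hn => ?_, fun hn => ?_⟩
    · rw [← hn] at e'
      have hi : (z (2 * n)).im = (z (2 * n + 1)).im := by
        conv_lhs => rw [e]
        conv_rhs => rw [e']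
        rw [lift_im, lift_im]
      by_cases hr : (z (2 * n)).re = 0
      · have hr' : (z (2 * n + 1)).re = 0 := by
          rw [(theta_eq_pi_div_two_of_re hodd hα him hz').2, ← hn,
            ← (theta_eq_pi_div_two_of_re hodd hα him hz).2, hr]
        apply Complex.ext
        · rw [Complex.neg_re, Complex.conj_re, hr, hr', neg_zero]
        · rw [Complex.neg_im, Complex.conj_im, neg_neg, hi]
      · have hne := ne_of_alphaMult_one E (by omega) (by omega : 2 * n < 2 * n + 1) h3
          (alphaMult_off_axes hodd hα hz (him0 _ (by omega) h3') hr)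
        have hσ : σ' = -σ := by
          rcases l.sign_re with h4 | h4 <;> rcases l'.sign_re with h5 | h5
          · exact absurd (by rw [e, e', h4, h5]) hne
          · rw [h4, h5]
          · rw [h4, h5]; norm_num
          · exact absurd (by rw [e, e', h4, h5]) hne
        apply Complex.ext
        · have h4 : (z (2 * n)).re = _ := (congrArg Complex.re e).trans (lift_re _ _ _ _)
          have h5 : (z (2 * n + 1)).re = _ := (congrArg Complex.re e').trans (lift_re _ _ _ _)
          rw [Complex.neg_re, Complex.conj_re, h4, h5, hσ]
          ring
        · rw [Complex.neg_im, Complex.conj_im, neg_neg, hi]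
    · have hlog : Real.log ‖z (2 * n)‖ ≠ Real.log ‖z (2 * n + 1)‖ :=
        (Real.log_lt_log (norm_pos_iff.2 (ne_zero_of_eval hodd hα hz).1) hn).ne
      have hth := (theta_edge_of_ne hlog heq).resolve_left
        (theta_eq_pi_div_two_of_re hodd hα him hz).1.ne'
      have hth' := (theta_edge_of_ne hlog.symm heq.symm).resolve_left
        (theta_eq_pi_div_two_of_re hodd hα him hz').1.ne'
      have r1 := (theta_eq_pi_div_two_of_re hodd hα him hz).2.2 hth
      have r2 := (theta_eq_pi_div_two_of_re hodd hα him hz').2.2 hth'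
      have i1 : (z (2 * n)).im = ρ * Real.exp (Real.log ‖z (2 * n)‖) := by
        conv_lhs => rw [e]
        rw [lift_im, hth, Real.sin_pi_div_two, mul_one]
      have i2 : (z (2 * n + 1)).im = ρ * Real.exp (Real.log ‖z (2 * n + 1)‖) := by
        conv_lhs => rw [e']
        rw [lift_im, hth', Real.sin_pi_div_two, mul_one]
      have p1 := Real.exp_pos (Real.log ‖z (2 * n)‖)
      have p2 := Real.exp_pos (Real.log ‖z (2 * n + 1)‖)
      rcases l.sign_im with h4 | h4
      · have q1 := Complex.arg_eq_pi_div_two_iff.2 ⟨r1, by rw [i1, h4]; linarith⟩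
        have q2 := Complex.arg_eq_pi_div_two_iff.2 ⟨r2, by rw [i2, h4]; linarith⟩
        exact ⟨q1.trans q2.symm, Or.inr q2⟩
      · have q1 := Complex.arg_eq_neg_pi_div_two_iff.2 ⟨r1, by rw [i1, h4]; linarith⟩
        have q2 := Complex.arg_eq_neg_pi_div_two_iff.2 ⟨r2, by rw [i2, h4]; linarith⟩
        have e3 : -Real.pi / 2 = -(Real.pi / 2) := neg_div _ _
        exact ⟨q1.trans q2.symm, Or.inl (by linarith)⟩
  · have h1' : ((1 : ℕ) : ℕ∞) ≤ ω := by exact_mod_cast h1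
    have hz := E.isAlphaPoint 1 le_rfl h1'
    have hp1 := hphase 1 le_rfl h1' 0 (by omega)
    constructor
    · have a1 := im_mul_sin_pos hodd hα him hz
      rw [hp1, Real.sin_add_pi_div_two] at a1
      simp only [Nat.cast_zero, add_zero] at a1
      rw [cos_int_mul_pi_eq] at a1
      linarith
    · obtain ⟨hth, hiff⟩ := theta_eq_pi_div_two_of_re hodd hα him hz
      rw [hiff]
      obtain ⟨s₀, h₀⟩ := phase_near_bot (neg_of_eq hj hp) (Real.log ‖α‖)
      set s := Real.log ‖z 1‖
      have hlt : min s₀ (s - 1) < s := (min_le_right _ _).trans_lt (by linarith)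
      -- The first point has the initial phase, which is also taken at smaller radii; so the curve
      -- is on an edge at `z 1`, and it can only be the imaginary one.
      have heq : d.phase (Real.log ‖α‖) s = d.phase (Real.log ‖α‖) (min s₀ (s - 1)) := by
        rw [h₀ _ (min_le_left _ _), hp]
        refine hp1.trans ?_
        push_cast
        ring
      exact (theta_edge_of_ne hlt.ne' heq).resolve_left hth.ne'

/-- The function in the statement is given by a `PowerForm`. -/
lemma exists_of_hasKthPowerForm {p : ℤ} {F : ℂ → ℂ} (hF : HasKthPowerForm 2 p F) :
    ∃ (ω₁ ω₂ : ℕ∞) (d : PowerForm (IndexUpTo ω₁) (IndexUpTo ω₂)), d.p = p ∧ F = d.eval := by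
  obtain ⟨-, -, ⟨A, ω₁, ω₂, a, b, hA, ha, hb, hsa, hsb, rfl⟩, hne⟩ := hF
  -- With `A = 0` and both products empty the function would be `z ^ p`.
  have hnt : 0 < A ∨ Nonempty (IndexUpTo ω₁) ∨ Nonempty (IndexUpTo ω₂) := by
    by_contra! h
    obtain ⟨h1, h2, h3⟩ := h
    refine hne (funext fun z => ?_)
    have hA0 : A = 0 := le_antisymm h1 hA
    rw [kthPowerForm, hA0, tprod_empty, tprod_empty]
    simp
  refine ⟨ω₁, ω₂, ⟨p, A, fun ν => a ν, fun μ => b μ, hA, ha, hb, hsa, hsb, hnt⟩, rfl, ?_⟩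
  funext z
  simp only [kthPowerForm, eval, rootProd, neg_div, ← sub_eq_add_neg]

end PowerForm

theorem mainTheorem8 (j : ℤ) (hj : j < 0) (F : ℂ → ℂ) (hF : HasKthPowerForm 2 (2 * j + 1) F)
    (α : ℂ) (hα : α ≠ 0) :
    (∃ (ω : ℕ∞) (z : ℕ → ℂ), IsAlphaEnumeration F α ω z) ∧
    ∀ (ω : ℕ∞) (z : ℕ → ℂ), IsAlphaEnumeration F α ω z →
      ((α ^ 2).im ≠ 0 → DistributionGeneric j F α ω z) ∧
      (α.im = 0 → DistributionReal j F α ω z) ∧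
      (α.re = 0 → DistributionImaginary j F α ω z) := by
  obtain ⟨ω₁, ω₂, d, hp, rfl⟩ := PowerForm.exists_of_hasKthPowerForm hF
  refine ⟨?_, fun ω z E => ⟨fun h => PowerForm.distributionGeneric hj hp h E,
    fun h => PowerForm.distributionReal hj hp hα h E,
    fun h => PowerForm.distributionImaginary hj hp hα h E⟩⟩
  by_cases h2 : (α ^ 2).im = 0
  · have h3 : α.re * α.im = 0 := by
      rw [sq, Complex.mul_im] at h2
      linarith
    rcases mul_eq_zero.1 h3 with h | h
    · exact (PowerForm.classIndex_imag hj hp hα h).exists_enumeration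
    · exact (PowerForm.classIndex_real hj hp hα h).exists_enumeration
  · exact (PowerForm.classIndex_generic hj hp h2).exists_enumeration
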